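/- Let $\Bbbk$ be a field and let $(Q,I)$ be a graded gentle quiver: $Q=(Q_0,Q_1,s,t)$ is a finite quiver, every arrow $\alpha$ has a degree $|\alpha|\in\mathbb Z$, arrows are composed from right to left ($\beta\alpha$ is a path if $s(\beta)=t(\alpha)$), $I\subseteq \Bbbk Q$ is an ideal generated by paths of length two, every vertex is the source of at most two and the target of at most two arrows, and for every arrow $\alpha$ there is at most one arrow $\beta$ with $s(\beta)=t(\alpha)$ and $\beta\alpha\in I$, at most one with $s(\beta)=t(\alpha)$ and $\beta\alpha\notin I$, at most one arrow $\gamma$ with $s(\alpha)=t(\gamma)$ and $\alpha\gamma\in I$, and at most one with $s(\alpha)=t(\gamma)$ and $\alpha\gamma\notin I$. Assume that $Q$ has a spanning tree (so $Q$ is non-empty and connected) and that $Q$ is neither a single vertex with one loop nor the Kronecker quiver. Let $A=\Bbbk Q/I$ with the induced grading; $A$ is not assumed to be homologically smooth or proper. **Hochschild cohomology.** $C^{n,d}(A)$ is the space of homogeneous $\Bbbk$-linear maps $f\colon A^{\otimes n}\to A$ of degree $d$, with differential $C^{n,d}(A)\to C^{n+1,d}(A)$ $$d(f)=(-1)^{d}\Big(m(\mathbf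 1\otimes f)+(-1)^{n+1}m(f\otimes\mathbf 1)+\sum_{i=0}^{n-1}(-1)^{i+1}f(\mathbf 1^{\otimes i}\otimes m\otimes\mathbf 1^{\otimes(n-1-i)})\Big),$$ evaluated by the Koszul sign rule. $\mathrm{HH}^{n,d}(A,A)$ is its $n$-th cohomology. $\mathrm{HH}^i(A,A)$ is the cohomology of the product total complex, whose degree $i$ part is $\prod_{n\ge 0}C^{n,i-n}(A)$; its neighbourhoods of zero are the subspaces $W_j$ ($j\geq 0$) of classes of cocycles in $\prod_{n\ge j}C^{n,i-n}(A)$. **Paths and anti-paths.** A path $p=\alpha_1\cdots\alpha_l$ of $Q$ (of length $l(p)=l$ and degree $|p|=\sum|\alpha_i|$) is a *path of $A$* if $\alpha_i\alpha_{i+1}\notin I$ for all $1\le i<l$, and an *anti-path* if $\alpha_i\alpha_{i+1}\in I$ for all $1\le i<l$. A path of $A$ (resp. anti-path) with $l\ge1$ and $s(p)=t(p)$ is *complete* if moreover $\alpha_l\alpha_1\notin I$ (resp. $\alpha_l\alpha_1\in I$). Put $\mathrm{rot}(p)=\alpha_2\cdots\alpha_l\alpha_1$; the period of $p$ is the least $r\ge1$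 with $\mathrm{rot}^r(p)=p$, and rotation classes are the classes modulo $p\sim\mathrm{rot}(p)$. Put $\omega(p)=|p|-l(p)$ for a complete anti-path $p$ and $\omega(q)=-|q|$ for a complete path $q$. A path of $A$ (resp. anti-path) of positive length is *maximal* if it is not properly contained in a longer path of $A$ (resp. anti-path). For a maximal anti-path $u$, let $u_\circ$ be the path of $A$ (unique if it exists, possibly trivial) with the same source and target as $u$ whose first and last arrows, if it has any, differ from those of $u$; if there is none, write $u_\circ=\emptyset$. **Elements.** Let $p$ be an anti-path of length $n$ and $q$ a path of $A$ with $s(p)=s(q)$ and $t(p)=t(q)$. Then $(p,q)$ denotes the cochain in $C^{n,|q|-|p|}(A)$ which sends a tuple $v_1\otimes\cdots\otimes v_n$ of paths of $A$ to $\sum(-1)^{(|q|-|p|)|u|}\,u\,q\,w$, summed over all factorisations of the word $v_1\cdots v_n$ as $u\,p\,w$ (for $n=0$ this is the element $q\in A$); this is the image of $p^*q$ under the comparison map from the Bardzell complex to the Hochschild complex. For a complete anti-path $p=\alpha_1\cdots\alpha_n$ of period $r$ and a complete path $q=\beta_1\cdots\beta_m$ of period $r'$ set $$\mathcal N^0(p)=\sum_{i=0}^{r-1}(-1)^{in+|p||\alpha_1\cdots\alpha_i|}\big(\mathrm{rot}^i(p),e_{s(\mathrm{rot}^i(p))}\big),\qquad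 \mathcal N^1(p)=(\alpha_np,\alpha_n),$$ $$\mathcal N^0(q)=\sum_{i=0}^{r'-1}(-1)^{|q||\beta_1\cdots\beta_i|}\big(e_{s(\mathrm{rot}^i(q))},\mathrm{rot}^i(q)\big),\qquad \mathcal N^1(q)=(\beta_m,\beta_mq).$$ **Theorem.** Choose any spanning tree $T$ of $Q$ and any complete sets of representatives $\mathcal P^c$ (resp. $\mathcal Q^c$) of the rotation classes of complete anti-paths (resp. complete paths). Then for every $n\ge0$ and $d\in\mathbb Z$ the following elements are cocycles, and their classes form a $\Bbbk$-basis of $\mathrm{HH}^{n,d}(A,A)$: 1. the unit $\sum_{x\in Q_0}(e_x,e_x)$, if $(n,d)=(0,0)$; 2. $\mathcal N^s(p)$ for $p\in\mathcal P^c$, $s\in\{0,1\}$, with $(n,d)=(l(p)+s,-|p|)$, where $\omega(p)$ is even or $\operatorname{char}\Bbbk=2$; 3. $\mathcal N^s(q)$ for $q\in\mathcal Q^c$, $s\in\{0,1\}$, with $(n,d)=(s,|q|)$, where $\omega(q)$ is even or $\operatorname{char}\Bbbk=2$; 4. $(u,u_\circ)$ for maximal anti-paths $u$ with $u_\circ\ne\emptyset$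 and $(n,d)=(l(u),|u_\circ|-|u|)$; 5. $(e_{s(u)},u)$ for closed maximal paths $u$ of $A$ with $(n,d)=(0,|u|)$; 6. $(\alpha,\alpha)$ for arrows $\alpha\in Q_1\setminus T_1$, if $(n,d)=(1,0)$. Moreover, for every $i\in\mathbb Z$ the classes of all these elements with $n+d=i$ form a Schauder basis of $\mathrm{HH}^i(A,A)$: every class is in a unique way the limit, for the topology given by the $W_j$, of a possibly infinite linear combination of them. -/

import Mathlib

noncomputable section

/-! ### Bigraded and total Hochschild cohomology of a graded algebra -/

namespace Hochschild

variable {k B : Type*} [Field k] [Ring B] [Algebra k B]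

/-- `Hom_k(B^{⊗ n}, B)`, written as `n`-multilinear maps. -/
def Cochain (k B : Type*) [Field k] [Ring B] [Algebra k B] (n : ℕ) : Type _ :=
  MultilinearMap k (fun _ : Fin n => B) B

instance (n : ℕ) : AddCommGroup (Cochain k B n) :=
  inferInstanceAs (AddCommGroup (MultilinearMap k (fun _ : Fin n => B) B))

instance (n : ℕ) : Module k (Cochain k B n) :=
  inferInstanceAs (Module k (MultilinearMap k (fun _ : Fin n => B) B))

instance (n : ℕ) : FunLike (Cochain k B n) (Fin n → B) B :=
  inferInstanceAs (FunLike (MultilinearMap k (fun _ : Fin n => B) B) (Fin n → B) B)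

/-- Replacing one entry of a tuple changes exactly one entry of its contraction, linearly. -/
theorem exists_contractNth_update (k : Type*) {B : Type*} [Field k] [Ring B] [Algebra k B]
    {n : ℕ} (j : Fin n) (a : Fin (n + 1) → B) (i : Fin (n + 1)) :
    ∃ (m : Fin n) (L : B →ₗ[k] B), ∀ x : B,
      Fin.contractNth j.castSucc (· * ·) (Function.update a i x) =
        Function.update (Fin.contractNth j.castSucc (· * ·) a) m (L x) := by
  rcases lt_trichotomy (i : ℕ) (j : ℕ) with h | h | h
  · refine ⟨⟨i, by omega⟩, LinearMap.id, fun x => ?_⟩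
    funext l
    simp only [Fin.contractNth, Function.update_apply, Fin.ext_iff, Fin.val_castSucc,
      Fin.val_succ, LinearMap.id_apply]
    split_ifs <;> first | rfl | omega
  · refine ⟨j, LinearMap.mulRight k (a j.succ), fun x => ?_⟩
    funext l
    simp only [Fin.contractNth, Function.update_apply, Fin.ext_iff, Fin.val_castSucc,
      Fin.val_succ, LinearMap.mulRight_apply]
    split_ifs <;> first | rfl | omega | (congr 2; ext; simp; omega)
  · by_cases h' : (i : ℕ) = j + 1
    · refine ⟨j, LinearMap.mulLeft k (a j.castSucc), fun x => ?_⟩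
      funext l
      simp only [Fin.contractNth, Function.update_apply, Fin.ext_iff, Fin.val_castSucc,
        Fin.val_succ, LinearMap.mulLeft_apply]
      split_ifs <;> first | rfl | omega | (congr 2; ext; simp; omega)
    · refine ⟨⟨i - 1, by omega⟩, LinearMap.id, fun x => ?_⟩
      funext l
      simp only [Fin.contractNth, Function.update_apply, Fin.ext_iff, Fin.val_castSucc,
        Fin.val_succ, LinearMap.id_apply]
      split_ifs <;> first | rfl | omega

variable (𝒜 : ℤ → Submodule k B) [GradedAlgebra 𝒜]

/-- The linear map `a ↦ (-1)^{d |a|} a`: the Koszul sign of moving a map of degree `d` past `a`. -/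
def koszul (d : ℤ) : B →ₗ[k] B :=
  (DirectSum.toModule k ℤ B fun i => (((d * i).negOnePow : ℤˣ) : ℤ) • (𝒜 i).subtype) ∘ₗ
    (DirectSum.decomposeLinearEquiv 𝒜).toLinearMap

/-- The Hochschild differential on maps `f : B^{⊗ n} → B` of internal degree `d`:
`(-1)^d (m(1 ⊗ f) + (-1)^{n+1} m(f ⊗ 1) + ∑_{i<n} (-1)^{i+1} f(1^{⊗ i} ⊗ m ⊗ 1^{⊗ (n-1-i)}))`,
tensor products of maps being evaluated by the Koszul sign rule. -/
def multilinearDifferential (d : ℤ) (n : ℕ) :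
    MultilinearMap k (fun _ : Fin n => B) B →ₗ[k] MultilinearMap k (fun _ : Fin (n + 1) => B) B where
  toFun f :=
    { toFun := fun a => ((d.negOnePow : ℤˣ) : ℤ) •
        (koszul 𝒜 d (a 0) * f (Fin.tail a)
          + (-1 : ℤ) ^ (n + 1) • (f (Fin.init a) * a (Fin.last n))
          + ∑ i : Fin n, (-1 : ℤ) ^ ((i : ℕ) + 1) • f (Fin.contractNth i.castSucc (· * ·) a))
      map_update_add' := by
        intro inst a i x y
        obtain rfl : inst = instDecidableEqFin _ := Subsingleton.elim _ _
        rw [← smul_add]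
        congr 1
        have h1 : ∀ x, koszul 𝒜 d (Function.update a i x 0) * f (Fin.tail (Function.update a i x)) =
            i.cases (motive := fun _ => B) (koszul 𝒜 d x * f (Fin.tail a))
              (fun m => koszul 𝒜 d (a 0) * f (Function.update (Fin.tail a) m x)) := by
          intro x
          cases i using Fin.cases with
          | zero => simp [Fin.tail_update_zero]
          | succ m => simp [Fin.tail_update_succ, Function.update_of_ne (Fin.succ_ne_zero m).symm]
        have h2 : ∀ x, f (Fin.init (Function.update a i x)) * Function.update a i x (Fin.last n) =
            i.lastCases (motive := fun _ => B) (f (Fin.init a) * x)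
              (fun m => f (Function.update (Fin.init a) m x) * a (Fin.last n)) := by
          intro x
          cases i using Fin.lastCases with
          | last => simp [Fin.init_update_last]
          | cast m =>
            simp [Fin.init_update_castSucc, Function.update_of_ne (Fin.castSucc_lt_last m).ne']
        have h3 : ∀ j : Fin n, f (Fin.contractNth j.castSucc (· * ·) (Function.update a i (x + y))) =
            f (Fin.contractNth j.castSucc (· * ·) (Function.update a i x)) +
            f (Fin.contractNth j.castSucc (· * ·) (Function.update a i y)) := by
          intro j
          obtain ⟨m, L, hL⟩ := exists_contractNth_update k j a i
          simp only [hL, map_add, f.map_update_add]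
        simp only [h1, h2, h3, smul_add, Finset.sum_add_distrib]
        have e1 : i.cases (motive := fun _ => B) (koszul 𝒜 d (x + y) * f (Fin.tail a))
              (fun m => koszul 𝒜 d (a 0) * f (Function.update (Fin.tail a) m (x + y))) =
            i.cases (motive := fun _ => B) (koszul 𝒜 d x * f (Fin.tail a))
              (fun m => koszul 𝒜 d (a 0) * f (Function.update (Fin.tail a) m x)) +
            i.cases (motive := fun _ => B) (koszul 𝒜 d y * f (Fin.tail a))
              (fun m => koszul 𝒜 d (a 0) * f (Function.update (Fin.tail a) m y)) := by
          cases i using Fin.cases <;> simp [add_mul, mul_add]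
        have e2 : i.lastCases (motive := fun _ => B) (f (Fin.init a) * (x + y))
              (fun m => f (Function.update (Fin.init a) m (x + y)) * a (Fin.last n)) =
            i.lastCases (motive := fun _ => B) (f (Fin.init a) * x)
              (fun m => f (Function.update (Fin.init a) m x) * a (Fin.last n)) +
            i.lastCases (motive := fun _ => B) (f (Fin.init a) * y)
              (fun m => f (Function.update (Fin.init a) m y) * a (Fin.last n)) := by
          cases i using Fin.lastCases <;> simp [add_mul, mul_add]
        rw [e1, e2, smul_add]
        abel
      map_update_smul' := by
        intro inst a i c x
        obtain rfl : inst = instDecidableEqFin _ := Subsingleton.elim _ _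
        rw [smul_comm c]
        congr 1
        have h1 : koszul 𝒜 d (Function.update a i (c • x) 0) *
              f (Fin.tail (Function.update a i (c • x))) =
            c • (koszul 𝒜 d (Function.update a i x 0) * f (Fin.tail (Function.update a i x))) := by
          cases i using Fin.cases with
          | zero => simp [Fin.tail_update_zero]
          | succ m => simp [Fin.tail_update_succ, Function.update_of_ne (Fin.succ_ne_zero m).symm]
        have h2 : f (Fin.init (Function.update a i (c • x))) *
              Function.update a i (c • x) (Fin.last n) =
            c • (f (Fin.init (Function.update a i x)) * Function.update a i x (Fin.last n)) := by
          cases i using Fin.lastCases with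
          | last => simp [Fin.init_update_last]
          | cast m =>
            simp [Fin.init_update_castSucc, Function.update_of_ne (Fin.castSucc_lt_last m).ne']
        have h3 : ∀ j : Fin n, f (Fin.contractNth j.castSucc (· * ·) (Function.update a i (c • x))) =
            c • f (Fin.contractNth j.castSucc (· * ·) (Function.update a i x)) := by
          intro j
          obtain ⟨m, L, hL⟩ := exists_contractNth_update k j a i
          simp only [hL, map_smul, f.map_update_smul]
        simp only [h1, h2, h3, smul_add, Finset.smul_sum, smul_comm c] }
  map_add' f g := by
    ext a
    simp only [MultilinearMap.coe_mk, add_apply, mul_add, add_mul, smul_add,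
      Finset.sum_add_distrib]
    abel
  map_smul' c f := by
    ext a
    simp only [MultilinearMap.coe_mk, smul_apply, RingHom.id_apply, smul_add,
      Finset.smul_sum, mul_smul_comm, smul_mul_assoc, smul_comm c]

/-- The Hochschild differential on cochains of internal degree `d`. -/
def differential (d : ℤ) (n : ℕ) : Cochain k B n →ₗ[k] Cochain k B (n + 1) :=
  multilinearDifferential 𝒜 d n

/-- `C^{n,d}(B) = Hom_k^d(B^{⊗ n}, B)`: the `n`-linear maps which are homogeneous of internal
degree `d`. -/
def homogeneous (n : ℕ) (d : ℤ) : Submodule k (Cochain k B n) where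
  carrier := {f | ∀ (e : Fin n → ℤ) (a : Fin n → B), (∀ i, a i ∈ 𝒜 (e i)) →
    f a ∈ 𝒜 ((∑ i, e i) + d)}
  add_mem' hf hg e a ha := add_mem (hf e a ha) (hg e a ha)
  zero_mem' _ _ _ := zero_mem _
  smul_mem' c _ hf e a ha := Submodule.smul_mem _ c (hf e a ha)

/-- The cocycles of `C^{•,d}(B)` in cohomological degree `n`. -/
def cocycles (n : ℕ) (d : ℤ) : Submodule k (Cochain k B n) :=
  homogeneous 𝒜 n d ⊓ LinearMap.ker (differential 𝒜 d n)

/-- The coboundaries of `C^{•,d}(B)` in cohomological degree `n`. -/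
def coboundaries : (n : ℕ) → (d : ℤ) → Submodule k (Cochain k B n)
  | 0, _ => ⊥
  | n + 1, d => (homogeneous 𝒜 n d).map (differential 𝒜 d n)

/-- The bigraded Hochschild cohomology `HH^{n,d}(B,B)`, the `n`-th cohomology of `C^{•,d}(B)`. -/
def HH (n : ℕ) (d : ℤ) : Type _ :=
  cocycles 𝒜 n d ⧸ (coboundaries 𝒜 n d).submoduleOf (cocycles 𝒜 n d)

instance (n : ℕ) (d : ℤ) : AddCommGroup (HH 𝒜 n d) :=
  inferInstanceAs
    (AddCommGroup (cocycles 𝒜 n d ⧸ (coboundaries 𝒜 n d).submoduleOf (cocycles 𝒜 n d)))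

instance (n : ℕ) (d : ℤ) : Module k (HH 𝒜 n d) :=
  inferInstanceAs
    (Module k (cocycles 𝒜 n d ⧸ (coboundaries 𝒜 n d).submoduleOf (cocycles 𝒜 n d)))

/-- The Hochschild class of a cocycle. -/
def HH.mk {n : ℕ} {d : ℤ} (f : cocycles 𝒜 n d) : HH 𝒜 n d :=
  Submodule.Quotient.mk f

/-- The degree `i` part `∏_n Hom_k^{i-n}(B^{⊗ n}, B)` of the Hochschild complex `C(B)`. -/
def totalCochains (i : ℤ) : Submodule k ((n : ℕ) → Cochain k B n) where
  carrier := {c | ∀ n : ℕ, c n ∈ homogeneous 𝒜 n (i - n)}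
  add_mem' hf hg n := add_mem (hf n) (hg n)
  zero_mem' _ := zero_mem _
  smul_mem' c _ hf n := Submodule.smul_mem _ c (hf n)

/-- The Hochschild differential of the total complex on elements of total degree `i`. -/
def totalDifferential (i : ℤ) : ((n : ℕ) → Cochain k B n) →ₗ[k] ((n : ℕ) → Cochain k B n) :=
  LinearMap.pi fun m => match m with
    | 0 => 0
    | n + 1 => differential 𝒜 (i - n) n ∘ₗ LinearMap.proj n

/-- The cocycles of total degree `i` in `C(B)`. -/
def totalCocycles (i : ℤ) : Submodule k ((n : ℕ) → Cochain k B n) :=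
  totalCochains 𝒜 i ⊓ LinearMap.ker (totalDifferential 𝒜 i)

/-- The coboundaries of total degree `i` in `C(B)`. -/
def totalCoboundaries (i : ℤ) : Submodule k ((n : ℕ) → Cochain k B n) :=
  (totalCochains 𝒜 (i - 1)).map (totalDifferential 𝒜 (i - 1))

/-- The Hochschild cohomology `HH^i(B,B)` of the (product total) Hochschild complex `C(B)`. -/
def TotalHH (i : ℤ) : Type _ :=
  totalCocycles 𝒜 i ⧸ (totalCoboundaries 𝒜 i).submoduleOf (totalCocycles 𝒜 i)

instance (i : ℤ) : AddCommGroup (TotalHH 𝒜 i) :=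
  inferInstanceAs
    (AddCommGroup (totalCocycles 𝒜 i ⧸ (totalCoboundaries 𝒜 i).submoduleOf (totalCocycles 𝒜 i)))

instance (i : ℤ) : Module k (TotalHH 𝒜 i) :=
  inferInstanceAs
    (Module k (totalCocycles 𝒜 i ⧸ (totalCoboundaries 𝒜 i).submoduleOf (totalCocycles 𝒜 i)))

/-- The class of a total cocycle. -/
def TotalHH.mk {i : ℤ} (f : totalCocycles 𝒜 i) : TotalHH 𝒜 i :=
  Submodule.Quotient.mk f

/-- The neighbourhood `W_j` of zero in `HH^i(B,B)`: the classes of cocycles in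
`∏_{n ≥ j} Hom_k^{i-n}(B^{⊗ n}, B)`. -/
def filtration (i : ℤ) (j : ℕ) : Submodule k (TotalHH 𝒜 i) :=
  ((⨅ n ∈ Finset.range j, LinearMap.ker (LinearMap.proj n :
      ((n : ℕ) → Cochain k B n) →ₗ[k] Cochain k B n)).submoduleOf (totalCocycles 𝒜 i)).map
    ((totalCoboundaries 𝒜 i).submoduleOf (totalCocycles 𝒜 i)).mkQ

/-- A family of classes in `HH^i(B,B)` is a Schauder basis if every class is, in a unique way, the
limit of a possibly infinite linear combination of the family, with respect to the topology whose
neighbourhoods of zero are the subspaces `W_j`. -/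
def IsSchauderBasis {i : ℤ} {ι : Type*} (v : ι → TotalHH 𝒜 i) : Prop :=
  ∀ z : TotalHH 𝒜 i, ∃! c : ι → k, ∀ j : ℕ, ∀ᶠ F : Finset ι in Filter.atTop,
    z - ∑ b ∈ F, c b • v b ∈ filtration 𝒜 i j

end Hochschild

/-! ### Graded gentle quivers and their algebras -/

/-- A quiver with vertex set `V` and arrow set `E`, whose arrows are graded by integers, together
with a set of paths of length two, to be thought of as the monomial generators of an ideal `I` of
the path algebra. Arrows are composed from right to left: `β α` is a path if `s β = t α`. -/
structure QuadraticQuiver (V E : Type*) where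
  /-- the start vertex of an arrow -/
  s : E → V
  /-- the end vertex of an arrow -/
  t : E → V
  /-- the degree of an arrow -/
  deg : E → ℤ
  /-- `rel β α` means that the path `β α` of length two is one of the generators of `I`; as `I` is
  generated by paths of length two, this is the same as `β α ∈ I` -/
  rel : E → E → Prop
  comp_of_rel : ∀ {β α : E}, rel β α → s β = t α

/-- A word in the arrows of a quiver with prescribed end vertex `tgt` and start vertex `src`. The
empty word with `tgt = src = x` stands for the trivial path `e_x`. -/
@[ext]
structure PathWord (V E : Type*) where
  /-- the end vertex -/
  tgt : V
  /-- the start vertex -/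
  src : V
  /-- the arrows `α₁ ⋯ α_l`, the last one being passed first -/
  arrows : List E

/-- The trivial path `e_x`. -/
def PathWord.trivial {V : Type*} (E : Type*) (x : V) : PathWord V E := ⟨x, x, []⟩

/-- The length of a path. -/
def PathWord.length {V E : Type*} (p : PathWord V E) : ℕ := p.arrows.length

namespace QuadraticQuiver

variable {V E : Type*} (Q : QuadraticQuiver V E)

/-- The conditions on a (graded) gentle quiver. -/
structure IsGentle : Prop where
  out_le : ∀ x : V, {α : E | Q.s α = x}.encard ≤ 2
  in_le : ∀ x : V, {α : E | Q.t α = x}.encard ≤ 2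
  rel_left : ∀ α β β' : E, Q.rel β α → Q.rel β' α → β = β'
  rel_right : ∀ α γ γ' : E, Q.rel α γ → Q.rel α γ' → γ = γ'
  nonrel_left : ∀ α β β' : E, Q.s β = Q.t α → ¬ Q.rel β α → Q.s β' = Q.t α → ¬ Q.rel β' α → β = β'
  nonrel_right : ∀ α γ γ' : E, Q.s α = Q.t γ → ¬ Q.rel α γ → Q.s α = Q.t γ' → ¬ Q.rel α γ' → γ = γ'

/-- The quiver is a loop with a single vertex. -/
def IsLoop (_Q : QuadraticQuiver V E) : Prop := Nat.card V = 1 ∧ Nat.card E = 1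

/-- The quiver is the Kronecker quiver: two vertices and two parallel arrows between them. -/
def IsKronecker : Prop :=
  ∃ x y : V, x ≠ y ∧ (∀ z : V, z = x ∨ z = y) ∧ Nat.card E = 2 ∧ ∀ α : E, Q.s α = x ∧ Q.t α = y

/-- Two vertices are joined by an arrow of `T`, in one of the two directions. -/
def Joined (T : Set E) (x y : V) : Prop :=
  ∃ α ∈ T, (Q.s α = x ∧ Q.t α = y) ∨ (Q.s α = y ∧ Q.t α = x)

/-- `T` is the set of arrows of a spanning tree: the underlying graph of `(Q₀, T)` is non-empty,
connected and has one edge less than vertices. -/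
def IsSpanningTree (T : Set E) : Prop :=
  Nonempty V ∧ (∀ x y : V, Relation.ReflTransGen (Q.Joined T) x y) ∧ T.ncard + 1 = Nat.card V

/-- The word `l` is a path in `Q` from `x` to `y`. -/
def IsWalk : V → List E → V → Prop
  | y, [], x => y = x
  | y, α :: l, x => Q.t α = y ∧ IsWalk (Q.s α) l x

/-- The word `p` is a path in `Q`. -/
def IsPath (p : PathWord V E) : Prop := Q.IsWalk p.tgt p.arrows p.src

/-- The path `p` is a path of `A`: it contains no relation, that is, `p ∉ I`. -/
def IsPathOfA (p : PathWord V E) : Prop :=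
  Q.IsPath p ∧ p.arrows.IsChain fun β α => ¬ Q.rel β α

/-- The path `p` is an anti-path of `A`: any two consecutive arrows form a relation. -/
def IsAntiPath (p : PathWord V E) : Prop :=
  Q.IsPath p ∧ p.arrows.IsChain Q.rel

/-- The degree of a word. -/
def wordDeg (l : List E) : ℤ := (l.map Q.deg).sum

/-- The degree `|p|` of a path. -/
def pathDeg (p : PathWord V E) : ℤ := Q.wordDeg p.arrows

/-- The basis of `A = k Q / I`: the paths which do not lie in `I`. -/
abbrev APath : Type _ := {p : PathWord V E // Q.IsPathOfA p}

/-- The graded gentle algebra `A = k Q / I`, described through its basis of paths of `A`. -/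
def Alg (k : Type*) [Field k] : Type _ := Q.APath →₀ k

variable (k : Type*) [Field k]

instance : AddCommGroup (Q.Alg k) := inferInstanceAs (AddCommGroup (Q.APath →₀ k))

instance : Module k (Q.Alg k) := inferInstanceAs (Module k (Q.APath →₀ k))

/-- The basis of `A` consisting of the paths of `A`. -/
def basis : Module.Basis Q.APath k (Q.Alg k) := Module.Basis.ofRepr (LinearEquiv.refl k _)

open Classical in
/-- The class in `A` of a path of `Q`, which is zero if the path lies in `I`. Words which are not
paths are sent to zero. -/
def pathElem (p : PathWord V E) : Q.Alg k :=
  if h : Q.IsPathOfA p then Q.basis k ⟨p, h⟩ else 0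

open Classical in
/-- The product in `A` of two paths of `A`: the class of their concatenation, or zero if they are
not composable. -/
def basisMul (p q : Q.APath) : Q.Alg k :=
  if p.1.src = q.1.tgt then Q.pathElem k ⟨p.1.tgt, q.1.src, p.1.arrows ++ q.1.arrows⟩ else 0

/-- The multiplication of `A`. -/
def mulLin : Q.Alg k →ₗ[k] Q.Alg k →ₗ[k] Q.Alg k :=
  (Q.basis k).constr k fun p => (Q.basis k).constr k fun q => Q.basisMul k p q

instance : Mul (Q.Alg k) := ⟨fun a b => Q.mulLin k a b⟩

variable {Q k}

theorem mul_def (a b : Q.Alg k) : a * b = Q.mulLin k a b := rfl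

theorem basis_mul_basis (p q : Q.APath) : Q.basis k p * Q.basis k q = Q.basisMul k p q := by
  simp [mul_def, mulLin]

theorem pathElem_of {p : PathWord V E} (h : Q.IsPathOfA p) :
    Q.pathElem k p = Q.basis k ⟨p, h⟩ := dif_pos h

theorem pathElem_of_not {p : PathWord V E} (h : ¬ Q.IsPathOfA p) : Q.pathElem k p = 0 := dif_neg h

theorem isWalk_append {x y : V} {l m : List E} :
    Q.IsWalk y (l ++ m) x ↔ ∃ z, Q.IsWalk y l z ∧ Q.IsWalk z m x := by
  induction l generalizing y with
  | nil => simp [IsWalk]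
  | cons α l ih => simp [IsWalk, ih, and_assoc]

theorem isWalk_unique {x y z : V} {l : List E} (h : Q.IsWalk y l x) (h' : Q.IsWalk z l x) :
    y = z := by
  cases l with
  | nil => exact h.trans h'.symm
  | cons α l => exact h.1.symm.trans h'.1

theorem isWalk_unique' {x y z : V} {l : List E} (h : Q.IsWalk y l x) (h' : Q.IsWalk y l z) :
    x = z := by
  induction l generalizing y with
  | nil => exact h.symm.trans h'
  | cons α l ih => exact ih h.2 h'.2

theorem pathElem_mul (p q : PathWord V E) (hp : Q.IsPath p) (hq : Q.IsPath q) (h : p.src = q.tgt) :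
    Q.pathElem k p * Q.pathElem k q = Q.pathElem k ⟨p.tgt, q.src, p.arrows ++ q.arrows⟩ := by
  by_cases hp' : Q.IsPathOfA p
  · by_cases hq' : Q.IsPathOfA q
    · rw [pathElem_of hp', pathElem_of hq', basis_mul_basis, basisMul, if_pos h]
    · have hn : ¬ Q.IsPathOfA ⟨p.tgt, q.src, p.arrows ++ q.arrows⟩ :=
        fun H => hq' ⟨hq, H.2.right_of_append⟩
      rw [pathElem_of_not hq', pathElem_of_not hn, mul_def, map_zero]
  · have hn : ¬ Q.IsPathOfA ⟨p.tgt, q.src, p.arrows ++ q.arrows⟩ :=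
      fun H => hp' ⟨hp, H.2.left_of_append⟩
    rw [pathElem_of_not hp', pathElem_of_not hn, mul_def, map_zero, LinearMap.zero_apply]

theorem pathElem_mul_of_ne (p q : PathWord V E) (h : p.src ≠ q.tgt) :
    Q.pathElem k p * Q.pathElem k q = 0 := by
  by_cases hp : Q.IsPathOfA p
  · by_cases hq : Q.IsPathOfA q
    · rw [pathElem_of hp, pathElem_of hq, basis_mul_basis, basisMul, if_neg h]
    · rw [pathElem_of_not hq, mul_def, map_zero]
  · rw [pathElem_of_not hp, mul_def, map_zero, LinearMap.zero_apply]

theorem basis_eq (p : Q.APath) : Q.basis k p = Q.pathElem k p.1 := (pathElem_of p.2).symm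

theorem IsPath.append {p q : PathWord V E} (hp : Q.IsPath p) (hq : Q.IsPath q)
    (h : p.src = q.tgt) : Q.IsPath ⟨p.tgt, q.src, p.arrows ++ q.arrows⟩ :=
  isWalk_append.2 ⟨q.tgt, h ▸ hp, hq⟩

theorem basis_mul_assoc (p q r : Q.APath) :
    Q.basis k p * Q.basis k q * Q.basis k r = Q.basis k p * (Q.basis k q * Q.basis k r) := by
  simp only [basis_eq]
  by_cases h1 : p.1.src = q.1.tgt
  · rw [pathElem_mul _ _ p.2.1 q.2.1 h1]
    by_cases h2 : q.1.src = r.1.tgt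
    · rw [pathElem_mul _ _ q.2.1 r.2.1 h2, pathElem_mul _ _ (p.2.1.append q.2.1 h1) r.2.1 h2,
        pathElem_mul _ _ p.2.1 (q.2.1.append r.2.1 h2) h1, List.append_assoc]
    · rw [pathElem_mul_of_ne _ _ h2, pathElem_mul_of_ne _ _ (by exact h2), mul_def _ 0, map_zero]
  · rw [pathElem_mul_of_ne _ _ h1, mul_def 0, map_zero, LinearMap.zero_apply]
    by_cases h2 : q.1.src = r.1.tgt
    · rw [pathElem_mul _ _ q.2.1 r.2.1 h2, pathElem_mul_of_ne _ _ (by exact h1)]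
    · rw [pathElem_mul_of_ne _ _ h2, mul_def _ 0, map_zero]

theorem mul_assoc_aux (a b c : Q.Alg k) : a * b * c = a * (b * c) := by
  have h1 : ∀ (p q : Q.APath), Q.mulLin k (Q.mulLin k (Q.basis k p) (Q.basis k q)) =
      (Q.mulLin k (Q.basis k p)) ∘ₗ (Q.mulLin k (Q.basis k q)) := fun p q =>
    (Q.basis k).ext fun r => basis_mul_assoc p q r
  have h2 : ∀ (p : Q.APath), (Q.mulLin k) ∘ₗ (Q.mulLin k (Q.basis k p)) =
      (LinearMap.llcomp k _ _ _ (Q.mulLin k (Q.basis k p))) ∘ₗ (Q.mulLin k) := fun p =>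
    (Q.basis k).ext fun q => h1 p q
  have h3 : (LinearMap.lcomp k _ (Q.mulLin k b)) ∘ₗ (Q.mulLin k) =
      (Q.mulLin k) ∘ₗ ((Q.mulLin k).flip b) := (Q.basis k).ext fun p =>
    (LinearMap.congr_fun (h2 p) b).symm
  exact (LinearMap.congr_fun (LinearMap.congr_fun h3 a) c).symm

/-- The trivial path as a path of `A`. -/
def trivialA (Q : QuadraticQuiver V E) (x : V) : Q.APath :=
  ⟨.trivial E x, rfl, List.isChain_nil⟩

/-- The arrow `α` as a path of `Q`. -/
def arrowPath (Q : QuadraticQuiver V E) (α : E) : PathWord V E := ⟨Q.t α, Q.s α, [α]⟩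

theorem trivialA_mul [Fintype V] (a : Q.Alg k) : (∑ x, Q.basis k (Q.trivialA x)) * a = a := by
  classical
  have h : Q.mulLin k (∑ x, Q.basis k (Q.trivialA x)) = LinearMap.id := by
    refine (Q.basis k).ext fun p => ?_
    rw [map_sum, LinearMap.sum_apply, LinearMap.id_apply, Finset.sum_eq_single p.1.tgt]
    · change Q.basis k (Q.trivialA p.1.tgt) * Q.basis k p = _
      rw [basis_eq, basis_eq, pathElem_mul _ _ (Q.trivialA _).2.1 p.2.1 rfl]
      rfl
    · intro x _ hx
      change Q.basis k (Q.trivialA x) * Q.basis k p = _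
      rw [basis_eq, basis_eq, pathElem_mul_of_ne _ _ (by exact hx)]
    · simp
  exact LinearMap.congr_fun h a

theorem mul_trivialA [Fintype V] (a : Q.Alg k) : a * (∑ x, Q.basis k (Q.trivialA x)) = a := by
  classical
  have h : (Q.mulLin k).flip (∑ x, Q.basis k (Q.trivialA x)) = LinearMap.id := by
    refine (Q.basis k).ext fun p => ?_
    rw [map_sum, LinearMap.sum_apply, LinearMap.id_apply, Finset.sum_eq_single p.1.src]
    · change Q.basis k p * Q.basis k (Q.trivialA p.1.src) = _
      rw [basis_eq, basis_eq, pathElem_mul _ _ p.2.1 (Q.trivialA _).2.1 rfl]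
      congr 1
      ext1
      · rfl
      · rfl
      · exact List.append_nil _
    · intro x _ hx
      change Q.basis k p * Q.basis k (Q.trivialA x) = _
      rw [basis_eq, basis_eq, pathElem_mul_of_ne _ _ (by exact hx.symm)]
    · simp
  exact LinearMap.congr_fun h a

/-- The ring structure of `A`, with unit `∑ₓ eₓ`. -/
instance [Fintype V] : Ring (Q.Alg k) where
  __ := instAddCommGroupAlg Q k
  mul a b := Q.mulLin k a b
  one := ∑ x, Q.basis k (Q.trivialA x)
  left_distrib a b c := map_add (Q.mulLin k a) b c
  right_distrib a b c := by
    change Q.mulLin k (a + b) c = _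
    rw [map_add]; rfl
  zero_mul a := by
    change Q.mulLin k 0 a = _
    rw [map_zero]; rfl
  mul_zero a := map_zero (Q.mulLin k a)
  mul_assoc := mul_assoc_aux
  one_mul := trivialA_mul
  mul_one := mul_trivialA

theorem one_def [Fintype V] : (1 : Q.Alg k) = ∑ x, Q.basis k (Q.trivialA x) := rfl

instance [Fintype V] : Algebra k (Q.Alg k) :=
  Algebra.ofModule
    (fun c a b => by change Q.mulLin k (c • a) b = c • Q.mulLin k a b; rw [map_smul]; rfl)
    (fun c a b => map_smul (Q.mulLin k a) c b)

variable (Q k)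

/-- The homogeneous component of degree `d` of `A`: the span of the paths of degree `d`. -/
def grading [Fintype V] (d : ℤ) : Submodule k (Q.Alg k) :=
  Submodule.span k (Q.basis k '' {p | Q.pathDeg p.1 = d})

variable {Q k}

theorem basis_mem_grading [Fintype V] (p : Q.APath) : Q.basis k p ∈ Q.grading k (Q.pathDeg p.1) :=
  Submodule.subset_span ⟨p, rfl, rfl⟩

instance [Fintype V] : SetLike.GradedMonoid (Q.grading k) where
  one_mem := by
    rw [one_def]
    exact sum_mem fun x _ => basis_mem_grading (Q.trivialA x)
  mul_mem := by
    intro i j a b ha hb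
    refine Submodule.mul_mem_mul ha hb |> fun h => ?_
    rw [grading, grading, Submodule.span_mul_span] at h
    refine Submodule.span_le.2 ?_ h
    rintro _ ⟨_, ⟨p, hp, rfl⟩, _, ⟨q, hq, rfl⟩, rfl⟩
    change Q.basis k p * Q.basis k q ∈ _
    rw [basis_mul_basis, basisMul]
    split_ifs with h
    · by_cases h' : Q.IsPathOfA ⟨p.1.tgt, q.1.src, p.1.arrows ++ q.1.arrows⟩
      · rw [pathElem_of h']
        refine Submodule.subset_span ⟨_, ?_, rfl⟩
        simp only [Set.mem_ofPred_eq, pathDeg, wordDeg] at hp hq ⊢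
        simp [hp, hq]
      · rw [pathElem_of_not h']
        exact zero_mem _
    · exact zero_mem _

instance [Fintype V] : DirectSum.Decomposition (Q.grading k) :=
  DirectSum.Decomposition.ofLinearMap _
    ((Q.basis k).constr k fun p =>
      DirectSum.lof k ℤ (fun i => Q.grading k i) (Q.pathDeg p.1) ⟨_, basis_mem_grading p⟩)
    (by
      refine (Q.basis k).ext fun p => ?_
      simp)
    (by
      refine DirectSum.linearMap_ext _ fun i => LinearMap.ext fun x => ?_
      obtain ⟨x, hx⟩ := x
      simp only [LinearMap.comp_apply, DirectSum.coeLinearMap_lof, LinearMap.id_apply]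
      induction hx using Submodule.span_induction with
      | mem x hx =>
        obtain ⟨p, hp, rfl⟩ := hx
        obtain rfl : Q.pathDeg p.1 = i := hp
        rw [Module.Basis.constr_basis]
      | zero => rw [map_zero]; exact (map_zero (DirectSum.lof k ℤ (fun i => Q.grading k i) i)).symm
      | add x y hx hy h1 h2 =>
        rw [map_add, h1, h2]
        exact (map_add (DirectSum.lof k ℤ (fun i => Q.grading k i) i) _ _).symm
      | smul c x hx h1 =>
        rw [map_smul, h1]
        exact (map_smul (DirectSum.lof k ℤ (fun i => Q.grading k i) i) _ _).symm)

instance [Fintype V] : GradedAlgebra (Q.grading k) where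

/-! #### Comparison with the quotient of the path algebra -/

variable (Q) in
/-- The same quiver without relations, whose algebra is the path algebra `k Q`. -/
def free : QuadraticQuiver V E where
  s := Q.s
  t := Q.t
  deg := Q.deg
  rel _ _ := False
  comp_of_rel h := h.elim

theorem free_isPath {p : PathWord V E} : Q.free.IsPath p ↔ Q.IsPath p := by
  have : ∀ (l : List E) (y x : V), Q.free.IsWalk y l x ↔ Q.IsWalk y l x := by
    intro l
    induction l with
    | nil => intro y x; rfl
    | cons α l ih => intro y x; exact and_congr Iff.rfl (ih _ _)
  exact this _ _ _

theorem free_isPathOfA {p : PathWord V E} : Q.free.IsPathOfA p ↔ Q.IsPath p := by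
  refine ⟨fun h => free_isPath.1 h.1, fun h => ⟨free_isPath.2 h, ?_⟩⟩
  exact List.isChain_iff_forall_rel_of_append_cons_cons.2 fun _ _ _ _ _ h => h

/-- The linear map `k Q → A` sending a path to its class. -/
def projLin [Fintype V] : Q.free.Alg k →ₗ[k] Q.Alg k :=
  (Q.free.basis k).constr k fun p => Q.pathElem k p.1

theorem projLin_pathElem [Fintype V] {p : PathWord V E} (hp : Q.IsPath p) :
    projLin (Q.free.pathElem k p) = Q.pathElem k p := by
  rw [pathElem_of (free_isPathOfA.2 hp), projLin, Module.Basis.constr_basis]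

/-- The projection `k Q → A`. -/
def proj [Fintype V] : Q.free.Alg k →ₐ[k] Q.Alg k :=
  AlgHom.ofLinearMap projLin
    (by
      rw [one_def, one_def, map_sum]
      refine Finset.sum_congr rfl fun x _ => ?_
      exact projLin_pathElem (p := .trivial E x) rfl |> fun h => by rwa [basis_eq, basis_eq])
    (by
      have h : ∀ p q : Q.free.APath, projLin (Q.free.basis k p * Q.free.basis k q) =
          projLin (Q.free.basis k p) * (projLin (Q.free.basis k q) : Q.Alg k) := by
        intro p q
        have hp := free_isPath.1 p.2.1
        have hq := free_isPath.1 q.2.1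
        simp only [basis_eq]
        rw [projLin_pathElem hp, projLin_pathElem hq]
        by_cases h : p.1.src = q.1.tgt
        · rw [pathElem_mul _ _ p.2.1 q.2.1 h, pathElem_mul _ _ hp hq h,
            projLin_pathElem (hp.append hq h)]
        · rw [pathElem_mul_of_ne _ _ h, pathElem_mul_of_ne _ _ h, map_zero]
      have h1 : ∀ p : Q.free.APath, projLin ∘ₗ Q.free.mulLin k (Q.free.basis k p) =
          Q.mulLin k (projLin (Q.free.basis k p)) ∘ₗ projLin := fun p =>
        (Q.free.basis k).ext fun q => h p q
      intro a b
      have h2 : projLin ∘ₗ (Q.free.mulLin k).flip b = (Q.mulLin k).flip (projLin b) ∘ₗ projLin :=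
        (Q.free.basis k).ext fun p => LinearMap.congr_fun (h1 p) b
      exact LinearMap.congr_fun h2 a)

theorem proj_pathElem [Fintype V] {p : PathWord V E} (hp : Q.IsPath p) :
    proj (Q.free.pathElem k p) = Q.pathElem k p := projLin_pathElem hp

theorem proj_surjective [Fintype V] : Function.Surjective (proj : Q.free.Alg k →ₐ[k] Q.Alg k) := by
  intro a
  induction (Q.basis k).mem_span a using Submodule.span_induction with
  | mem x hx =>
    obtain ⟨p, rfl⟩ := hx
    exact ⟨_, (proj_pathElem p.2.1).trans (basis_eq p).symm⟩
  | zero => exact ⟨0, map_zero _⟩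
  | add x y _ _ h1 h2 =>
    obtain ⟨u, rfl⟩ := h1
    obtain ⟨v, rfl⟩ := h2
    exact ⟨u + v, map_add _ _ _⟩
  | smul c x _ h1 =>
    obtain ⟨u, rfl⟩ := h1
    exact ⟨c • u, map_smul _ _ _⟩

variable (Q k) in
/-- The ideal `I` of `k Q` generated by the paths `β α` of length two which are relations. -/
def relIdeal [Fintype V] : TwoSidedIdeal (Q.free.Alg k) :=
  TwoSidedIdeal.span {a | ∃ β α : E, Q.rel β α ∧ a = Q.free.pathElem k ⟨Q.t β, Q.s α, [β, α]⟩}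

theorem pathElem_mem_relIdeal [Fintype V] {p : PathWord V E} (hp : Q.IsPath p)
    (hp' : ¬ Q.IsPathOfA p) : Q.free.pathElem k p ∈ Q.relIdeal k := by
  have hc : ¬ p.arrows.IsChain fun β α => ¬ Q.rel β α := fun h => hp' ⟨hp, h⟩
  obtain ⟨u, β, α, w, hl, hr⟩ : ∃ u β α w, p.arrows = u ++ [β, α] ++ w ∧ Q.rel β α := by
    by_contra! H
    refine hc (List.isChain_iff_forall_rel_of_append_cons_cons.2 fun β α u w h => ?_)
    exact H u β α w (by simp [h])
  obtain ⟨y, x, l⟩ := p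
  obtain rfl : l = u ++ [β, α] ++ w := hl
  obtain ⟨z, hz, hz'⟩ := isWalk_append.1 hp
  obtain ⟨z', hz1, hz2⟩ := isWalk_append.1 hz
  obtain ⟨rfl, hz3, rfl⟩ := hz2
  have e : Q.free.pathElem k ⟨y, x, u ++ [β, α] ++ w⟩ =
      Q.free.pathElem k ⟨y, Q.t β, u⟩ * Q.free.pathElem k ⟨Q.t β, Q.s α, [β, α]⟩ *
        Q.free.pathElem k ⟨Q.s α, x, w⟩ := by
    rw [pathElem_mul, pathElem_mul]
    · exact free_isPath.2 hz
    · exact free_isPath.2 hz'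
    · rfl
    · exact free_isPath.2 hz1
    · exact free_isPath.2 (show Q.IsPath ⟨Q.t β, Q.s α, [β, α]⟩ from ⟨rfl, hz3, rfl⟩)
    · rfl
  rw [e]
  exact TwoSidedIdeal.mul_mem_right _ _ _ (TwoSidedIdeal.mul_mem_left _ _ _
    (TwoSidedIdeal.subset_span ⟨β, α, hr, rfl⟩))

/-- `A` is the quotient of the path algebra `k Q` by the ideal `I`: the kernel of the surjective
algebra homomorphism `k Q → A`, which sends a path to its class, is `I`. -/
theorem proj_eq_zero_iff [Fintype V] (a : Q.free.Alg k) :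
    (proj a : Q.Alg k) = 0 ↔ a ∈ Q.relIdeal k := by
  classical
  have hrev : ∀ a ∈ Q.relIdeal k, (proj a : Q.Alg k) = 0 := by
    intro a h
    have : Q.relIdeal k ≤ TwoSidedIdeal.ker (proj : Q.free.Alg k →ₐ[k] Q.Alg k) := by
      refine TwoSidedIdeal.span_le.2 ?_
      rintro _ ⟨β, α, hr, rfl⟩
      refine (TwoSidedIdeal.mem_ker _).2 ?_
      have hw : Q.IsPath ⟨Q.t β, Q.s α, [β, α]⟩ := ⟨rfl, (Q.comp_of_rel hr).symm, rfl⟩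
      rw [proj_pathElem hw, pathElem_of_not]
      rintro ⟨-, hc⟩
      simp [hr] at hc
    exact (TwoSidedIdeal.mem_ker _).1 (this h)
  refine ⟨fun h => ?_, hrev a⟩
  have key : ∀ a : Q.free.Alg k, ∃ b : Q.Alg k, ∃ c ∈ Q.relIdeal k,
      a = (Q.basis k).constr k (fun p => Q.free.pathElem k p.1) b + c := by
    intro a
    induction (Q.free.basis k).mem_span a using Submodule.span_induction with
    | mem x hx =>
      obtain ⟨p, rfl⟩ := hx
      by_cases hp : Q.IsPathOfA p.1
      · refine ⟨Q.basis k ⟨p.1, hp⟩, 0, zero_mem _, ?_⟩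
        rw [Module.Basis.constr_basis, add_zero, basis_eq]
      · refine ⟨0, _, pathElem_mem_relIdeal (free_isPath.1 p.2.1) hp, ?_⟩
        rw [map_zero, zero_add, basis_eq]
    | zero => exact ⟨0, 0, zero_mem _, by rw [map_zero, add_zero]⟩
    | add x y _ _ h1 h2 =>
      obtain ⟨b, c, hc, rfl⟩ := h1
      obtain ⟨b', c', hc', rfl⟩ := h2
      exact ⟨b + b', c + c', add_mem hc hc', by rw [map_add]; abel⟩
    | smul r x _ h1 =>
      obtain ⟨b, c, hc, rfl⟩ := h1
      refine ⟨r • b, r • c, ?_, by rw [map_smul, smul_add]⟩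
      rw [Algebra.smul_def]
      exact TwoSidedIdeal.mul_mem_left _ _ _ hc
  obtain ⟨b, c, hc, rfl⟩ := key a
  have hsec : (proj (k := k) (Q := Q)).toLinearMap ∘ₗ
      (Q.basis k).constr k (fun p => Q.free.pathElem k p.1) = LinearMap.id := by
    refine (Q.basis k).ext fun p => ?_
    rw [LinearMap.comp_apply, Module.Basis.constr_basis]
    exact (proj_pathElem p.2.1).trans (basis_eq p).symm
  have hb : (proj ((Q.basis k).constr k (fun p => Q.free.pathElem k p.1) b) : Q.Alg k) = b :=
    LinearMap.congr_fun hsec b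
  rw [map_add, hrev c hc, add_zero, hb] at h
  rw [h, map_zero, zero_add]
  exact hc

/-! ### From parallel pairs to Hochschild cochains -/

variable (Q k)

open Classical in
/-- The Hochschild cochain with prescribed values on tuples of paths of `A`. -/
def extendMultilinear [Fintype V] (n : ℕ) (F : (Fin n → Q.APath) → Q.Alg k) :
    Hochschild.Cochain k (Q.Alg k) n :=
  (MultilinearMap.fromDFinsuppEquiv (fun _ : Fin n => Q.APath) k
    (fun v => MultilinearMap.mkPiRing k (Fin n) (F v))).compLinearMap
      (fun _ => (finsuppLequivDFinsupp k).toLinearMap ∘ₗ (Q.basis k).repr.toLinearMap)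

theorem extendMultilinear_basis [Fintype V] (n : ℕ) (F : (Fin n → Q.APath) → Q.Alg k)
    (v : Fin n → Q.APath) : Q.extendMultilinear k n F (fun i => Q.basis k (v i)) = F v := by
  classical
  change MultilinearMap.fromDFinsuppEquiv (fun _ : Fin n => Q.APath) k
    (fun v => MultilinearMap.mkPiRing k (Fin n) (F v))
      (fun i => finsuppLequivDFinsupp k ((Q.basis k).repr (Q.basis k (v i)))) = F v
  simp only [Module.Basis.repr_self, finsuppLequivDFinsupp_apply_apply,
    Finsupp.toDFinsupp_single]
  rw [MultilinearMap.fromDFinsuppEquiv_single]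
  simp

/-- The product in `A` of the arrows of a word; it is `1` for the empty word. -/
def wordElem [Fintype V] (l : List E) : Q.Alg k :=
  (l.map fun α => Q.pathElem k (Q.arrowPath α)).prod

open Classical in
/-- The Hochschild cochain attached to a pair `(p, q)` of an anti-path `p` of length `n` and a
parallel path `q` of `A`, of degree `s = |q| - |p|`. It sends paths `v₁, …, vₙ` of `A` to
`∑ (-1)^{s |u|} u q w`, summed over all ways to write the word `v₁ ⋯ vₙ` as `u p w`. It is the
image of `p^* q ∈ Hom(k P_n, A)` under the comparison map from the Bardzell to the bar resolution:
for `n = 0` it is the element `q`, for `n = 1` the derivation sending the arrow `p` to `q`, and for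
`n ≥ 2` it can be non-zero only on tuples `u α₁, α₂, …, α_{n-1}, αₙ w` where `p = α₁ ⋯ αₙ`. -/
def pairCochain [Fintype V] (n : ℕ) (p q : PathWord V E) : Hochschild.Cochain k (Q.Alg k) n :=
  if p.length = n then
    Q.extendMultilinear k n fun v =>
      let L : List E := (List.ofFn fun i => (v i).1.arrows).flatten
      ∑ i ∈ Finset.range (L.length + 1),
        if (L.drop i).take n = p.arrows then
          (((Q.pathDeg q - Q.pathDeg p) * Q.wordDeg (L.take i)).negOnePow : ℤ) •
            (Q.wordElem k (L.take i) * Q.pathElem k q * Q.wordElem k (L.drop (i + n)))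
        else 0
  else 0

/-- Linear combinations of pairs `(p, q)`. The pairs of an anti-path `p` of length `n` and a path
`q` of `A` parallel to it form the usual basis of degree `n` of the Bardzell cochain complex. -/
abbrev PairChain (V E k : Type*) [Field k] : Type _ := (PathWord V E × PathWord V E) →₀ k

/-- The Hochschild `n`-cochain attached to a linear combination of pairs; pairs whose anti-path does
not have length `n` do not contribute. -/
def toHochschild [Fintype V] (n : ℕ) : PairChain V E k →ₗ[k] Hochschild.Cochain k (Q.Alg k) n :=
  Finsupp.linearCombination k fun x => Q.pairCochain k n x.1 x.2

/-! ### Complete and maximal paths and anti-paths -/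

/-- A complete anti-path `α₁ ⋯ α_l`: a closed anti-path of positive length with `α_l α₁ ∈ I`. -/
def IsCompleteAntiPath (p : PathWord V E) : Prop :=
  Q.IsAntiPath p ∧ p.tgt = p.src ∧
    ∃ α β : E, p.arrows.head? = some α ∧ p.arrows.getLast? = some β ∧ Q.rel β α

/-- A complete path `α₁ ⋯ α_l`: a closed path of `A` of positive length with `α_l α₁ ∉ I`. -/
def IsCompletePath (p : PathWord V E) : Prop :=
  Q.IsPathOfA p ∧ p.tgt = p.src ∧
    ∃ α β : E, p.arrows.head? = some α ∧ p.arrows.getLast? = some β ∧ ¬ Q.rel β α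

/-- The rotation `α₂ ⋯ α_l α₁` of a closed path `α₁ ⋯ α_l`. -/
def rot (p : PathWord V E) : PathWord V E :=
  match p.arrows with
  | [] => p
  | α :: l => ⟨Q.s α, Q.s α, l ++ [α]⟩

/-- The period of a closed path: the smallest `r ≥ 1` such that the `r`-fold rotation of `p`
is `p`. -/
def period (p : PathWord V E) : ℕ := Function.minimalPeriod Q.rot p

/-- `R` is a complete set of representatives of the rotation classes of elements of `S`. -/
def IsTransversal (S R : Set (PathWord V E)) : Prop :=
  R ⊆ S ∧ ∀ p ∈ S, ∃! r, r ∈ R ∧ ∃ i : ℕ, Q.rot^[i] r = p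

/-- `ω(p) = |p| - l(p)` for a complete anti-path `p`. -/
def antiWinding (p : PathWord V E) : ℤ := Q.pathDeg p - p.length

/-- `ω(q) = -|q|` for a complete path `q`. -/
def pathWinding (q : PathWord V E) : ℤ := -Q.pathDeg q

/-- A maximal anti-path: an anti-path of positive length which is not properly contained in a longer
anti-path. -/
def IsMaximalAntiPath (p : PathWord V E) : Prop :=
  Q.IsAntiPath p ∧ p.arrows ≠ [] ∧
    ∀ p', Q.IsAntiPath p' → p.arrows <:+: p'.arrows → p'.arrows = p.arrows

/-- A maximal path of `A`: a path of `A` of positive length which is not properly contained in a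
longer path of `A`. -/
def IsMaximalPath (p : PathWord V E) : Prop :=
  Q.IsPathOfA p ∧ p.arrows ≠ [] ∧
    ∀ p', Q.IsPathOfA p' → p.arrows <:+: p'.arrows → p'.arrows = p.arrows

/-- `q = u_∘`: a path of `A` parallel to the maximal anti-path `u` whose first and last arrows
differ from those of `u`. A trivial path, which has no arrows, is allowed if `u` is closed. -/
def IsOpposite (u q : PathWord V E) : Prop :=
  Q.IsPathOfA q ∧ q.tgt = u.tgt ∧ q.src = u.src ∧
    (∀ α : E, q.arrows.head? = some α → u.arrows.head? ≠ some α) ∧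
    (∀ α : E, q.arrows.getLast? = some α → u.arrows.getLast? ≠ some α)

/-! ### The basis elements -/

/-- `N⁰(p) = ∑_{i<r} (-1)^{i n + |p| |α₁ ⋯ α_i|} (rot^i p, s(rot^i p))` for a complete anti-path
`p = α₁ ⋯ αₙ` of period `r`. -/
def antiN0 (p : PathWord V E) : PairChain V E k :=
  ∑ i ∈ Finset.range (Q.period p),
    Finsupp.single (Q.rot^[i] p, PathWord.trivial E (Q.rot^[i] p).src)
      (((i * p.length + Q.pathDeg p * Q.wordDeg (p.arrows.take i) : ℤ).negOnePow : ℤ) : k)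

/-- `N¹(p) = (αₙ p, αₙ)` for a complete anti-path `p = α₁ ⋯ αₙ`. -/
def antiN1 (p : PathWord V E) : PairChain V E k :=
  match p.arrows.getLast? with
  | some α => Finsupp.single (⟨Q.t α, p.src, α :: p.arrows⟩, Q.arrowPath α) 1
  | none => 0

/-- `N⁰(q) = ∑_{i<r} (-1)^{|q| |β₁ ⋯ β_i|} (s(rot^i q), rot^i q)` for a complete path
`q = β₁ ⋯ βₙ` of period `r`. -/
def pathN0 (q : PathWord V E) : PairChain V E k :=
  ∑ i ∈ Finset.range (Q.period q),
    Finsupp.single (PathWord.trivial E (Q.rot^[i] q).src, Q.rot^[i] q)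
      (((Q.pathDeg q * Q.wordDeg (q.arrows.take i)).negOnePow : ℤ) : k)

/-- `N¹(q) = (βₙ, βₙ q)` for a complete path `q = β₁ ⋯ βₙ`. -/
def pathN1 (q : PathWord V E) : PairChain V E k :=
  match q.arrows.getLast? with
  | some β => Finsupp.single (Q.arrowPath β, ⟨Q.t β, q.src, β :: q.arrows⟩) 1
  | none => 0

/-- The index set of the basis, for a spanning tree `T` and complete sets of representatives `Pc`
and `Qc` of the rotation classes of complete anti-paths and of complete paths. -/
inductive BasisIndex (T : Set E) (Pc Qc : Set (PathWord V E)) : Type _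
  /-- the unit -/
  | unit
  /-- `N^s(p)` for `p ∈ Pc` -/
  | anti (s : Fin 2) (p : PathWord V E) (hp : p ∈ Pc)
      (parity : Even (Q.antiWinding p) ∨ ringChar k = 2)
  /-- `N^s(q)` for `q ∈ Qc` -/
  | path (s : Fin 2) (q : PathWord V E) (hq : q ∈ Qc)
      (parity : Even (Q.pathWinding q) ∨ ringChar k = 2)
  /-- `(u, u_∘)` for a maximal anti-path `u` -/
  | maxAnti (u q : PathWord V E) (hu : Q.IsMaximalAntiPath u) (hq : Q.IsOpposite u q)
  /-- `(s(u), u)` for a closed maximal path `u` of `A` -/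
  | maxPath (u : PathWord V E) (hu : Q.IsMaximalPath u) (closed : u.tgt = u.src)
  /-- `(α, α)` for an arrow `α` outside of `T` -/
  | arrow (α : E) (hα : α ∉ T)

namespace BasisIndex

variable {Q k} {T : Set E} {Pc Qc : Set (PathWord V E)}

/-- The bidegree `(n, d)` of a basis element. -/
def bidegree : Q.BasisIndex k T Pc Qc → ℕ × ℤ
  | unit => (0, 0)
  | anti s p _ _ => (p.length + s, -Q.pathDeg p)
  | path s q _ _ => (s, Q.pathDeg q)
  | maxAnti u q _ _ => (u.length, Q.pathDeg q - Q.pathDeg u)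
  | maxPath u _ _ => (0, Q.pathDeg u)
  | arrow _ _ => (1, 0)

/-- The total degree `n + d` of a basis element. -/
def totalDegree (b : Q.BasisIndex k T Pc Qc) : ℤ := b.bidegree.1 + b.bidegree.2

/-- The linear combination of parallel pairs which represents a basis element. -/
def chain [Fintype V] : Q.BasisIndex k T Pc Qc → PairChain V E k
  | unit => ∑ x : V, Finsupp.single (PathWord.trivial E x, PathWord.trivial E x) 1
  | anti s p _ _ => if s = 0 then Q.antiN0 k p else Q.antiN1 k p
  | path s q _ _ => if s = 0 then Q.pathN0 k q else Q.pathN1 k q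
  | maxAnti u q _ _ => Finsupp.single (u, q) 1
  | maxPath u _ _ => Finsupp.single (PathWord.trivial E u.src, u) 1
  | arrow α _ => Finsupp.single (Q.arrowPath α, Q.arrowPath α) 1

/-- The Hochschild cochains of all arities which represent a basis element; only the one whose arity
is the cohomological degree of the basis element is non-zero. -/
def cochain [Fintype V] (b : Q.BasisIndex k T Pc Qc) (n : ℕ) :
    Hochschild.Cochain k (Q.Alg k) n :=
  Q.toHochschild k n b.chain

end BasisIndex

end QuadraticQuiver

end

noncomputable section

namespace Hochschild

variable {k B : Type*} [Field k] [Ring B] [Algebra k B]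

/-! ### Cochains as functions on lists -/

/-! The algebra is quadratic monomial, so its Hochschild cohomology is computed by the Bardzell
complex, whose cochains of arity `n` are functions on pairs (p, q) of an anti-path p of length `n`
and a parallel path q of A. The comparison is made by hand. Restricting a cochain to tuples of
arrows that form an anti-path, `restr`, commutes with the differentials up to the sign (-1)^d
(`restr_differential`), and the explicit cochains of the theorem split this restriction
(`restr_toHochschild`). What remains is that a cocycle vanishing on anti-paths is a coboundary,
`mem_coboundaries_of_restr`. This is a discrete Morse argument on tuples of paths: a tuple which
follows an anti-path up to an arrow α and then leaves it with an entry x is paired with the tuple in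
which α and x are merged, and only the anti-paths stay unpaired. Homotopies that read off an
anti-path at the start of a tuple remove the values on one stage after the other (`exists_vanish`),
and a cocycle normalised in this way is determined by its values on anti-paths
(`eq_zero_of_vanish`).

The Bardzell complex of a gentle quiver falls apart into very small pieces. A pair has at most two
faces, got by removing a common first arrow (`lam`) or a common last arrow (`rho`). No pair is a
left face and has a left face at once, since some product of two arrows would lie both in I and
outside I; likewise on the right. Gentleness makes the extension of a pair on either side unique,
unless both of its words are trivial. Hence the pieces are: - edges and squares, which are acyclic
(`exists_common_extension`); - isolated pairs, which are the (u, u_∘) and the closed maximal paths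
(`isolated_cases`); - for every rotation class of complete anti-paths or complete paths, a closed
cycle of pairs (`IsCycleSystem`); running once around it multiplies a cocycle by (-1)^ω
(`sign_anti`, `sign_path`), so the cycle contributes a class in two adjacent degrees if this sign is
1 in the field, and nothing otherwise; - the complex of vertices and arrows of Q, whose cohomology
has the unit and the arrows outside a spanning tree as a basis.

Spanning is proved by shrinking the support of a cocycle one pair at a time (`exists_reduction`,
`mem_chainSpan`). Independence holds because distinct basis elements involve disjoint sets of pairs
and each has a leading pair at which no relevant coboundary can be non-zero
(`BasisIndex.eq_zero_of_sum_chain`). The total complex in a fixed degree is the product over the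
arities, and `W_j` only sees arities below `j`; collecting the finite expansions of all arities
gives the Schauder basis. -/

/-- The value of an `n`-cochain on a list of length `n`, and zero on lists of another length. -/
def evalList {n : ℕ} (f : Cochain k B n) (l : List B) : B :=
  if h : l.length = n then f (fun i => l.get (i.cast h.symm)) else 0

theorem evalList_ofFn {n : ℕ} (f : Cochain k B n) (a : Fin n → B) :
    evalList f (List.ofFn a) = f a := by
  rw [evalList, dif_pos (by simp)]
  congr 1
  funext i
  simp

theorem evalList_of_length {n : ℕ} (f : Cochain k B n) {l : List B} (h : l.length ≠ n) :
    evalList f l = 0 := dif_neg h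

/-- This is the only consequence of multilinearity needed to pass from elements of A to paths:
products of paths which lie in I may be dropped. -/
theorem evalList_append_zero {n : ℕ} (f : Cochain k B n) (u v : List B) :
    evalList f (u ++ 0 :: v) = 0 := by
  unfold evalList
  split_ifs with h
  · have hu : u.length < n := by rw [← h]; simp
    refine MultilinearMap.map_coord_zero (f : MultilinearMap k (fun _ : Fin n => B) B)
      ⟨u.length, hu⟩ ?_
    simp
  · rfl

theorem evalList_add {n : ℕ} (f g : Cochain k B n) (l : List B) :
    evalList (f + g) l = evalList f l + evalList g l := by
  unfold evalList
  split_ifs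
  · rfl
  · simp

theorem evalList_smul {n : ℕ} (c : k) (f : Cochain k B n) (l : List B) :
    evalList (c • f) l = c • evalList f l := by
  unfold evalList
  split_ifs
  · rfl
  · simp

theorem evalList_zero {n : ℕ} (l : List B) : evalList (0 : Cochain k B n) l = 0 := by
  unfold evalList
  split_ifs <;> rfl

/-- The part of the Hochschild differential which involves the product in `B` and the right
multiplication, on functions on lists. -/
def barDiff : (List B → B) → List B → B
  | _, [] => 0
  | F, [a] => -(F [] * a)
  | F, a :: b :: l => -F (a * b :: l) - barDiff (fun m => F (a :: m)) (b :: l)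

theorem barDiff_congr {F G : List B → B} {l : List B}
    (h : ∀ m, m.length + 1 = l.length → F m = G m) : barDiff F l = barDiff G l := by
  induction l generalizing F G with
  | nil => rfl
  | cons a l ih =>
    cases l with
    | nil => simp [barDiff, h [] rfl]
    | cons b l =>
      simp only [barDiff]
      rw [h _ (by simp), ih fun m hm => h _ (by simpa using hm)]

theorem barDiff_add (F G : List B → B) (l : List B) :
    barDiff (fun m => F m + G m) l = barDiff F l + barDiff G l := by
  induction l generalizing F G with
  | nil => simp [barDiff]
  | cons a l ih =>
    cases l with
    | nil => simp [barDiff, add_mul]; abel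
    | cons b l => simp only [barDiff]; rw [ih]; abel

theorem barDiff_neg (F : List B → B) (l : List B) :
    barDiff (fun m => -F m) l = -barDiff F l := by
  induction l generalizing F with
  | nil => simp [barDiff]
  | cons a l ih =>
    cases l with
    | nil => simp [barDiff]
    | cons b l => simp only [barDiff]; rw [ih]; abel

theorem barDiff_mul_left (c : B) (F : List B → B) (l : List B) :
    barDiff (fun m => c * F m) l = c * barDiff F l := by
  induction l generalizing F with
  | nil => simp [barDiff]
  | cons a l ih =>
    cases l with
    | nil => simp [barDiff, mul_assoc]
    | cons b l => simp only [barDiff]; rw [ih, mul_sub, mul_neg]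

/-- The induction is on the list, for all `F` simultaneously, because the recursion of `barDiff`
changes the function. Associativity enters where two neighbouring products overlap. -/
theorem barDiff_barDiff (F : List B → B) (l : List B) : barDiff (barDiff F) l = 0 := by
  induction l generalizing F with
  | nil => rfl
  | cons a l ih =>
    cases l with
    | nil => simp [barDiff]
    | cons b l =>
      cases l with
      | nil => simp [barDiff, mul_assoc]
      | cons c l =>
        -- One step of the recursion writes `barDiff F (a :: m)` as a merged value plus the
        -- `barDiff` of `F (a :: ·)`; the second part dies by the induction hypothesis. The default
        -- in `headD 0` is never reached, as only non-empty `m` are evaluated.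
        have h1 : barDiff (fun m => barDiff F (a :: m)) (b :: c :: l) =
            -barDiff (fun m => F ((a * m.headD 0) :: m.tail)) (b :: c :: l) := by
          have : barDiff (fun m => barDiff F (a :: m)) (b :: c :: l) =
              barDiff (fun m => (-F ((a * m.headD 0) :: m.tail)) +
                -barDiff (fun m => F (a :: m)) m) (b :: c :: l) := by
            refine barDiff_congr fun m hm => ?_
            cases m with
            | nil => simp at hm
            | cons x m => simp [barDiff, sub_eq_add_neg]
          rw [this, barDiff_add, barDiff_neg, barDiff_neg, ih, neg_zero, add_zero]
        rw [barDiff, h1]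
        simp only [barDiff, List.headD_cons, List.tail_cons]
        simp [mul_assoc]

/-! ### The Hochschild differential on functions on lists -/

variable (𝒜 : ℤ → Submodule k B) [GradedAlgebra 𝒜]

/-- The Hochschild differential on functions on lists, without the global sign `(-1)^d`. -/
def listDiff (d : ℤ) (F : List B → B) : List B → B
  | [] => 0
  | a :: l => koszul 𝒜 d a * F l + barDiff F (a :: l)

theorem listDiff_cons (d : ℤ) (F : List B → B) (a : B) (l : List B) :
    listDiff 𝒜 d F (a :: l) = koszul 𝒜 d a * F l + barDiff F (a :: l) := rfl

theorem koszul_of_mem (d : ℤ) {i : ℤ} {a : B} (ha : a ∈ 𝒜 i) :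
    koszul 𝒜 d a = (((d * i).negOnePow : ℤˣ) : ℤ) • a := by
  have : DirectSum.decompose 𝒜 a = DirectSum.of (fun i => 𝒜 i) i ⟨a, ha⟩ :=
    DirectSum.decompose_of_mem 𝒜 ha
  simp only [koszul, LinearMap.comp_apply, LinearEquiv.coe_coe,
    DirectSum.decomposeLinearEquiv_apply, this]
  exact DirectSum.toModule_lof k i _

/-- Multiplicativity of the Koszul sign is what lets the two-fold left multiplication cancel against
the merging of the first two entries in `listDiff_listDiff`. -/
theorem koszul_mul (d : ℤ) (a b : B) :
    koszul 𝒜 d (a * b) = koszul 𝒜 d a * koszul 𝒜 d b := by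
  induction a using DirectSum.Decomposition.inductionOn 𝒜 with
  | zero => simp
  | add a a' h h' => rw [add_mul, map_add, h, h', map_add, add_mul]
  | homogeneous a =>
    induction b using DirectSum.Decomposition.inductionOn 𝒜 with
    | zero => simp
    | add b b' h h' => rw [mul_add, map_add, h, h', map_add, mul_add]
    | homogeneous b =>
      rw [koszul_of_mem 𝒜 d a.2, koszul_of_mem 𝒜 d b.2,
        koszul_of_mem 𝒜 d (SetLike.mul_mem_graded a.2 b.2), mul_add, Int.negOnePow_add,
        smul_mul_smul_comm]
      simp

theorem listDiff_listDiff (d : ℤ) (F : List B → B) (l : List B) :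
    listDiff 𝒜 d (listDiff 𝒜 d F) l = 0 := by
  cases l with
  | nil => rfl
  | cons a l =>
    have h0 : listDiff 𝒜 d F = fun m =>
        (m.head?.elim 0 (fun x => koszul 𝒜 d x * F m.tail)) + barDiff F m := by
      funext m
      cases m <;> simp [listDiff, barDiff]
    cases l with
    | nil => simp [listDiff, barDiff]
    | cons b l =>
      have h1 : barDiff (listDiff 𝒜 d F) (a :: b :: l) =
          barDiff (fun m => m.head?.elim 0 (fun x => koszul 𝒜 d x * F m.tail)) (a :: b :: l) := by
        rw [h0, barDiff_add, barDiff_barDiff, add_zero]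
      have h2 : barDiff (fun m => koszul 𝒜 d a * F m) (b :: l) =
          koszul 𝒜 d a * barDiff F (b :: l) := barDiff_mul_left _ _ _
      rw [listDiff, h1]
      simp only [listDiff, barDiff, List.head?_cons, Option.elim_some, List.tail_cons, h2]
      rw [koszul_mul, mul_add, mul_assoc]
      abel

/-- Each entry passed by the recursion contributes one minus sign, which produces the alternating
signs of the classical formula. -/
theorem barDiff_ofFn {n : ℕ} (F : List B → B) (a : Fin (n + 1) → B) :
    barDiff F (List.ofFn a) =
      (-1 : ℤ) ^ (n + 1) • (F (List.ofFn (Fin.init a)) * a (Fin.last n)) +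
        ∑ i : Fin n, (-1 : ℤ) ^ ((i : ℕ) + 1) •
          F (List.ofFn (Fin.contractNth i.castSucc (· * ·) a)) := by
  induction n generalizing F with
  | zero => simp [barDiff]
  | succ n ih =>
    have e1 : List.ofFn a = a 0 :: a 1 :: List.ofFn (fun i : Fin n => a i.succ.succ) := by
      rw [List.ofFn_succ, List.ofFn_succ]
      rfl
    have e2 : a 1 :: List.ofFn (fun i : Fin n => a i.succ.succ) = List.ofFn (Fin.tail a) := by
      rw [List.ofFn_succ]
      rfl
    have e3 : Fin.contractNth (0 : Fin (n + 1)).castSucc (· * ·) a =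
        Fin.cons (a 0 * a 1) (fun i : Fin n => a i.succ.succ) := by
      funext i
      cases i using Fin.cases with
      | zero => simp [Fin.contractNth]
      | succ i => simp [Fin.contractNth]
    have e4 : ∀ i : Fin n, Fin.contractNth i.succ.castSucc (· * ·) a =
        Fin.cons (a 0) (Fin.contractNth i.castSucc (· * ·) (Fin.tail a)) := by
      intro i
      funext j
      cases j using Fin.cases with
      | zero => simp [Fin.contractNth]
      | succ j => simp [Fin.contractNth, Fin.tail]
    have e5 : Fin.init a = Fin.cons (a 0) (Fin.init (Fin.tail a)) := by
      funext j
      cases j using Fin.cases with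
      | zero => simp [Fin.init]
      | succ j => simp [Fin.init, Fin.tail]
    rw [e1, barDiff, e2, ih, Fin.sum_univ_succ, e3, e5]
    simp only [e4, List.ofFn_cons, Fin.val_succ]
    simp only [pow_succ _ (_ + 1), mul_neg, mul_one, neg_smul, Finset.sum_neg_distrib, Fin.val_zero]
    have : Fin.tail a (Fin.last n) = a (Fin.last (n + 1)) := rfl
    rw [this]
    simp
    abel

theorem evalList_differential (d : ℤ) {n : ℕ} (f : Cochain k B n) {l : List B}
    (hl : l.length = n + 1) :
    evalList (differential 𝒜 d n f) l =
      ((d.negOnePow : ℤˣ) : ℤ) • listDiff 𝒜 d (evalList f) l := by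
  obtain ⟨a, rfl⟩ : ∃ a : Fin (n + 1) → B, l = List.ofFn a :=
    ⟨fun i => l.get (i.cast hl.symm), 
      List.ext_getElem (by simp [hl]) fun i h1 h2 => by simp [-List.ofFn_succ]⟩
  rw [evalList_ofFn]
  have h1 : listDiff 𝒜 d (evalList f) (List.ofFn a) =
      koszul 𝒜 d (a 0) * f (Fin.tail a) + barDiff (evalList f) (List.ofFn a) := by
    rw [List.ofFn_succ, listDiff]
    congr 2
    exact evalList_ofFn f _
  rw [h1, barDiff_ofFn]
  simp only [evalList_ofFn]
  rw [← add_assoc]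
  rfl

theorem ext_evalList {n : ℕ} {f g : Cochain k B n}
    (h : ∀ l : List B, l.length = n → evalList f l = evalList g l) : f = g := by
  refine MultilinearMap.ext fun a => ?_
  have := h (List.ofFn a) (by simp)
  rwa [evalList_ofFn, evalList_ofFn] at this

theorem differential_differential (d : ℤ) {n : ℕ} (f : Cochain k B n) :
    differential 𝒜 d (n + 1) (differential 𝒜 d n f) = 0 := by
  refine ext_evalList fun l hl => ?_
  rw [evalList_differential 𝒜 d _ hl, evalList_zero]
  have h : listDiff 𝒜 d (evalList (differential 𝒜 d n f)) l =
      listDiff 𝒜 d (fun m => ((d.negOnePow : ℤˣ) : ℤ) • listDiff 𝒜 d (evalList f) m) l := by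
    cases l with
    | nil => rfl
    | cons a l =>
      simp only [listDiff]
      rw [evalList_differential 𝒜 d f (by simpa using hl)]
      congr 1
      exact barDiff_congr fun m hm => evalList_differential 𝒜 d f (by simp at hm hl; omega)
  rw [h]
  rcases Int.units_eq_one_or d.negOnePow with h1 | h1
  · simp only [h1, Units.val_one, one_smul]
    exact listDiff_listDiff 𝒜 d _ l
  · simp only [h1, Units.val_neg, Units.val_one, neg_smul, one_smul]
    have h2 := listDiff_listDiff 𝒜 d (evalList f) l
    cases l with
    | nil => simp [listDiff]
    | cons a l =>
      rw [listDiff_cons] at h2 ⊢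
      rw [barDiff_neg (listDiff 𝒜 d (evalList f)), mul_neg, ← neg_add, h2, neg_zero, neg_zero]

end Hochschild

end

noncomputable section

open Hochschild

namespace QuadraticQuiver

variable {V E : Type*} {Q : QuadraticQuiver V E} {k : Type*} [Field k]

set_option linter.unusedSectionVars false

/-! ### Words in paths -/

variable (k) in
/-- The sign `(-1)^m` as an element of `k`. -/
def sgn (m : ℤ) : k := ((m.negOnePow : ℤˣ) : ℤ)

theorem sgn_add (m n : ℤ) : sgn k (m + n) = sgn k m * sgn k n := by
  simp [sgn, Int.negOnePow_add]

theorem sgn_zero : sgn k 0 = 1 := by simp [sgn]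

theorem sgn_mul_self (m : ℤ) : sgn k m * sgn k m = 1 := by
  rw [← sgn_add, sgn, Int.negOnePow_even _ ⟨m, rfl⟩]
  simp

theorem sgn_ne_zero (m : ℤ) : sgn k m ≠ 0 := fun h => by
  have := sgn_mul_self (k := k) m
  simp [h] at this

theorem sgn_natCast (n : ℕ) : sgn k n = (-1) ^ n := by
  simp [sgn, Int.negOnePow_def, zpow_natCast]

theorem zsmul_negOnePow {M : Type*} [AddCommGroup M] [Module k M] (m : ℤ) (a : M) :
    ((m.negOnePow : ℤˣ) : ℤ) • a = sgn k m • a := by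
  rw [sgn, Int.cast_smul_eq_zsmul]

/-- The concatenation of two words. -/
def comp (x y : PathWord V E) : PathWord V E := ⟨x.tgt, y.src, x.arrows ++ y.arrows⟩

variable (Q) in
/-- The product of the two paths is non-zero in `A`. -/
def Ok (x y : PathWord V E) : Prop := x.src = y.tgt ∧ Q.IsPathOfA (comp x y)

theorem pathElem_mul_pathElem {x y : PathWord V E} (hx : Q.IsPathOfA x) (hy : Q.IsPathOfA y)
    [Decidable (Q.Ok x y)] :
    Q.pathElem k x * Q.pathElem k y = if Q.Ok x y then Q.pathElem k (comp x y) else 0 := by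
  split_ifs with h
  · exact pathElem_mul _ _ hx.1 hy.1 h.1
  · by_cases h1 : x.src = y.tgt
    · rw [pathElem_mul _ _ hx.1 hy.1 h1]
      exact pathElem_of_not fun h2 => h ⟨h1, h2⟩
    · exact pathElem_mul_of_ne _ _ h1

theorem isPathOfA_trivial (x : V) : Q.IsPathOfA (.trivial E x) := ⟨rfl, List.isChain_nil⟩

theorem isPathOfA_arrowPath (α : E) : Q.IsPathOfA (Q.arrowPath α) :=
  ⟨⟨rfl, rfl⟩, List.isChain_singleton _⟩

theorem IsPathOfA.eq_trivial {x : PathWord V E} (hx : Q.IsPathOfA x) (h : x.arrows = []) :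
    x = .trivial E x.tgt := by
  obtain ⟨a, b, l⟩ := x
  obtain rfl : l = [] := h
  obtain rfl : a = b := hx.1
  rfl

theorem IsPathOfA.tgt_eq {x : PathWord V E} (hx : Q.IsPathOfA x) {α : E} {m : List E}
    (h : x.arrows = α :: m) : x.tgt = Q.t α := by
  obtain ⟨a, b, l⟩ := x
  obtain rfl : l = α :: m := h
  exact hx.1.1.symm

theorem IsPathOfA.tail {x : PathWord V E} (hx : Q.IsPathOfA x) {α : E} {m : List E}
    (h : x.arrows = α :: m) : Q.IsPathOfA ⟨Q.s α, x.src, m⟩ := by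
  obtain ⟨a, b, l⟩ := x
  obtain rfl : l = α :: m := h
  exact ⟨hx.1.2, hx.2.tail⟩

variable (Q) in
/-- No relation starts with `α` followed by the first arrow of `x`. -/
def Bad (α : E) (x : PathWord V E) : Prop := ∀ β m, x.arrows = β :: m → ¬ Q.rel α β

theorem ok_arrow_iff {α : E} {x : PathWord V E} (hx : Q.IsPathOfA x) :
    Q.Ok (Q.arrowPath α) x ↔ Q.s α = x.tgt ∧ Q.Bad α x := by
  obtain ⟨a, b, l⟩ := x
  refine and_congr_right fun h => ?_
  change Q.s α = a at h
  constructor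
  · rintro ⟨-, h2⟩ β m rfl
    exact (List.isChain_cons_cons.1 h2).1
  · intro h2
    refine ⟨⟨rfl, h ▸ hx.1⟩, ?_⟩
    cases l with
    | nil => exact List.isChain_singleton _
    | cons β m => exact List.isChain_cons_cons.2 ⟨h2 β m rfl, hx.2⟩

theorem not_ok_arrow {α β : E} (h : Q.rel α β) {x : PathWord V E} {m : List E}
    (hx : x.arrows = β :: m) : ¬ Q.Ok (Q.arrowPath α) x := by
  rintro ⟨-, -, h2⟩
  rw [comp, hx] at h2
  exact (List.isChain_cons_cons.1 h2).1 h

variable (Q) in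
/-- All words of the list are paths of `A`. -/
def AllPaths (l : List (PathWord V E)) : Prop := ∀ x ∈ l, Q.IsPathOfA x

theorem allPaths_cons {x : PathWord V E} {l : List (PathWord V E)} :
    Q.AllPaths (x :: l) ↔ Q.IsPathOfA x ∧ Q.AllPaths l := by
  simp [AllPaths]

theorem allPaths_append {l m : List (PathWord V E)} :
    Q.AllPaths (l ++ m) ↔ Q.AllPaths l ∧ Q.AllPaths m := by
  simp [AllPaths, or_imp, forall_and]

theorem allPaths_nil : Q.AllPaths [] := by simp [AllPaths]

theorem allPaths_map_arrowPath (l : List E) : Q.AllPaths (l.map Q.arrowPath) := by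
  intro x hx
  obtain ⟨α, -, rfl⟩ := List.mem_map.1 hx
  exact isPathOfA_arrowPath α

/-! ### The Hochschild differential on tuples of paths of A -/

section Diff

variable [Fintype V]

open Classical in
/-- The inner and right part of the Hochschild differential on functions on lists of paths. -/
def wordDiff : (List (PathWord V E) → Q.Alg k) → List (PathWord V E) → Q.Alg k
  | _, [] => 0
  | F, [x] => -(F [] * Q.pathElem k x)
  | F, x :: y :: l =>
    -(if Q.Ok x y then F (comp x y :: l) else 0) - wordDiff (fun m => F (x :: m)) (y :: l)

/-- Entries are merged only if their product is non-zero in A, so the differential never leaves the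
lists of paths of A. -/
theorem wordDiff_congr {F G : List (PathWord V E) → Q.Alg k} {l : List (PathWord V E)}
    (hl : Q.AllPaths l) (h : ∀ m, Q.AllPaths m → m.length + 1 = l.length → F m = G m) :
    wordDiff F l = wordDiff G l := by
  induction l generalizing F G with
  | nil => rfl
  | cons a l ih =>
    cases l with
    | nil => simp [wordDiff, h [] allPaths_nil rfl]
    | cons b l =>
      have h1 := allPaths_cons.1 hl
      simp only [wordDiff]
      rw [ih h1.2 fun m hm hm' => h _ (allPaths_cons.2 ⟨h1.1, hm⟩) (by simpa using hm')]
      congr 2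
      split_ifs with h2
      · exact h _ (allPaths_cons.2 ⟨h2.2, (allPaths_cons.1 h1.2).2⟩) (by simp)
      · rfl

theorem wordDiff_zero (l : List (PathWord V E)) :
    wordDiff (fun _ => (0 : Q.Alg k)) l = 0 := by
  induction l with
  | nil => rfl
  | cons a l ih =>
    cases l with
    | nil => simp [wordDiff]
    | cons b l => simp [wordDiff, ih]

theorem wordDiff_eq_zero {F : List (PathWord V E) → Q.Alg k} {l : List (PathWord V E)}
    (hl : Q.AllPaths l) (h : ∀ m, Q.AllPaths m → m.length + 1 = l.length → F m = 0) :
    wordDiff F l = 0 :=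
  (wordDiff_congr hl h).trans (wordDiff_zero l)

theorem wordDiff_add (F G : List (PathWord V E) → Q.Alg k) (l : List (PathWord V E)) :
    wordDiff (fun m => F m + G m) l = wordDiff F l + wordDiff G l := by
  induction l generalizing F G with
  | nil => simp [wordDiff]
  | cons a l ih =>
    cases l with
    | nil => simp [wordDiff, add_mul]; abel
    | cons b l => simp only [wordDiff]; rw [ih]; split_ifs <;> abel

theorem wordDiff_mul_left (c : Q.Alg k) (F : List (PathWord V E) → Q.Alg k)
    (l : List (PathWord V E)) : wordDiff (fun m => c * F m) l = c * wordDiff F l := by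
  induction l generalizing F with
  | nil => simp [wordDiff]
  | cons a l ih =>
    cases l with
    | nil => simp [wordDiff, mul_assoc]
    | cons b l => simp only [wordDiff]; rw [ih, mul_sub, mul_neg]; split_ifs <;> simp

theorem wordDiff_sum {ι : Type*} (s : Finset ι) (F : ι → List (PathWord V E) → Q.Alg k)
    (l : List (PathWord V E)) :
    wordDiff (fun m => ∑ i ∈ s, F i m) l = ∑ i ∈ s, wordDiff (F i) l := by
  classical
  induction s using Finset.induction_on with
  | empty => simp [wordDiff_zero]
  | insert i s hi ih => simp only [Finset.sum_insert hi, wordDiff_add, ih]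

/-- The Hochschild differential on functions on lists of paths, without its global sign. -/
def fullDiff (d : ℤ) (F : List (PathWord V E) → Q.Alg k) : List (PathWord V E) → Q.Alg k
  | [] => 0
  | x :: l => sgn k (d * Q.pathDeg x) • (Q.pathElem k x * F l) + wordDiff F (x :: l)

theorem fullDiff_cons (d : ℤ) (F : List (PathWord V E) → Q.Alg k) (x : PathWord V E)
    (l : List (PathWord V E)) : fullDiff d F (x :: l) =
      sgn k (d * Q.pathDeg x) • (Q.pathElem k x * F l) + wordDiff F (x :: l) := rfl

theorem fullDiff_congr (d : ℤ) {F G : List (PathWord V E) → Q.Alg k} {l : List (PathWord V E)}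
    (hl : Q.AllPaths l) (h : ∀ m, Q.AllPaths m → m.length + 1 = l.length → F m = G m) :
    fullDiff d F l = fullDiff d G l := by
  cases l with
  | nil => rfl
  | cons x l =>
    rw [fullDiff_cons, fullDiff_cons, wordDiff_congr hl h, h l (allPaths_cons.1 hl).2 rfl]

/-! ### Values of cochains on tuples of paths -/

/-- The values of a cochain on lists of paths. -/
def onWords {n : ℕ} (f : Cochain k (Q.Alg k) n) (l : List (PathWord V E)) : Q.Alg k :=
  evalList f (l.map (Q.pathElem k))

theorem onWords_of_length {n : ℕ} (f : Cochain k (Q.Alg k) n) {l : List (PathWord V E)}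
    (h : l.length ≠ n) : onWords f l = 0 :=
  evalList_of_length f (by simpa using h)

theorem onWords_add {n : ℕ} (f g : Cochain k (Q.Alg k) n) (l : List (PathWord V E)) :
    onWords (f + g) l = onWords f l + onWords g l := evalList_add _ _ _

theorem onWords_smul {n : ℕ} (c : k) (f : Cochain k (Q.Alg k) n) (l : List (PathWord V E)) :
    onWords (c • f) l = c • onWords f l := evalList_smul _ _ _

theorem onWords_zero {n : ℕ} (l : List (PathWord V E)) :
    onWords (0 : Cochain k (Q.Alg k) n) l = 0 := evalList_zero _

theorem onWords_sub {n : ℕ} (f g : Cochain k (Q.Alg k) n) (l : List (PathWord V E)) :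
    onWords (f - g) l = onWords f l - onWords g l := by
  have : f - g = f + (-1 : k) • g := by rw [neg_one_smul, sub_eq_add_neg]
  rw [this, onWords_add, onWords_smul, neg_one_smul, sub_eq_add_neg]

theorem ext_onWords {n : ℕ} {f g : Cochain k (Q.Alg k) n}
    (h : ∀ l, Q.AllPaths l → l.length = n → onWords f l = onWords g l) : f = g := by
  refine Module.Basis.ext_multilinear (fun _ => Q.basis k) fun v => ?_
  have := h (List.ofFn fun i => (v i).1) (by
    intro x hx
    obtain ⟨i, rfl⟩ := List.mem_ofFn.1 hx
    exact (v i).2) (by simp)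
  have e : (List.ofFn fun i => (v i).1).map (Q.pathElem k) =
      List.ofFn fun i => Q.basis k (v i) := by
    rw [List.map_ofFn]
    congr 1
    funext i
    exact (basis_eq (v i)).symm
  rwa [onWords, onWords, e, evalList_ofFn, evalList_ofFn] at this

theorem onWords_extendMultilinear {n : ℕ} (G : List (PathWord V E) → Q.Alg k)
    {l : List (PathWord V E)} (hl : Q.AllPaths l) (hn : l.length = n) :
    onWords (Q.extendMultilinear k n fun v => G (List.ofFn fun i => (v i).1)) l = G l := by
  subst hn
  have e : l.map (Q.pathElem k) =
      List.ofFn fun i : Fin l.length => Q.basis k ⟨l.get i, hl _ (l.get_mem i)⟩ := by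
    refine List.ext_getElem (by simp) fun i h1 h2 => ?_
    simp [basis_eq]
  rw [onWords, e, evalList_ofFn, extendMultilinear_basis]
  congr 1
  exact List.ofFn_get l

theorem pathElem_mem_grading (x : PathWord V E) :
    Q.pathElem k x ∈ Q.grading k (Q.pathDeg x) := by
  by_cases h : Q.IsPathOfA x
  · rw [pathElem_of h]
    exact basis_mem_grading ⟨x, h⟩
  · rw [pathElem_of_not h]
    exact zero_mem _

theorem koszul_pathElem (d : ℤ) (x : PathWord V E) :
    koszul (Q.grading k) d (Q.pathElem k x) = sgn k (d * Q.pathDeg x) • Q.pathElem k x := by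
  rw [koszul_of_mem _ d (pathElem_mem_grading x), zsmul_negOnePow (k := k)]

theorem barDiff_map_pathElem {F : List (Q.Alg k) → Q.Alg k}
    (hF : ∀ u v, F (u ++ 0 :: v) = 0) {l : List (PathWord V E)} (hl : Q.AllPaths l) :
    barDiff F (l.map (Q.pathElem k)) = wordDiff (fun m => F (m.map (Q.pathElem k))) l := by
  classical
  induction l generalizing F with
  | nil => rfl
  | cons x l ih =>
    cases l with
    | nil => rfl
    | cons y l =>
      have h1 := allPaths_cons.1 hl
      have h2 := allPaths_cons.1 h1.2
      have := @ih (fun m => F (Q.pathElem k x :: m)) (fun u v => hF (_ :: u) v) h1.2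
      simp only [List.map_cons, barDiff, wordDiff] at this ⊢
      rw [this, pathElem_mul_pathElem h1.1 h2.1]
      congr 2
      split_ifs
      · rfl
      · exact hF [] _

theorem onWords_differential (d : ℤ) {n : ℕ} (f : Cochain k (Q.Alg k) n)
    {l : List (PathWord V E)} (hl : Q.AllPaths l) (hn : l.length = n + 1) :
    onWords (differential (Q.grading k) d n f) l = sgn k d • fullDiff d (onWords f) l := by
  rw [onWords, evalList_differential _ d f (by simpa using hn), zsmul_negOnePow (k := k)]
  cases l with
  | nil => rfl
  | cons x l =>
    rw [List.map_cons, listDiff_cons, fullDiff_cons, koszul_pathElem, ← List.map_cons,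
      barDiff_map_pathElem (evalList_append_zero f) hl, smul_mul_assoc]
    rfl

theorem fullDiff_onWords_of_length (d : ℤ) {n : ℕ} (f : Cochain k (Q.Alg k) n)
    {l : List (PathWord V E)} (hl : Q.AllPaths l) (hn : l.length ≠ n + 1) :
    fullDiff d (onWords f) l = 0 := by
  cases l with
  | nil => rfl
  | cons x l =>
    rw [fullDiff_cons, onWords_of_length f (by simpa using hn), mul_zero, smul_zero, zero_add]
    exact wordDiff_eq_zero hl fun m _ hm => onWords_of_length f (by simp at hm hn; omega)

/-- On lists of length other than `n + 1` the right-hand condition is automatic. Stating it for all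
lists frees the arguments about cocycles below from any bookkeeping of arities. -/
theorem differential_eq_zero_iff (d : ℤ) {n : ℕ} (f : Cochain k (Q.Alg k) n) :
    differential (Q.grading k) d n f = 0 ↔
      ∀ l, Q.AllPaths l → fullDiff d (onWords f) l = 0 := by
  constructor
  · intro h l hl
    by_cases hn : l.length = n + 1
    · have := onWords_differential d f hl hn
      rw [h, onWords_zero] at this
      exact (smul_eq_zero.1 this.symm).resolve_left (sgn_ne_zero d)
    · exact fullDiff_onWords_of_length d f hl hn
  · intro h
    refine ext_onWords fun l hl hn => ?_
    rw [onWords_differential d f hl hn, h l hl, smul_zero, onWords_zero]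

end Diff

/-! ### The contracting homotopies -/

section Homotopy

variable [Fintype V]

open Classical in
/-- Reads off an anti-path of length `j + 1` which starts with `β` in a list of paths whose first
entry is `β w`, and applies `H` to the anti-path, to what is left of the entry which contains its
last arrow, and to the rest of the list. -/
def readAnti : ℕ → E → PathWord V E →
    (List E → PathWord V E → List (PathWord V E) → Q.Alg k) → List (PathWord V E) → Q.Alg k
  | 0, _, w, H, l => H [] w l
  | _ + 1, _, _, _, [] => 0
  | j + 1, β, w, H, y :: l =>
    if w.arrows = [] then
      match y.arrows with
      | [] => 0
      | γ :: m => if Q.rel β γ then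
          readAnti j γ ⟨Q.s γ, y.src, m⟩ (fun p => H (γ :: p)) l else 0
    else 0

theorem readAnti_zero (β : E) (w : PathWord V E)
    (H : List E → PathWord V E → List (PathWord V E) → Q.Alg k) (l : List (PathWord V E)) :
    readAnti 0 β w H l = H [] w l := by
  cases l <;> rfl

theorem readAnti_nil (j : ℕ) (β : E) (w : PathWord V E)
    (H : List E → PathWord V E → List (PathWord V E) → Q.Alg k) :
    readAnti (j + 1) β w H [] = 0 := rfl

theorem readAnti_ne {w : PathWord V E} (hw : w.arrows ≠ []) (j : ℕ) (β : E)
    (H : List E → PathWord V E → List (PathWord V E) → Q.Alg k) (l : List (PathWord V E)) :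
    readAnti (j + 1) β w H l = 0 := by
  cases l with
  | nil => rfl
  | cons y l => simp [readAnti, hw]

theorem readAnti_eq {w w' : PathWord V E} (hw : w.arrows = []) (hw' : w'.arrows = []) (j : ℕ)
    (β : E) (H : List E → PathWord V E → List (PathWord V E) → Q.Alg k)
    (l : List (PathWord V E)) : readAnti (j + 1) β w H l = readAnti (j + 1) β w' H l := by
  cases l with
  | nil => rfl
  | cons y l => simp [readAnti, hw, hw']

theorem readAnti_bad {β : E} {y : PathWord V E} (hy : Q.Bad β y) (j : ℕ) (w : PathWord V E)
    (H : List E → PathWord V E → List (PathWord V E) → Q.Alg k) (l : List (PathWord V E)) :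
    readAnti (j + 1) β w H (y :: l) = 0 := by
  obtain ⟨a, b, m⟩ := y
  cases m with
  | nil => simp [readAnti]
  | cons γ m => simp [readAnti, hy γ m rfl]

theorem readAnti_step {β γ : E} (h : Q.rel β γ) {w : PathWord V E} (hw : w.arrows = []) (j : ℕ)
    (H : List E → PathWord V E → List (PathWord V E) → Q.Alg k) (a x : V) (m : List E)
    (l : List (PathWord V E)) :
    readAnti (j + 1) β w H (⟨a, x, γ :: m⟩ :: l) =
      readAnti j γ ⟨Q.s γ, x, m⟩ (fun p => H (γ :: p)) l := by
  simp [readAnti, hw, h]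

variable (Q) in
/-- The arrow `α` followed by the arrows `pre` is an anti-path, and its last arrow does not form a
relation with the first arrow of `x`. -/
def BadAfter : E → List E → PathWord V E → Prop
  | α, [], x => Q.Bad α x
  | α, β :: pre, x => Q.rel α β ∧ BadAfter β pre x

/-- Reading stops where the list leaves the anti-path, so an anti-path with more arrows than that
cannot be read. -/
theorem readAnti_badAfter {α : E} {pre : List E} {x : PathWord V E} (h : Q.BadAfter α pre x)
    {j : ℕ} (hj : pre.length < j) {w : PathWord V E} (hw : w.arrows = [])
    (H : List E → PathWord V E → List (PathWord V E) → Q.Alg k) (l : List (PathWord V E)) :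
    readAnti j α w H (pre.map Q.arrowPath ++ x :: l) = 0 := by
  induction pre generalizing α j w H with
  | nil =>
    obtain ⟨j, rfl⟩ : ∃ i, j = i + 1 := ⟨j - 1, by simp at hj; omega⟩
    exact readAnti_bad h _ _ _ _
  | cons β pre ih =>
    obtain ⟨j, rfl⟩ : ∃ i, j = i + 1 := ⟨j - 1, by simp at hj; omega⟩
    rw [List.map_cons, List.cons_append, arrowPath, readAnti_step h.1 hw]
    exact ih h.2 (by simpa using hj) rfl _

open Classical in
/-- The Hochschild differential of `readAnti`, for a list whose preceding entry is `β`. -/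
def readAntiDiff (j : ℕ) (β : E)
    (H : List E → PathWord V E → List (PathWord V E) → Q.Alg k) : List (PathWord V E) → Q.Alg k
  | [] => 0
  | x :: l => (if Q.Ok (Q.arrowPath β) x then readAnti j β x H l else 0) +
      wordDiff (readAnti j β (.trivial E (Q.s β)) H) (x :: l)

/-- If `x` is trivial, merging `x` to the left with `β` and to the right with the next entry gives
the same value with opposite signs, and if one merger is impossible the other value is zero. If `x`
has arrows, then after merging it with `β` nothing more can be read, and merging it with the next
entry keeps its first arrow, which does not extend the anti-path. -/
theorem readAntiDiff_bad {β : E} {x : PathWord V E} (hx : Q.Bad β x) (j : ℕ)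
    (H : List E → PathWord V E → List (PathWord V E) → Q.Alg k) {l : List (PathWord V E)}
    (hl : Q.AllPaths (x :: l)) : readAntiDiff (j + 1) β H (x :: l) = 0 := by
  classical
  have h1 := allPaths_cons.1 hl
  cases l with
  | nil => simp [readAntiDiff, wordDiff, readAnti_nil]
  | cons y l =>
    have h2 := allPaths_cons.1 h1.2
    have h3 : wordDiff (fun m => readAnti (j + 1) β (.trivial E (Q.s β)) H (x :: m)) (y :: l) =
        0 := wordDiff_eq_zero h1.2 fun m _ _ => readAnti_bad hx _ _ _ _
    simp only [readAntiDiff, wordDiff, h3, sub_zero]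
    by_cases hx' : x.arrows = []
    · have hbad : Q.s β ≠ y.tgt → Q.Bad β y := by
        intro hne γ m hm hr
        exact hne ((Q.comp_of_rel hr).trans (h2.1.tgt_eq hm).symm)
      have hxe := h1.1.eq_trivial hx'
      have hx2 : x.src = x.tgt := by rw [hxe]; rfl
      have h4 : Q.Ok x y ↔ x.src = y.tgt := by
        refine ⟨fun h => h.1, fun h => ⟨h, ?_⟩⟩
        rw [comp, hx', List.nil_append, ← hx2, h]
        exact h2.1
      have h5 : x.src = y.tgt → comp x y = y := by
        intro h
        rw [comp, hx', List.nil_append, ← hx2, h]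
      rw [ok_arrow_iff h1.1, h4, readAnti_eq hx' (w' := .trivial E (Q.s β)) rfl]
      by_cases h6 : x.src = y.tgt
      · rw [if_pos h6, h5 h6]
        by_cases h7 : Q.s β = x.tgt
        · rw [if_pos ⟨h7, hx⟩, add_neg_cancel]
        · rw [if_neg (by tauto), readAnti_bad (hbad (by rw [← h6, hx2]; exact h7))]
          simp
      · rw [if_neg h6]
        split_ifs with h7
        · rw [readAnti_bad (hbad (by rw [h7.1, ← hx2]; exact h6))]
          simp
        · simp
    · have h8 : Q.Bad β (comp x y) := by
        obtain ⟨γ, m, hm⟩ := List.exists_cons_of_ne_nil hx'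
        intro δ m' hm'
        simp only [comp, hm, List.cons_append, List.cons.injEq] at hm'
        exact hm'.1 ▸ hx γ m hm
      rw [readAnti_ne hx', readAnti_bad h8]
      simp

/-- The product `α β` is zero, so `β` is never merged with `α`; in the remaining terms `β` is read
first, and passing it costs one sign. -/
theorem readAntiDiff_step {α β : E} (h : Q.rel α β) (j : ℕ)
    (H : List E → PathWord V E → List (PathWord V E) → Q.Alg k) {l : List (PathWord V E)}
    (hl : Q.AllPaths l) : readAntiDiff (j + 1) α H (Q.arrowPath β :: l) =
      -readAntiDiff j β (fun p => H (β :: p)) l := by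
  classical
  have h0 : ¬ Q.Ok (Q.arrowPath α) (Q.arrowPath β) := not_ok_arrow h (m := []) rfl
  cases l with
  | nil => simp [readAntiDiff, wordDiff, h0, readAnti_nil]
  | cons x l =>
    have h1 := allPaths_cons.1 hl
    have e : wordDiff (fun m => readAnti (j + 1) α (.trivial E (Q.s α)) H
        (Q.arrowPath β :: m)) (x :: l) =
        wordDiff (readAnti j β (.trivial E (Q.s β)) (fun p => H (β :: p))) (x :: l) :=
      wordDiff_congr hl fun m _ _ => readAnti_step h rfl _ _ _ _ _ _
    simp only [readAntiDiff, wordDiff, h0, if_false, zero_add, e, neg_add, sub_eq_add_neg]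
    congr 2
    split_ifs with h2
    · have : (⟨Q.s β, x.src, x.arrows⟩ : PathWord V E) = x := by rw [show Q.s β = x.tgt from h2.1]
      rw [comp, show (Q.arrowPath β).arrows ++ x.arrows = β :: x.arrows from rfl,
        readAnti_step h rfl, this]
    · rfl

/-- The last arrow of the word consisting of `α` and `pre`. -/
def lastArrow : E → List E → E
  | α, [] => α
  | _, β :: pre => lastArrow β pre

theorem readAntiDiff_badAfter_lt {α : E} {pre : List E} {x : PathWord V E}
    (h : Q.BadAfter α pre x) {j : ℕ} (hj : pre.length < j)
    (H : List E → PathWord V E → List (PathWord V E) → Q.Alg k) {l : List (PathWord V E)}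
    (hl : Q.AllPaths (x :: l)) :
    readAntiDiff j α H (pre.map Q.arrowPath ++ x :: l) = 0 := by
  induction pre generalizing α j H with
  | nil =>
    obtain ⟨j, rfl⟩ : ∃ i, j = i + 1 := ⟨j - 1, by simp at hj; omega⟩
    exact readAntiDiff_bad h _ _ hl
  | cons β pre ih =>
    obtain ⟨j, rfl⟩ : ∃ i, j = i + 1 := ⟨j - 1, by simp at hj; omega⟩
    rw [List.map_cons, List.cons_append, readAntiDiff_step h.1 _ _
      (allPaths_append.2 ⟨allPaths_map_arrowPath _, hl⟩), ih h.2 (by simpa using hj), neg_zero]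

/-- Iterating `readAntiDiff_step` along the anti-path leaves the trivial reading at its end, with
one sign per arrow. -/
theorem readAntiDiff_badAfter_eq {α : E} {pre : List E} {x : PathWord V E}
    (h : Q.BadAfter α pre x)
    (H : List E → PathWord V E → List (PathWord V E) → Q.Alg k) {l : List (PathWord V E)}
    (hl : Q.AllPaths (x :: l)) :
    readAntiDiff pre.length α H (pre.map Q.arrowPath ++ x :: l) =
      (-1 : k) ^ pre.length •
        readAntiDiff 0 (lastArrow α pre) (fun p => H (pre ++ p)) (x :: l) := by
  induction pre generalizing α H with
  | nil => simp [lastArrow]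
  | cons β pre ih =>
    rw [List.map_cons, List.cons_append, List.length_cons, readAntiDiff_step h.1 _ _
      (allPaths_append.2 ⟨allPaths_map_arrowPath _, hl⟩), ih h.2, pow_succ]
    simp [lastArrow]

/-- Extends a function of an arrow `α` and a path `w` to a sum over the factorisations `u α w` of a
path, linearly in `u`. -/
def leftExtend (d : ℤ) (Φ : E → PathWord V E → Q.Alg k) : List E → V → Q.Alg k
  | [], _ => 0
  | α :: m, x => sgn k (d * Q.deg α) • (Q.pathElem k (Q.arrowPath α) * leftExtend d Φ m x) +
      Q.pathElem k (.trivial E (Q.t α)) * Φ α ⟨Q.s α, x, m⟩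

/-- The sum over all ways to read off an anti-path of length `j + 1`. -/
def readSum (d : ℤ) (j : ℕ) (H : List E → PathWord V E → List (PathWord V E) → Q.Alg k) :
    List (PathWord V E) → Q.Alg k
  | [] => 0
  | v :: l => leftExtend d (fun α w => readAnti j α w (fun p => H (α :: p)) l) v.arrows v.src

theorem trivial_mul_pathElem {x : PathWord V E} (hx : Q.IsPathOfA x) :
    Q.pathElem k (.trivial E x.tgt) * Q.pathElem k x = Q.pathElem k x := by
  rw [pathElem_mul _ _ (isPathOfA_trivial _).1 hx.1 rfl]
  simp [PathWord.trivial]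

theorem pathElem_mul_trivial {x : PathWord V E} (hx : Q.IsPathOfA x) :
    Q.pathElem k x * Q.pathElem k (.trivial E x.src) = Q.pathElem k x := by
  rw [pathElem_mul _ _ hx.1 (isPathOfA_trivial _).1 rfl]
  simp [PathWord.trivial]

theorem trivial_mul_trivial (y : V) :
    Q.pathElem k (.trivial E y) * Q.pathElem k (.trivial E y) = Q.pathElem k (.trivial E y) :=
  trivial_mul_pathElem (Q := Q) (x := .trivial E y) (isPathOfA_trivial y)

theorem trivial_mul_trivial_of_ne {y z : V} (h : y ≠ z) :
    Q.pathElem k (.trivial E y) * Q.pathElem k (.trivial E z) = 0 :=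
  pathElem_mul_of_ne _ _ h

theorem trivial_mul_readSum (d : ℤ) (j : ℕ)
    (H : List E → PathWord V E → List (PathWord V E) → Q.Alg k) {v : PathWord V E}
    (hv : Q.IsPathOfA v) (l : List (PathWord V E)) :
    Q.pathElem k (.trivial E v.tgt) * readSum d j H (v :: l) = readSum d j H (v :: l) := by
  obtain ⟨a, b, m⟩ := v
  cases m with
  | nil => simp [readSum, leftExtend]
  | cons α m =>
    obtain rfl : Q.t α = a := hv.1.1
    simp only [readSum, leftExtend, mul_add, mul_smul_comm, ← mul_assoc, trivial_mul_trivial]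
    rw [show (Q.t α) = (Q.arrowPath α).tgt from rfl, trivial_mul_pathElem (isPathOfA_arrowPath α)]

theorem mul_readSum_of_ne (d : ℤ) (j : ℕ)
    (H : List E → PathWord V E → List (PathWord V E) → Q.Alg k) {v : PathWord V E}
    (hv : Q.IsPathOfA v) (l : List (PathWord V E)) {x : PathWord V E}
    (hx : x.src ≠ v.tgt) :
    Q.pathElem k x * readSum d j H (v :: l) = 0 := by
  rw [← trivial_mul_readSum d j H hv, ← mul_assoc, pathElem_mul_of_ne _ _ (by exact hx), zero_mul]

theorem readSum_arrow (d : ℤ) (j : ℕ)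
    (H : List E → PathWord V E → List (PathWord V E) → Q.Alg k) (α : E)
    (l : List (PathWord V E)) : readSum d j H (Q.arrowPath α :: l) =
      Q.pathElem k (.trivial E (Q.t α)) *
        readAnti j α (.trivial E (Q.s α)) (fun p => H (α :: p)) l := by
  simp [readSum, leftExtend, arrowPath, PathWord.trivial]

theorem comp_trivial_left {v : PathWord V E} : comp (.trivial E v.tgt) v = v := rfl

theorem ok_trivial_iff {y : V} {v : PathWord V E} (hv : Q.IsPathOfA v) :
    Q.Ok (.trivial E y) v ↔ y = v.tgt := by
  refine ⟨fun h => h.1, ?_⟩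
  rintro rfl
  exact ⟨rfl, hv⟩

/-- Nothing can be read in a trivial path. The only surviving terms multiply by the trivial path
from the left or merge it with the next entry, and these cancel. -/
theorem fullDiff_readSum_trivial (d : ℤ) (j : ℕ)
    (H : List E → PathWord V E → List (PathWord V E) → Q.Alg k) (y : V)
    {l : List (PathWord V E)} (hl : Q.AllPaths l) :
    fullDiff d (readSum d j H) (.trivial E y :: l) = 0 := by
  classical
  cases l with
  | nil => simp [fullDiff, wordDiff, readSum]
  | cons v l =>
    have h1 := allPaths_cons.1 hl
    have h2 : wordDiff (fun m => readSum d j H (.trivial E y :: m)) (v :: l) = 0 :=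
      wordDiff_zero _
    simp only [fullDiff, wordDiff, h2, sub_zero, ok_trivial_iff h1.1]
    split_ifs with h
    · subst h
      rw [trivial_mul_readSum d j H h1.1, comp_trivial_left]
      simp [pathDeg, wordDeg, PathWord.trivial, sgn_zero]
    · rw [mul_readSum_of_ne d j H h1.1 _ (by exact h)]
      simp

/-- Left multiplication by `α` has to disappear. If `α` is followed by an entry outside the
anti-path, it cancels against the part of `readSum` of the merged path which starts reading after
`α`. If it is followed by further arrows of the anti-path, too few arrows are left to be read. -/
theorem fullDiff_readSum_arrow (d : ℤ) (j : ℕ)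
    (H : List E → PathWord V E → List (PathWord V E) → Q.Alg k) {α : E} {pre : List E}
    {x : PathWord V E} (hx : Q.BadAfter α pre x) (hj : pre.length ≤ j)
    {l : List (PathWord V E)} (hl : Q.AllPaths (x :: l)) :
    fullDiff d (readSum d j H) (Q.arrowPath α :: (pre.map Q.arrowPath ++ x :: l)) =
      -(Q.pathElem k (.trivial E (Q.t α)) *
        readAntiDiff j α (fun p => H (α :: p)) (pre.map Q.arrowPath ++ x :: l)) := by
  classical
  have hd : Q.pathDeg (Q.arrowPath α) = Q.deg α := by simp [pathDeg, wordDeg, arrowPath]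
  have hW : ∀ l : List (PathWord V E), Q.AllPaths l →
      wordDiff (fun m => readSum d j H (Q.arrowPath α :: m)) l =
      Q.pathElem k (.trivial E (Q.t α)) *
        wordDiff (readAnti j α (.trivial E (Q.s α)) (fun p => H (α :: p))) l := by
    intro l hl
    rw [← wordDiff_mul_left]
    exact wordDiff_congr hl fun m _ _ => readSum_arrow _ _ _ _ _
  cases pre with
  | nil =>
    have h1 := allPaths_cons.1 hl
    simp only [List.map_nil, List.nil_append, fullDiff, wordDiff, hW _ hl, readAntiDiff, hd]
    by_cases h2 : Q.Ok (Q.arrowPath α) x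
    · have e : readSum d j H (comp (Q.arrowPath α) x :: l) =
          sgn k (d * Q.deg α) • (Q.pathElem k (Q.arrowPath α) * readSum d j H (x :: l)) +
            Q.pathElem k (.trivial E (Q.t α)) * readAnti j α x (fun p => H (α :: p)) l := by
        have : (⟨Q.s α, x.src, x.arrows⟩ : PathWord V E) = x := by
          rw [show Q.s α = x.tgt from h2.1]
        simp only [comp, arrowPath, List.singleton_append, readSum, leftExtend, this]
      rw [if_pos h2, if_pos h2, e]
      simp only [mul_add, neg_add]
      abel
    · rw [if_neg h2, if_neg h2]
      have h3 : (Q.arrowPath α).src ≠ x.tgt := fun h => h2 ((ok_arrow_iff h1.1).2 ⟨h, hx⟩)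
      rw [mul_readSum_of_ne d j H h1.1 _ h3]
      simp
  | cons β pre =>
    have h2 : ¬ Q.Ok (Q.arrowPath α) (Q.arrowPath β) := not_ok_arrow hx.1 (m := []) rfl
    have h3 : readSum d j H (Q.arrowPath β :: (pre.map Q.arrowPath ++ x :: l)) = 0 := by
      rw [readSum_arrow, readAnti_badAfter hx.2 (by simpa using hj) rfl, mul_zero]
    have h4 : Q.AllPaths (Q.arrowPath β :: (pre.map Q.arrowPath ++ x :: l)) :=
      allPaths_cons.2 ⟨isPathOfA_arrowPath β,
        allPaths_append.2 ⟨allPaths_map_arrowPath _, hl⟩⟩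
    simp only [List.map_cons, List.cons_append, fullDiff, wordDiff, h3, hW _ h4, readAntiDiff,
      if_neg h2]
    simp

end Homotopy

/-! ### Cocycles which vanish on anti-paths are coboundaries -/

theorem badAfter_iff {α : E} {pre : List E} {x : PathWord V E} :
    Q.BadAfter α pre x ↔ (α :: pre).IsChain Q.rel ∧ Q.Bad (lastArrow α pre) x := by
  induction pre generalizing α with
  | nil => simp [BadAfter, lastArrow]
  | cons β pre ih => simp [BadAfter, lastArrow, ih, List.isChain_cons_cons, and_assoc]

theorem bad_trivial (α : E) (y : V) : Q.Bad α (.trivial E y) := fun _ _ h => by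
  simp [PathWord.trivial] at h

theorem lastArrow_append (α : E) (pre : List E) (β : E) : lastArrow α (pre ++ [β]) = β := by
  induction pre generalizing α with
  | nil => rfl
  | cons γ pre ih => exact ih γ

theorem isChain_snoc {r : E → E → Prop} {α : E} {pre : List E} {β : E}
    (h : (α :: pre).IsChain r) (h' : r (lastArrow α pre) β) : (α :: (pre ++ [β])).IsChain r := by
  induction pre generalizing α with
  | nil => exact List.isChain_cons_cons.2 ⟨h', List.isChain_singleton _⟩
  | cons γ pre ih =>
    have h1 := List.isChain_cons_cons.1 h
    exact List.isChain_cons_cons.2 ⟨h1.1, ih h1.2 h'⟩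

variable (Q) in
/-- The list of the arrows of `α pre`, with `x` concatenated to the last one. -/
def mergeLast : E → List E → PathWord V E → List (PathWord V E)
  | α, [], x => [comp (Q.arrowPath α) x]
  | α, β :: pre, x => Q.arrowPath α :: mergeLast β pre x

theorem mergeLast_trivial (α : E) (pre : List E) :
    Q.mergeLast α pre (.trivial E (Q.s (lastArrow α pre))) = (α :: pre).map Q.arrowPath := by
  induction pre generalizing α with
  | nil => simp [mergeLast, comp, arrowPath, PathWord.trivial, lastArrow]
  | cons γ pre ih => simp [mergeLast, lastArrow, ih]

theorem mergeLast_append (α : E) (pre : List E) (β : E) (w : PathWord V E) :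
    Q.mergeLast α (pre ++ [β]) w =
      (α :: pre).map Q.arrowPath ++ [comp (Q.arrowPath β) w] := by
  induction pre generalizing α with
  | nil => rfl
  | cons γ pre ih => simp [mergeLast, ih]

section Vanishing

variable [Fintype V]

variable (Q) in
/-- The function vanishes on lists which start with a trivial path. -/
def VanishTrivial (F : List (PathWord V E) → Q.Alg k) : Prop :=
  ∀ y l, Q.AllPaths l → F (.trivial E y :: l) = 0

variable (Q) in
/-- The function vanishes on lists which start with the arrows of an anti-path of length `j + 1`,
followed by a path whose first arrow does not extend the anti-path. -/
def VanishAt (j : ℕ) (F : List (PathWord V E) → Q.Alg k) : Prop :=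
  ∀ α pre x l, pre.length = j → Q.BadAfter α pre x → Q.AllPaths (x :: l) →
    F (Q.arrowPath α :: (pre.map Q.arrowPath ++ x :: l)) = 0

/-- Consecutive arrows of an anti-path have product zero, so the first merger that survives is that
of the last arrow with `x`. -/
theorem wordDiff_arrows {F : List (PathWord V E) → Q.Alg k} {α : E} {pre : List E}
    {x : PathWord V E} (h : (α :: pre).IsChain Q.rel) (hx : Q.Bad (lastArrow α pre) x)
    (hc : Q.s (lastArrow α pre) = x.tgt)
    {l : List (PathWord V E)} (hl : Q.AllPaths (x :: l)) :
    wordDiff F (Q.arrowPath α :: (pre.map Q.arrowPath ++ x :: l)) =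
      (-1 : k) ^ (pre.length + 1) • (F (Q.mergeLast α pre x ++ l) +
        wordDiff (fun m => F ((α :: pre).map Q.arrowPath ++ m)) (x :: l)) := by
  classical
  induction pre generalizing α F with
  | nil =>
    have : Q.Ok (Q.arrowPath α) x := (ok_arrow_iff (allPaths_cons.1 hl).1).2 ⟨hc, hx⟩
    simp only [List.map_nil, List.nil_append, wordDiff, if_pos this, mergeLast]
    simp
    abel
  | cons β pre ih =>
    have h1 := List.isChain_cons_cons.1 h
    have : ¬ Q.Ok (Q.arrowPath α) (Q.arrowPath β) := not_ok_arrow h1.1 (m := []) rfl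
    simp only [List.map_cons, List.cons_append, wordDiff, if_neg this]
    rw [ih h1.2 hx hc, List.length_cons, pow_succ _ (_ + 1)]
    simp [mergeLast]
    exact add_comm _ _

/-- This disposes of the term of the differential which multiplies by the first arrow `α`: the list
that remains follows an anti-path with one arrow less, or starts with a trivial path, and `F`
already vanishes there. -/
theorem VanishAt.arrow_mul {F : List (PathWord V E) → Q.Alg k} {j : ℕ}
    (h0 : Q.VanishTrivial F) (hF : ∀ i < j, Q.VanishAt i F) {α : E} {pre : List E}
    (hj : pre.length ≤ j)
    {x : PathWord V E} (hx : Q.BadAfter α pre x) (hx' : pre = [] → x.arrows = [])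
    {l : List (PathWord V E)} (hl : Q.AllPaths (x :: l)) :
    F (pre.map Q.arrowPath ++ x :: l) = 0 := by
  cases pre with
  | nil =>
    rw [List.map_nil, List.nil_append, (allPaths_cons.1 hl).1.eq_trivial (hx' rfl)]
    exact h0 _ _ (allPaths_cons.1 hl).2
  | cons β pre => exact hF pre.length (by simpa using hj) _ _ _ _ rfl hx.2 hl

/-- The cocycle condition at the list with the trivial path at `v.tgt` put in front has only two
non-zero terms. -/
theorem VanishTrivial.trivial_mul {d : ℤ} {F : List (PathWord V E) → Q.Alg k}
    (h0 : Q.VanishTrivial F) (hF : ∀ l, Q.AllPaths l → fullDiff d F l = 0)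
    {v : PathWord V E} {l : List (PathWord V E)} (hl : Q.AllPaths (v :: l)) :
    Q.pathElem k (.trivial E v.tgt) * F (v :: l) = F (v :: l) := by
  classical
  have h1 := hF (.trivial E v.tgt :: v :: l) (allPaths_cons.2 ⟨isPathOfA_trivial _, hl⟩)
  have h2 : wordDiff (fun m => F (.trivial E v.tgt :: m)) (v :: l) = 0 :=
    wordDiff_eq_zero hl fun m hm _ => h0 _ _ hm
  simp only [fullDiff, wordDiff, h2, if_pos ((ok_trivial_iff (allPaths_cons.1 hl).1).2 rfl),
    comp_trivial_left] at h1
  simp only [pathDeg, wordDeg, PathWord.trivial, List.map_nil, List.sum_nil, mul_zero, sgn_zero,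
    one_smul, sub_zero] at h1
  exact eq_of_sub_eq_zero (by rw [sub_eq_add_neg]; exact h1)

/-- The cocycle condition is applied to the list with a trivial path inserted behind the anti-path.
Merging this trivial path with the last arrow gives back the original list. -/
theorem cocycle_after_antipath {d : ℤ} {F : List (PathWord V E) → Q.Alg k}
    (h0 : Q.VanishTrivial F) (hF : ∀ l, Q.AllPaths l → fullDiff d F l = 0)
    {α : E} {pre : List E} (hV : ∀ i < pre.length, Q.VanishAt i F)
    (h : (α :: pre).IsChain Q.rel) {l : List (PathWord V E)} (hl : Q.AllPaths l) :
    wordDiff (fun m => F ((α :: pre).map Q.arrowPath ++ m))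
      (.trivial E (Q.s (lastArrow α pre)) :: l) = -F ((α :: pre).map Q.arrowPath ++ l) := by
  have hl' : Q.AllPaths (.trivial E (Q.s (lastArrow α pre)) :: l) :=
    allPaths_cons.2 ⟨isPathOfA_trivial _, hl⟩
  have hb := bad_trivial (Q := Q) (lastArrow α pre) (Q.s (lastArrow α pre))
  have h1 := hF (Q.arrowPath α :: (pre.map Q.arrowPath ++
    .trivial E (Q.s (lastArrow α pre)) :: l)) (allPaths_cons.2 ⟨isPathOfA_arrowPath α,
      allPaths_append.2 ⟨allPaths_map_arrowPath _, hl'⟩⟩)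
  rw [fullDiff_cons, VanishAt.arrow_mul h0 hV le_rfl (badAfter_iff.2 ⟨h, hb⟩) (fun _ => rfl) hl',
    wordDiff_arrows h hb rfl hl', mergeLast_trivial, mul_zero, smul_zero, zero_add] at h1
  have h2 := (smul_eq_zero.1 h1).resolve_left (pow_ne_zero _ (by simp))
  rw [add_comm] at h2
  exact eq_neg_of_add_eq_zero_left h2

/-- The function on which the contracting homotopy is built. -/
def afterAnti (F : List (PathWord V E) → Q.Alg k) (p : List E) (w : PathWord V E)
    (l : List (PathWord V E)) : Q.Alg k := F (p.map Q.arrowPath ++ w :: l)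

/-- This is the homotopy identity at the stage being removed. After the anti-path is peeled off,
what is left is the differential of `F` behind a trivial path inserted after the anti-path, and
`cocycle_after_antipath` evaluates it to `F` itself. -/
theorem fullDiff_readSum_afterAnti {d : ℤ} {F : List (PathWord V E) → Q.Alg k}
    (h0 : Q.VanishTrivial F) (hF : ∀ l, Q.AllPaths l → fullDiff d F l = 0)
    {α : E} {pre : List E} (hV : ∀ i < pre.length, Q.VanishAt i F)
    {x : PathWord V E} (hx : Q.BadAfter α pre x)
    {l : List (PathWord V E)} (hl : Q.AllPaths (x :: l)) :
    fullDiff d (readSum d pre.length (afterAnti F))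
      (Q.arrowPath α :: (pre.map Q.arrowPath ++ x :: l)) =
      -((-1 : k) ^ pre.length • F (Q.arrowPath α :: (pre.map Q.arrowPath ++ x :: l))) := by
  classical
  have hl1 := (allPaths_cons.1 hl).1
  rw [fullDiff_readSum_arrow d _ _ hx le_rfl hl, readAntiDiff_badAfter_eq hx _ hl]
  obtain ⟨hc, hb⟩ := badAfter_iff.1 hx
  have key := cocycle_after_antipath h0 hF hV hc hl
  have hL : Q.AllPaths (Q.arrowPath α :: (pre.map Q.arrowPath ++ x :: l)) :=
    allPaths_cons.2 ⟨isPathOfA_arrowPath α, allPaths_append.2 ⟨allPaths_map_arrowPath _, hl⟩⟩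
  have h1 : readAntiDiff 0 (lastArrow α pre) (fun p => afterAnti F (α :: (pre ++ p))) (x :: l) =
      F (Q.arrowPath α :: (pre.map Q.arrowPath ++ x :: l)) := by
    simp only [wordDiff, ok_trivial_iff hl1, neg_eq_iff_eq_neg, sub_eq_iff_eq_add] at key
    simp only [readAntiDiff, ok_arrow_iff hl1, and_iff_left hb]
    have e1 : readAnti 0 (lastArrow α pre) x (fun p => afterAnti F (α :: (pre ++ p))) l =
        F ((α :: pre).map Q.arrowPath ++ x :: l) := by
      rw [readAnti_zero, List.append_nil, afterAnti]
    have e2 : readAnti 0 (lastArrow α pre) (.trivial E (Q.s (lastArrow α pre)))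
        (fun p => afterAnti F (α :: (pre ++ p))) = fun m =>
        F ((α :: pre).map Q.arrowPath ++ .trivial E (Q.s (lastArrow α pre)) :: m) := by
      funext m
      rw [readAnti_zero, List.append_nil, afterAnti]
    rw [e1, e2]
    have e3 : (if Q.s (lastArrow α pre) = x.tgt then F ((α :: pre).map Q.arrowPath ++
        comp (.trivial E (Q.s (lastArrow α pre))) x :: l) else 0) =
        if Q.s (lastArrow α pre) = x.tgt then F ((α :: pre).map Q.arrowPath ++ x :: l) else 0 := by
      split_ifs with h
      · rw [h, comp_trivial_left]
      · rfl
    rw [e3] at key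
    rw [key]
    simp
  have h2 := h0.trivial_mul hF hL
  rw [h1, mul_smul_comm]
  exact congrArg (fun a => -((-1 : k) ^ pre.length • a)) h2

/-- The correction made at stage `j` does not disturb the stages below `j` that have been normalised
before. -/
theorem fullDiff_readSum_eq_zero {d : ℤ} {j : ℕ}
    (H : List E → PathWord V E → List (PathWord V E) → Q.Alg k)
    {α : E} {pre : List E} (hj : pre.length < j) {x : PathWord V E} (hx : Q.BadAfter α pre x)
    {l : List (PathWord V E)} (hl : Q.AllPaths (x :: l)) :
    fullDiff d (readSum d j H) (Q.arrowPath α :: (pre.map Q.arrowPath ++ x :: l)) = 0 := by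
  rw [fullDiff_readSum_arrow d _ _ hx hj.le hl, readAntiDiff_badAfter_lt hx hj _ hl, mul_zero,
    neg_zero]

/-- The contracting homotopy for lists whose first entry is trivial. -/
def trivialSum (F : List (PathWord V E) → Q.Alg k) (l : List (PathWord V E)) : Q.Alg k :=
  ∑ x : V, Q.pathElem k (.trivial E x) * F (.trivial E x :: l)

theorem sum_trivial : ∑ x : V, Q.pathElem k (.trivial E x) = (1 : Q.Alg k) := by
  rw [one_def]
  exact Finset.sum_congr rfl fun x _ => (basis_eq (Q.trivialA x)).symm

/-- Inserting a sum of trivial paths in front is a homotopy on lists which start with a trivial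
path, because these idempotents are orthogonal with sum 1. -/
theorem fullDiff_trivialSum {d : ℤ} {F : List (PathWord V E) → Q.Alg k}
    (hF : ∀ l, Q.AllPaths l → fullDiff d F l = 0) (y : V) {l : List (PathWord V E)}
    (hl : Q.AllPaths l) :
    fullDiff d (trivialSum F) (.trivial E y :: l) = F (.trivial E y :: l) := by
  classical
  have hl' : Q.AllPaths (.trivial E y :: l) := allPaths_cons.2 ⟨isPathOfA_trivial y, hl⟩
  have hd : ∀ x : V, Q.pathDeg (.trivial E x) = 0 := fun x => rfl
  -- This is the cocycle condition at the list starting with the trivial paths at `x` and `y`,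
  -- multiplied by the idempotent of `x`; the two trivial paths merge only if `x = y`.
  have h1 : ∀ x : V, Q.pathElem k (.trivial E x) *
      wordDiff (fun m => F (.trivial E x :: m)) (.trivial E y :: l) =
      Q.pathElem k (.trivial E x) * F (.trivial E y :: l) -
        if x = y then Q.pathElem k (.trivial E x) * F (.trivial E y :: l) else 0 := by
    intro x
    have := hF (.trivial E x :: .trivial E y :: l) (allPaths_cons.2 ⟨isPathOfA_trivial x, hl'⟩)
    simp only [fullDiff_cons, hd, mul_zero, sgn_zero, one_smul, wordDiff,
      ok_trivial_iff (isPathOfA_trivial y)] at this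
    rw [← add_sub_assoc, sub_eq_zero] at this
    rw [← this, mul_add, ← mul_assoc, trivial_mul_trivial, sub_eq_add_neg]
    congr 1
    rw [mul_neg]
    congr 1
    by_cases h : x = y
    · subst h
      rw [if_pos (show x = (PathWord.trivial E x).tgt from rfl), if_pos rfl]
      rfl
    · rw [if_neg h, if_neg (by exact h), mul_zero]
  rw [fullDiff_cons, hd, mul_zero, sgn_zero, one_smul]
  change _ + wordDiff (fun m => ∑ x : V, Q.pathElem k (.trivial E x) * F (.trivial E x :: m)) _ = _
  rw [wordDiff_sum]
  simp only [wordDiff_mul_left, h1]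
  rw [Finset.sum_sub_distrib, ← Finset.sum_mul, sum_trivial, one_mul, Finset.sum_ite_eq',
    if_pos (Finset.mem_univ _), trivialSum, Finset.mul_sum, Finset.sum_eq_single y]
  · rw [← mul_assoc, trivial_mul_trivial]
    abel
  · intro x _ hx
    rw [← mul_assoc, trivial_mul_trivial_of_ne hx.symm, zero_mul]
  · simp

/-- The hypotheses make `F` vanish on the shorter half of each matched couple of tuples and on the
unmatched tuples. The cocycle condition transports this to the other half, where an arrow and the
entry after it have been merged. -/
theorem eq_zero_of_vanish {d : ℤ} {n : ℕ} {F : List (PathWord V E) → Q.Alg k}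
    (h0 : Q.VanishTrivial F) (hF : ∀ l, Q.AllPaths l → fullDiff d F l = 0)
    (hV : ∀ i, Q.VanishAt i F) (hn : ∀ l, l.length ≠ n → F l = 0)
    (hA : ∀ α pre, (α :: pre).IsChain Q.rel → (α :: pre).length = n →
      F ((α :: pre).map Q.arrowPath) = 0)
    {l : List (PathWord V E)} (hl : Q.AllPaths l) (hne : l ≠ []) : F l = 0 := by
  classical
  -- Lists that start with an anti-path, by induction on the number of entries behind it: an entry
  -- that is a single continuing arrow lengthens the anti-path, and `hV` treats an entry that does
  -- not continue it.
  have step1 : ∀ m α pre l, l.length = m → (α :: pre).IsChain Q.rel → Q.AllPaths l →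
      F ((α :: pre).map Q.arrowPath ++ l) = 0 := by
    intro m
    induction m with
    | zero =>
      intro α pre l hm hc _
      obtain rfl := List.length_eq_zero_iff.1 hm
      rw [List.append_nil]
      by_cases h : (α :: pre).length = n
      · exact hA α pre hc h
      · exact hn _ (by simpa using h)
    | succ m ih =>
      intro α pre l hm hc hl
      obtain ⟨x, l, rfl⟩ := List.exists_cons_of_length_eq_add_one hm
      have hx1 := allPaths_cons.1 hl
      by_cases hx : Q.Bad (lastArrow α pre) x
      · exact hV _ α pre x l rfl (badAfter_iff.2 ⟨hc, hx⟩) hl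
      · simp only [Bad, not_forall, not_not] at hx
        obtain ⟨β, mm, hmm, hr⟩ := hx
        have hc' := isChain_snoc hc hr
        have hlm : l.length = m := by simpa using hm
        have hw := hx1.1.tail hmm
        have hxe : x = comp (Q.arrowPath β) ⟨Q.s β, x.src, mm⟩ := by
          have := hx1.1.tgt_eq hmm
          obtain ⟨a, b, c⟩ := x
          simp only [comp, arrowPath] at this hmm ⊢
          rw [this, hmm]
          rfl
        by_cases hmm' : mm = []
        · subst hmm'
          have hxa : x = Q.arrowPath β := by
            have h3 : Q.s β = x.src := hw.1
            rw [hxe, ← h3]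
            rfl
          have := ih α (pre ++ [β]) l hlm hc' hx1.2
          rw [hxa]
          simpa using this
        · have hb : Q.Bad (lastArrow α (pre ++ [β])) ⟨Q.s β, x.src, mm⟩ := by
            rw [lastArrow_append]
            rw [hxe] at hx1
            exact ((ok_arrow_iff hw).1 ⟨rfl, hx1.1⟩).2
          have hl2 : Q.AllPaths (⟨Q.s β, x.src, mm⟩ :: l) := allPaths_cons.2 ⟨hw, hx1.2⟩
          -- The entry is `β w` with `β` continuing the anti-path and `w` non-trivial. In the
          -- cocycle condition with `β` and `w` as separate entries, the only term not yet known to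
          -- vanish is the one merging them.
          have h1 := hF (Q.arrowPath α :: ((pre ++ [β]).map Q.arrowPath ++
            ⟨Q.s β, x.src, mm⟩ :: l)) (allPaths_cons.2 ⟨isPathOfA_arrowPath α,
              allPaths_append.2 ⟨allPaths_map_arrowPath _, hl2⟩⟩)
          rw [fullDiff_cons, VanishAt.arrow_mul h0 (fun i _ => hV i) le_rfl
            (badAfter_iff.2 ⟨hc', hb⟩) (by simp) hl2,
            wordDiff_arrows hc' hb (by rw [lastArrow_append]) hl2,
            mergeLast_append, mul_zero, smul_zero, zero_add, ← hxe,
            wordDiff_eq_zero hl2 fun m' hm' hm'' => ih α (pre ++ [β]) m'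
              (by simpa [hlm] using hm'') hc' hm', add_zero] at h1
          have h2 := (smul_eq_zero.1 h1).resolve_left (pow_ne_zero _ (by simp))
          simpa using h2
  -- Arbitrary first entries, by induction on their length. The cocycle condition at the list in
  -- which the first arrow is split off expresses the value by lists starting with an arrow and by a
  -- shorter first entry.
  have step2 : ∀ (c : ℕ) (v : PathWord V E) l, v.arrows.length = c → Q.AllPaths (v :: l) →
      F (v :: l) = 0 := by
    intro c
    induction c with
    | zero =>
      intro v l hc hl
      have := allPaths_cons.1 hl
      rw [this.1.eq_trivial (List.length_eq_zero_iff.1 hc)]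
      exact h0 _ _ this.2
    | succ c ih =>
      intro v l hc hl
      have hl1 := allPaths_cons.1 hl
      obtain ⟨α, m, hm⟩ := List.exists_cons_of_length_eq_add_one hc
      have hw := hl1.1.tail hm
      have hve : v = comp (Q.arrowPath α) ⟨Q.s α, v.src, m⟩ := by
        have := hl1.1.tgt_eq hm
        obtain ⟨a, b, c⟩ := v
        simp only [comp, arrowPath] at this hm ⊢
        rw [this, hm]
        rfl
      have hok : Q.Ok (Q.arrowPath α) ⟨Q.s α, v.src, m⟩ := ⟨rfl, hve ▸ hl1.1⟩
      have hl2 : Q.AllPaths (⟨Q.s α, v.src, m⟩ :: l) := allPaths_cons.2 ⟨hw, hl1.2⟩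
      have h1 := hF (Q.arrowPath α :: ⟨Q.s α, v.src, m⟩ :: l)
        (allPaths_cons.2 ⟨isPathOfA_arrowPath α, hl2⟩)
      rw [fullDiff_cons, ih _ _ (by rw [hm] at hc; simpa using hc) hl2, mul_zero, smul_zero,
        zero_add] at h1
      have h2 : wordDiff (fun m => F (Q.arrowPath α :: m)) (⟨Q.s α, v.src, m⟩ :: l) = 0 :=
        wordDiff_eq_zero hl2 fun m' hm' _ =>
          step1 _ α [] m' rfl (List.isChain_singleton _) hm'
      rw [wordDiff, h2, if_pos hok, ← hve, sub_zero, neg_eq_zero] at h1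
      exact h1
  cases l with
  | nil => exact absurd rfl hne
  | cons v l => exact step2 _ v l rfl hl

end Vanishing

/-! ### Coefficients -/

open Classical in
variable (Q k) in
/-- The coefficient of a path in an element of `A`. -/
def coeff (q : PathWord V E) : Q.Alg k →ₗ[k] k :=
  if h : Q.IsPathOfA q then (Q.basis k).coord ⟨q, h⟩ else 0

open Classical in
theorem coeff_pathElem {p : PathWord V E} (hp : Q.IsPathOfA p) (q : PathWord V E) :
    Q.coeff k q (Q.pathElem k p) = if p = q then 1 else 0 := by
  rw [pathElem_of hp, coeff]
  split_ifs with h1 h2 h2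
  · subst h2
    simp
  · simp [h2]
  · subst h2
    exact absurd hp h1
  · rfl

theorem eq_zero_of_coeff {a : Q.Alg k} (h : ∀ q, Q.IsPathOfA q → Q.coeff k q a = 0) : a = 0 := by
  refine (Q.basis k).ext_elem fun ⟨q, hq⟩ => ?_
  have := h q hq
  rw [coeff, dif_pos hq] at this
  simpa using this

section Coeff

variable [Fintype V]

open Classical in
theorem coeff_trivial_mul {q : PathWord V E} (y : V) (a : Q.Alg k) :
    Q.coeff k q (Q.pathElem k (.trivial E y) * a) = if q.tgt = y then Q.coeff k q a else 0 := by
  have : Q.coeff k q ∘ₗ LinearMap.mulLeft k (Q.pathElem k (.trivial E y)) =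
      (if q.tgt = y then 1 else 0 : k) • Q.coeff k q := by
    refine (Q.basis k).ext fun p => ?_
    rw [LinearMap.comp_apply, LinearMap.mulLeft_apply, LinearMap.smul_apply, basis_eq]
    by_cases h : p.1.tgt = y
    · subst h
      rw [trivial_mul_pathElem p.2, coeff_pathElem p.2]
      split_ifs with h1 h2 <;> simp_all
    · rw [pathElem_mul_of_ne _ _ (by exact fun h' => h h'.symm), coeff_pathElem p.2]
      split_ifs with h1 h2 <;> simp_all
  have h := LinearMap.congr_fun this a
  rw [LinearMap.comp_apply, LinearMap.mulLeft_apply, LinearMap.smul_apply] at h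
  rw [h]
  split_ifs <;> simp

open Classical in
theorem coeff_mul_trivial {q : PathWord V E} (y : V) (a : Q.Alg k) :
    Q.coeff k q (a * Q.pathElem k (.trivial E y)) = if q.src = y then Q.coeff k q a else 0 := by
  have : Q.coeff k q ∘ₗ LinearMap.mulRight k (Q.pathElem k (.trivial E y)) =
      (if q.src = y then 1 else 0 : k) • Q.coeff k q := by
    refine (Q.basis k).ext fun p => ?_
    rw [LinearMap.comp_apply, LinearMap.mulRight_apply, LinearMap.smul_apply, basis_eq]
    by_cases h : p.1.src = y
    · subst h
      rw [pathElem_mul_trivial p.2, coeff_pathElem p.2]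
      split_ifs with h1 h2 <;> simp_all
    · rw [pathElem_mul_of_ne _ _ (by exact h), coeff_pathElem p.2]
      split_ifs with h1 h2 <;> simp_all
  have h := LinearMap.congr_fun this a
  rw [LinearMap.comp_apply, LinearMap.mulRight_apply, LinearMap.smul_apply] at h
  rw [h]
  split_ifs <;> simp

theorem coeff_arrow_mul {q : PathWord V E} (hq : Q.IsPathOfA q) {α : E} {m : List E}
    (hm : q.arrows = α :: m) (a : Q.Alg k) :
    Q.coeff k q (Q.pathElem k (Q.arrowPath α) * a) = Q.coeff k ⟨Q.s α, q.src, m⟩ a := by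
  classical
  have : Q.coeff k q ∘ₗ LinearMap.mulLeft k (Q.pathElem k (Q.arrowPath α)) =
      Q.coeff k ⟨Q.s α, q.src, m⟩ := by
    refine (Q.basis k).ext fun p => ?_
    rw [LinearMap.comp_apply, LinearMap.mulLeft_apply, basis_eq, coeff_pathElem p.2,
      pathElem_mul_pathElem (isPathOfA_arrowPath α) p.2]
    have hqe : q = ⟨Q.t α, q.src, α :: m⟩ := by
      rw [← hm, ← hq.tgt_eq hm]
    obtain ⟨⟨b, c, n⟩, hp⟩ := p
    split_ifs with h1 h2 h2
    · rw [coeff_pathElem h1.2, if_pos]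
      rw [hqe]
      simp only [PathWord.mk.injEq] at h2
      simp [comp, arrowPath, h2]
    · rw [coeff_pathElem h1.2, if_neg]
      intro h3
      rw [hqe] at h3
      simp only [comp, arrowPath, PathWord.mk.injEq, List.singleton_append, List.cons.injEq] at h3
      exact h2 (PathWord.ext h1.1.symm h3.2.1 h3.2.2.2)
    · exfalso
      simp only [PathWord.mk.injEq] at h2
      refine h1 ⟨h2.1.symm, ?_⟩
      have : comp (Q.arrowPath α) ⟨b, c, n⟩ = q := by
        rw [hqe]
        simp [comp, arrowPath, h2]
      rwa [this]
    · rw [map_zero]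
  exact LinearMap.congr_fun this a

theorem coeff_arrow_mul_of_ne {q : PathWord V E} {α : E}
    (hm : ∀ m, q.arrows ≠ α :: m) (a : Q.Alg k) :
    Q.coeff k q (Q.pathElem k (Q.arrowPath α) * a) = 0 := by
  classical
  have : Q.coeff k q ∘ₗ LinearMap.mulLeft k (Q.pathElem k (Q.arrowPath α)) = 0 := by
    refine (Q.basis k).ext fun p => ?_
    rw [LinearMap.comp_apply, LinearMap.mulLeft_apply, basis_eq,
      pathElem_mul_pathElem (isPathOfA_arrowPath α) p.2]
    split_ifs with h1
    · rw [coeff_pathElem h1.2, if_neg, LinearMap.zero_apply]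
      rintro rfl
      exact hm _ rfl
    · rw [map_zero, LinearMap.zero_apply]
  exact LinearMap.congr_fun this a

theorem coeff_mul_arrow {q : PathWord V E} (hq : Q.IsPathOfA q) {α : E} {m : List E}
    (hm : q.arrows = m ++ [α]) (a : Q.Alg k) :
    Q.coeff k q (a * Q.pathElem k (Q.arrowPath α)) = Q.coeff k ⟨q.tgt, Q.t α, m⟩ a := by
  classical
  have : Q.coeff k q ∘ₗ LinearMap.mulRight k (Q.pathElem k (Q.arrowPath α)) =
      Q.coeff k ⟨q.tgt, Q.t α, m⟩ := by
    refine (Q.basis k).ext fun p => ?_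
    rw [LinearMap.comp_apply, LinearMap.mulRight_apply, basis_eq, coeff_pathElem p.2,
      pathElem_mul_pathElem p.2 (isPathOfA_arrowPath α)]
    have hqe : q = ⟨q.tgt, Q.s α, m ++ [α]⟩ := by
      have h := hq.1
      rw [IsPath, hm] at h
      obtain ⟨z, -, -, h⟩ := isWalk_append.1 h
      rw [← hm, show Q.s α = q.src from h]
    obtain ⟨⟨b, c, n⟩, hp⟩ := p
    split_ifs with h1 h2 h2
    · rw [coeff_pathElem h1.2, if_pos]
      rw [hqe]
      simp only [PathWord.mk.injEq] at h2
      simp [comp, arrowPath, h2]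
    · rw [coeff_pathElem h1.2, if_neg]
      intro h3
      rw [hqe] at h3
      simp only [comp, arrowPath, PathWord.mk.injEq, List.append_left_inj] at h3
      exact h2 (PathWord.ext h3.1 h1.1 h3.2.2)
    · exfalso
      simp only [PathWord.mk.injEq] at h2
      refine h1 ⟨h2.2.1, ?_⟩
      have : comp ⟨b, c, n⟩ (Q.arrowPath α) = q := by
        rw [hqe]
        simp [comp, arrowPath, h2]
      rwa [this]
    · rw [map_zero]
  exact LinearMap.congr_fun this a

theorem coeff_mul_arrow_of_ne {q : PathWord V E} {α : E}
    (hm : ∀ m, q.arrows ≠ m ++ [α]) (a : Q.Alg k) :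
    Q.coeff k q (a * Q.pathElem k (Q.arrowPath α)) = 0 := by
  classical
  have : Q.coeff k q ∘ₗ LinearMap.mulRight k (Q.pathElem k (Q.arrowPath α)) = 0 := by
    refine (Q.basis k).ext fun p => ?_
    rw [LinearMap.comp_apply, LinearMap.mulRight_apply, basis_eq,
      pathElem_mul_pathElem p.2 (isPathOfA_arrowPath α)]
    split_ifs with h1
    · rw [coeff_pathElem h1.2, if_neg, LinearMap.zero_apply]
      rintro rfl
      exact hm _ rfl
    · rw [map_zero, LinearMap.zero_apply]
  exact LinearMap.congr_fun this a

/-! ### Homogeneous cochains -/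

variable (Q) in
/-- The degree of a list of words. -/
def listDeg (l : List (PathWord V E)) : ℤ := (l.map Q.pathDeg).sum

theorem listDeg_cons (x : PathWord V E) (l : List (PathWord V E)) :
    Q.listDeg (x :: l) = Q.pathDeg x + Q.listDeg l := by simp [listDeg]

theorem listDeg_append (l m : List (PathWord V E)) :
    Q.listDeg (l ++ m) = Q.listDeg l + Q.listDeg m := by simp [listDeg]

theorem listDeg_map_arrowPath (p : List E) :
    Q.listDeg (p.map Q.arrowPath) = Q.wordDeg p := by
  simp only [listDeg, wordDeg, List.map_map]
  congr 1
  refine List.map_congr_left fun α _ => ?_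
  simp [pathDeg, wordDeg, arrowPath]

theorem onWords_mem_grading {n : ℕ} {d : ℤ} {f : Cochain k (Q.Alg k) n}
    (hf : f ∈ homogeneous (Q.grading k) n d) (l : List (PathWord V E)) :
    onWords f l ∈ Q.grading k (Q.listDeg l + d) := by
  by_cases hn : l.length = n
  · subst hn
    have := hf (fun i => Q.pathDeg (l.get i)) (fun i => Q.pathElem k (l.get i))
      fun i => pathElem_mem_grading _
    have e : ∑ i : Fin l.length, Q.pathDeg (l.get i) = Q.listDeg l := by
      rw [listDeg, ← List.sum_ofFn]
      congr 1
      exact List.ext_getElem (by simp) fun i h1 h2 => by simp [-List.ofFn_succ]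
    rw [e] at this
    rw [onWords, evalList, dif_pos (by simp)]
    convert this using 2
    funext i
    simp
  · rw [onWords_of_length f hn]
    exact zero_mem _

/-- A homogeneous element of A is a combination of paths of that degree, so multilinearity reduces
the condition to tuples of paths. -/
theorem mem_homogeneous {n : ℕ} {d : ℤ} {f : Cochain k (Q.Alg k) n}
    (hf : ∀ l, Q.AllPaths l → l.length = n → onWords f l ∈ Q.grading k (Q.listDeg l + d)) :
    f ∈ homogeneous (Q.grading k) n d := by
  classical
  intro e a ha
  have hspan : ∀ i, ∃ c : Q.APath →₀ k, (∀ p ∈ c.support, Q.pathDeg p.1 = e i) ∧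
      a i = ∑ p ∈ c.support, c p • Q.basis k p := by
    intro i
    obtain ⟨c, hc, hc'⟩ := (Finsupp.mem_span_image_iff_linearCombination k).1 (ha i)
    refine ⟨c, fun p hp => hc hp, ?_⟩
    rw [← hc', Finsupp.linearCombination_apply, Finsupp.sum]
  choose c hc hc' using hspan
  have h1 : f a = f fun i => ∑ p ∈ (c i).support, c i p • Q.basis k p := by
    congr 1
    funext i
    exact hc' i
  rw [h1]
  have h2 := MultilinearMap.map_sum_finset (f : MultilinearMap k (fun _ : Fin n => Q.Alg k) (Q.Alg k))
    (fun i p => c i p • Q.basis k p) (fun i => (c i).support)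
  refine (congrArg (· ∈ Q.grading k _) h2).mpr (sum_mem fun r hr => ?_)
  have h3 := MultilinearMap.map_smul_univ
    (f : MultilinearMap k (fun _ : Fin n => Q.Alg k) (Q.Alg k)) (fun i => c i (r i))
    (fun i => Q.basis k (r i))
  refine (congrArg (· ∈ Q.grading k _) h3).mpr (Submodule.smul_mem _ _ ?_)
  have h4 := hf (List.ofFn fun i => (r i).1) (by
    intro x hx
    obtain ⟨i, rfl⟩ := List.mem_ofFn.1 hx
    exact (r i).2) (by simp)
  have e1 : (List.ofFn fun i => (r i).1).map (Q.pathElem k) =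
      List.ofFn fun i => Q.basis k (r i) := by
    rw [List.map_ofFn]
    congr 1
    funext i
    exact (basis_eq (r i)).symm
  have e2 : Q.listDeg (List.ofFn fun i => (r i).1) = ∑ i, e i := by
    rw [listDeg, List.map_ofFn, List.sum_ofFn]
    exact Finset.sum_congr rfl fun i _ => hc i _ (Fintype.mem_piFinset.1 hr i)
  rwa [onWords, e1, evalList_ofFn, e2] at h4

theorem mul_mem_grading {a b : Q.Alg k} {i j l : ℤ} (ha : a ∈ Q.grading k i)
    (hb : b ∈ Q.grading k j) (h : i + j = l) : a * b ∈ Q.grading k l :=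
  h ▸ SetLike.mul_mem_graded ha hb

theorem wordDiff_mem_grading {d : ℤ} {F : List (PathWord V E) → Q.Alg k} {l : List (PathWord V E)}
    (hF : ∀ l, F l ∈ Q.grading k (Q.listDeg l + d)) :
    wordDiff F l ∈ Q.grading k (Q.listDeg l + d) := by
  induction l generalizing F d with
  | nil => exact zero_mem _
  | cons x l ih =>
    cases l with
    | nil =>
      refine neg_mem (mul_mem_grading (hF []) (pathElem_mem_grading x) ?_)
      simp [listDeg, add_comm]
    | cons y l =>
      refine sub_mem (neg_mem ?_) ?_
      · split_ifs
        · have := hF (comp x y :: l)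
          rwa [listDeg_cons, show Q.pathDeg (comp x y) = Q.pathDeg x + Q.pathDeg y by
            simp [comp, pathDeg, wordDeg], add_assoc (Q.pathDeg x), ← listDeg_cons,
            ← listDeg_cons] at this
        · exact zero_mem _
      · have := @ih (Q.pathDeg x + d) (fun m => F (x :: m)) fun m => by
          have := hF (x :: m)
          rwa [listDeg_cons, add_right_comm, add_comm (Q.pathDeg x + d)] at this
        rwa [listDeg_cons x, add_right_comm, add_comm (Q.pathDeg x + d)]

theorem fullDiff_mem_grading {d e : ℤ} {F : List (PathWord V E) → Q.Alg k}
    {l : List (PathWord V E)} (hF : ∀ l, F l ∈ Q.grading k (Q.listDeg l + d)) :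
    fullDiff e F l ∈ Q.grading k (Q.listDeg l + d) := by
  cases l with
  | nil => exact zero_mem _
  | cons x l =>
    refine add_mem (Submodule.smul_mem _ _ (mul_mem_grading (pathElem_mem_grading x) (hF l) ?_))
      (wordDiff_mem_grading hF)
    rw [listDeg_cons, add_assoc]

theorem differential_mem_homogeneous {n : ℕ} {d : ℤ} {f : Cochain k (Q.Alg k) n}
    (hf : f ∈ homogeneous (Q.grading k) n d) :
    differential (Q.grading k) d n f ∈ homogeneous (Q.grading k) (n + 1) d := by
  refine mem_homogeneous fun l hl hn => ?_
  rw [onWords_differential d f hl hn]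
  exact Submodule.smul_mem _ _ (fullDiff_mem_grading (onWords_mem_grading hf))

/-- The constant `c` absorbs the degrees of the arrows already read, which makes the induction
close. -/
theorem readAnti_mem_grading {c : ℤ}
    {H : List E → PathWord V E → List (PathWord V E) → Q.Alg k}
    (hH : ∀ p w l, H p w l ∈ Q.grading k (c + Q.wordDeg p + Q.pathDeg w + Q.listDeg l))
    (j : ℕ) (β : E) (w : PathWord V E) (l : List (PathWord V E)) :
    readAnti j β w H l ∈ Q.grading k (c + Q.pathDeg w + Q.listDeg l) := by
  induction j generalizing β w H l c with
  | zero =>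
    have := hH [] w l
    rw [readAnti_zero]
    simpa [wordDeg] using this
  | succ j ih =>
    cases l with
    | nil => exact zero_mem _
    | cons y l =>
      obtain ⟨a, b, m⟩ := y
      by_cases hw : w.arrows = []
      · cases m with
        | nil => simp [readAnti]
        | cons γ m =>
          by_cases hr : Q.rel β γ
          · rw [readAnti_step hr hw]
            have := @ih (c + Q.deg γ) (fun p => H (γ :: p)) (fun p w l => by
              have := hH (γ :: p) w l
              rwa [show Q.wordDeg (γ :: p) = Q.deg γ + Q.wordDeg p by simp [wordDeg],
                ← add_assoc c] at this) γ ⟨Q.s γ, b, m⟩ l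
            convert this using 2
            simp [pathDeg, wordDeg, listDeg, hw]
            ring
          · simp [readAnti, hr]
      · rw [readAnti_ne hw]
        exact zero_mem _

theorem readSum_mem_grading {d e : ℤ}
    {H : List E → PathWord V E → List (PathWord V E) → Q.Alg k}
    (hH : ∀ p w l, H p w l ∈ Q.grading k (d + Q.wordDeg p + Q.pathDeg w + Q.listDeg l))
    (j : ℕ) (l : List (PathWord V E)) :
    readSum e j H l ∈ Q.grading k (Q.listDeg l + d) := by
  cases l with
  | nil => exact zero_mem _
  | cons v l =>
    obtain ⟨a, b, m⟩ := v
    rw [listDeg_cons, readSum]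
    change leftExtend _ _ m b ∈ Q.grading k (Q.wordDeg m + _ + d)
    induction m with
    | nil => exact zero_mem _
    | cons α m ih =>
      refine add_mem (Submodule.smul_mem _ _ (mul_mem_grading (pathElem_mem_grading _) ih ?_))
        (mul_mem_grading (pathElem_mem_grading _) (@readAnti_mem_grading _ _ _ _ _ _
          (d + Q.deg α) (fun p => H (α :: p)) (fun p w l => ?_) j α _ l) ?_)
      · simp [pathDeg, wordDeg, arrowPath]
        ring
      · have := hH (α :: p) w l
        rwa [show Q.wordDeg (α :: p) = Q.deg α + Q.wordDeg p by simp [wordDeg],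
          ← add_assoc d] at this
      · simp [pathDeg, wordDeg, PathWord.trivial]
        ring

theorem trivialSum_mem_grading {d : ℤ} {F : List (PathWord V E) → Q.Alg k}
    (hF : ∀ l, F l ∈ Q.grading k (Q.listDeg l + d)) (l : List (PathWord V E)) :
    trivialSum F l ∈ Q.grading k (Q.listDeg l + d) := by
  refine sum_mem fun x _ => mul_mem_grading (pathElem_mem_grading _) (hF _) ?_
  simp [listDeg, pathDeg, wordDeg, PathWord.trivial]

/-! ### Modification of cocycles by coboundaries -/

variable (k) in
/-- The cochain with prescribed values on lists of paths of length `n`. -/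
def ofWords (n : ℕ) (G : List (PathWord V E) → Q.Alg k) : Cochain k (Q.Alg k) n :=
  Q.extendMultilinear k n fun v => G (List.ofFn fun i => (v i).1)

theorem onWords_ofWords {n : ℕ} (G : List (PathWord V E) → Q.Alg k) {l : List (PathWord V E)}
    (hl : Q.AllPaths l) (hn : l.length = n) : onWords (ofWords k n G) l = G l :=
  onWords_extendMultilinear G hl hn

theorem ofWords_mem_homogeneous {n : ℕ} {d : ℤ} {G : List (PathWord V E) → Q.Alg k}
    (hG : ∀ l, G l ∈ Q.grading k (Q.listDeg l + d)) :
    ofWords k n G ∈ homogeneous (Q.grading k) n d :=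
  mem_homogeneous fun l hl hn => by
    rw [onWords_ofWords G hl hn]
    exact hG l

theorem onWords_differential_ofWords (d : ℤ) {n : ℕ} (G : List (PathWord V E) → Q.Alg k)
    {l : List (PathWord V E)} (hl : Q.AllPaths l) (hn : l.length = n + 1) :
    onWords (differential (Q.grading k) d n (ofWords k n G)) l = sgn k d • fullDiff d G l := by
  rw [onWords_differential d _ hl hn]
  congr 1
  exact fullDiff_congr d hl fun m hm hm' => onWords_ofWords G hm (by omega)

/-- Induction over the stages: lists with a trivial first entry are treated by `trivialSum`, and
stage `j` by the homotopy that reads anti-paths of length `j + 1`. -/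
theorem exists_vanish {n : ℕ} {d : ℤ} {f : Cochain k (Q.Alg k) (n + 1)}
    (hf : f ∈ cocycles (Q.grading k) (n + 1) d) (j : ℕ) :
    ∃ g ∈ homogeneous (Q.grading k) n d,
      Q.VanishTrivial (onWords (f - differential (Q.grading k) d n g)) ∧
      ∀ i < j, Q.VanishAt i (onWords (f - differential (Q.grading k) d n g)) := by
  have hcoc : ∀ g ∈ homogeneous (Q.grading k) n d, ∀ l, Q.AllPaths l →
      fullDiff d (onWords (f - differential (Q.grading k) d n g)) l = 0 := by
    intro g hg
    rw [← differential_eq_zero_iff, map_sub, differential_differential, sub_zero]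
    exact hf.2
  induction j with
  | zero =>
    have hF := (differential_eq_zero_iff d f).1 hf.2
    refine ⟨sgn k d • ofWords k n (trivialSum (onWords f)), Submodule.smul_mem _ _
      (ofWords_mem_homogeneous (trivialSum_mem_grading (onWords_mem_grading hf.1))), ?_, ?_⟩
    · intro y l hl
      by_cases hn : l.length = n
      · have hl' : Q.AllPaths (.trivial E y :: l) := allPaths_cons.2 ⟨isPathOfA_trivial y, hl⟩
        rw [onWords_sub, map_smul, onWords_smul, onWords_differential_ofWords d _ hl'
          (by simpa using hn), smul_smul, sgn_mul_self, one_smul, fullDiff_trivialSum hF y hl,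
          sub_self]
      · exact onWords_of_length _ (by simpa using hn)
    · simp
  | succ j ih =>
    obtain ⟨g, hg, h0, hV⟩ := ih
    set F := onWords (f - differential (Q.grading k) d n g) with hFdef
    have hF := hcoc g hg
    have hhom : ∀ l, F l ∈ Q.grading k (Q.listDeg l + d) :=
      onWords_mem_grading (sub_mem hf.1 (differential_mem_homogeneous hg))
    -- The factor `sgn k d` undoes the global sign of the differential, and `-(-1) ^ j` turns the
    -- homotopy identity `fullDiff_readSum_afterAnti` into an exact cancellation of `F` at stage
    -- `j`.
    refine ⟨g + (sgn k d * -(-1) ^ j) • ofWords k n (readSum d j (afterAnti F)),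
      add_mem hg (Submodule.smul_mem _ _ (ofWords_mem_homogeneous
        (readSum_mem_grading (fun p w l => ?_) j))), ?_⟩
    · have := hhom (p.map Q.arrowPath ++ w :: l)
      rw [listDeg_append, listDeg_cons, listDeg_map_arrowPath] at this
      have e : d + Q.wordDeg p + Q.pathDeg w + Q.listDeg l =
          Q.wordDeg p + (Q.pathDeg w + Q.listDeg l) + d := by ring
      rw [e]
      exact this
    have key : ∀ l, Q.AllPaths l → l.length = n + 1 →
        onWords (f - differential (Q.grading k) d n (g + (sgn k d * -(-1) ^ j) •
          ofWords k n (readSum d j (afterAnti F)))) l =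
        F l + (-1 : k) ^ j • fullDiff d (readSum d j (afterAnti F)) l := by
      intro l hl hn
      rw [map_add, ← sub_sub, onWords_sub, map_smul, onWords_smul,
        onWords_differential_ofWords d _ hl hn, smul_smul, sub_eq_add_neg, ← neg_smul]
      congr 2
      rw [mul_right_comm, sgn_mul_self]
      ring
    constructor
    · intro y l hl
      by_cases hn : l.length = n
      · rw [key _ (allPaths_cons.2 ⟨isPathOfA_trivial y, hl⟩) (by simpa using hn), h0 y l hl,
          fullDiff_readSum_trivial d j _ y hl]
        simp
      · exact onWords_of_length _ (by simpa using hn)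
    · intro i hi α pre x l hpre hx hl
      have hl' : Q.AllPaths (Q.arrowPath α :: (pre.map Q.arrowPath ++ x :: l)) :=
        allPaths_cons.2 ⟨isPathOfA_arrowPath α, allPaths_append.2 ⟨allPaths_map_arrowPath _, hl⟩⟩
      by_cases hn : (Q.arrowPath α :: (pre.map Q.arrowPath ++ x :: l)).length = n + 1
      · rw [key _ hl' hn]
        rcases Nat.lt_succ_iff_lt_or_eq.1 hi with h | rfl
        · rw [fullDiff_readSum_eq_zero _ (by omega) hx hl, hV i h α pre x l hpre hx hl]
          simp
        · subst hpre
          rw [fullDiff_readSum_afterAnti h0 hF hV hx hl, smul_neg, smul_smul, ← mul_pow]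
          simp
      · exact onWords_of_length _ hn

end Coeff

/-! ### Parallel pairs -/

variable (Q) in
/-- A pair of an anti-path and a path of `A` with the same source and target. -/
def IsPair (x : PathWord V E × PathWord V E) : Prop :=
  Q.IsAntiPath x.1 ∧ Q.IsPathOfA x.2 ∧ x.1.tgt = x.2.tgt ∧ x.1.src = x.2.src

variable (Q) in
/-- The pair `(α p, α q)`. -/
def consPair (α : E) (y : PathWord V E × PathWord V E) : PathWord V E × PathWord V E :=
  (⟨Q.t α, y.1.src, α :: y.1.arrows⟩, ⟨Q.t α, y.2.src, α :: y.2.arrows⟩)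

variable (Q) in
/-- The pair `(p α, q α)`. -/
def snocPair (y : PathWord V E × PathWord V E) (α : E) : PathWord V E × PathWord V E :=
  (⟨y.1.tgt, Q.s α, y.1.arrows ++ [α]⟩, ⟨y.2.tgt, Q.s α, y.2.arrows ++ [α]⟩)

open Classical in
variable (Q) in
/-- Removes a common first arrow from a pair. -/
def lam (x : PathWord V E × PathWord V E) : Option (PathWord V E × PathWord V E) :=
  match x.1.arrows, x.2.arrows with
  | α :: m, β :: m' =>
    if α = β ∧ Q.IsPair x then some (⟨Q.s α, x.1.src, m⟩, ⟨Q.s α, x.2.src, m'⟩) else none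
  | _, _ => none

open Classical in
variable (Q) in
/-- Removes a common last arrow from a pair. -/
def rho (x : PathWord V E × PathWord V E) : Option (PathWord V E × PathWord V E) :=
  match x.1.arrows.getLast?, x.2.arrows.getLast? with
  | some α, some β =>
    if α = β ∧ Q.IsPair x then
      some (⟨x.1.tgt, Q.t α, x.1.arrows.dropLast⟩, ⟨x.2.tgt, Q.t α, x.2.arrows.dropLast⟩)
    else none
  | _, _ => none

theorem IsAntiPath.tgt_eq {x : PathWord V E} (hx : Q.IsAntiPath x) {α : E} {m : List E}
    (h : x.arrows = α :: m) : x.tgt = Q.t α := by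
  obtain ⟨a, b, l⟩ := x
  obtain rfl : l = α :: m := h
  exact hx.1.1.symm

theorem IsPath.src_eq {x : PathWord V E} (hx : Q.IsPath x) {α : E} {m : List E}
    (h : x.arrows = m ++ [α]) : x.src = Q.s α := by
  rw [IsPath, h] at hx
  obtain ⟨z, -, -, h⟩ := isWalk_append.1 hx
  exact h.symm

theorem isPath_snoc {α : E} {y x : V} {m : List E} :
    Q.IsPath ⟨y, x, m ++ [α]⟩ ↔ Q.IsPath ⟨y, Q.t α, m⟩ ∧ Q.s α = x := by
  constructor
  · intro h
    obtain ⟨z, h1, h2, h3⟩ := isWalk_append.1 h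
    exact ⟨h2 ▸ h1, h3⟩
  · rintro ⟨h1, h2⟩
    exact isWalk_append.2 ⟨_, h1, rfl, h2⟩

theorem isPair_of_cons {α : E} {p q : List E} {a b c d : V}
    (h : Q.IsPair (⟨a, b, α :: p⟩, ⟨c, d, α :: q⟩)) :
    Q.IsPair (⟨Q.s α, b, p⟩, ⟨Q.s α, d, q⟩) :=
  ⟨⟨h.1.1.2, h.1.2.tail⟩, ⟨h.2.1.1.2, h.2.1.2.tail⟩, rfl, h.2.2.2⟩

theorem isPair_of_snoc {α : E} {p q : List E} {a b c d : V}
    (h : Q.IsPair (⟨a, b, p ++ [α]⟩, ⟨c, d, q ++ [α]⟩)) :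
    Q.IsPair (⟨a, Q.t α, p⟩, ⟨c, Q.t α, q⟩) :=
  ⟨⟨(isPath_snoc.1 h.1.1).1, h.1.2.left_of_append⟩,
    ⟨(isPath_snoc.1 h.2.1.1).1, h.2.1.2.left_of_append⟩, h.2.2.1, rfl⟩

theorem lam_eq_some_iff {x y : PathWord V E × PathWord V E} :
    Q.lam x = some y ↔ Q.IsPair x ∧ ∃ α, x = Q.consPair α y ∧ y.1.tgt = Q.s α ∧
      y.2.tgt = Q.s α := by
  obtain ⟨⟨a, b, p⟩, ⟨c, d, q⟩⟩ := x
  obtain ⟨⟨a', b', p'⟩, ⟨c', d', q'⟩⟩ := y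
  constructor
  · intro h
    cases p with
    | nil => simp [lam] at h
    | cons α p =>
      cases q with
      | nil => simp [lam] at h
      | cons β q =>
        simp only [lam, Option.ite_none_right_eq_some, Option.some.injEq, Prod.mk.injEq,
          PathWord.mk.injEq] at h
        obtain ⟨⟨rfl, hp⟩, ⟨h1, h2, h3⟩, h4, h5, h6⟩ := h
        refine ⟨hp, α, ?_, h1.symm, h4.symm⟩
        have e1 := hp.1.1.1
        have e2 := hp.2.1.1.1
        simp only at e1 e2
        subst_vars
        rfl
  · rintro ⟨hp, α, h, h1, h2⟩
    simp only [consPair, Prod.mk.injEq, PathWord.mk.injEq] at h h1 h2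
    obtain ⟨⟨rfl, rfl, rfl⟩, rfl, rfl, rfl⟩ := h
    subst h1
    subst h2
    simp [lam, hp]

theorem rho_eq_some_iff {x y : PathWord V E × PathWord V E} :
    Q.rho x = some y ↔ Q.IsPair x ∧ ∃ α, x = Q.snocPair y α ∧ y.1.src = Q.t α ∧
      y.2.src = Q.t α := by
  obtain ⟨⟨a, b, p⟩, ⟨c, d, q⟩⟩ := x
  obtain ⟨⟨a', b', p'⟩, ⟨c', d', q'⟩⟩ := y
  constructor
  · intro h
    rcases List.eq_nil_or_concat' p with rfl | ⟨p, α, rfl⟩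
    · simp [rho] at h
    · rcases List.eq_nil_or_concat' q with rfl | ⟨q, β, rfl⟩
      · simp [rho] at h
      · simp only [rho, List.getLast?_append, List.getLast?_singleton, Option.some_or,
          List.dropLast_concat, Option.ite_none_right_eq_some, Option.some.injEq, Prod.mk.injEq,
          PathWord.mk.injEq] at h
        obtain ⟨⟨rfl, hp⟩, ⟨h1, h2, h3⟩, h4, h5, h6⟩ := h
        refine ⟨hp, α, ?_, h2.symm, h5.symm⟩
        have e1 := (isPath_snoc.1 hp.1.1).2
        have e2 := (isPath_snoc.1 hp.2.1.1).2
        subst_vars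
        rfl
  · rintro ⟨hp, α, h, h1, h2⟩
    simp only [snocPair, Prod.mk.injEq, PathWord.mk.injEq] at h h1 h2
    obtain ⟨⟨rfl, rfl, rfl⟩, rfl, rfl, rfl⟩ := h
    subst h1
    subst h2
    simp [rho, hp]

theorem isPair_of_lam {x y : PathWord V E × PathWord V E} (h : Q.lam x = some y) :
    Q.IsPair y := by
  obtain ⟨⟨a, b, p⟩, ⟨c, e, q⟩⟩ := y
  obtain ⟨hx, α, rfl, h1, h2⟩ := lam_eq_some_iff.1 h
  simp only at h1 h2
  subst h1
  subst h2
  exact isPair_of_cons hx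

theorem isPair_of_rho {x y : PathWord V E × PathWord V E} (h : Q.rho x = some y) :
    Q.IsPair y := by
  obtain ⟨⟨a, b, p⟩, ⟨c, e, q⟩⟩ := y
  obtain ⟨hx, α, rfl, h1, h2⟩ := rho_eq_some_iff.1 h
  simp only at h1 h2
  subst h1
  subst h2
  exact isPair_of_snoc hx

variable (k) in
/-- The coefficient of the left part of the Bardzell differential. -/
def aSign (Q : QuadraticQuiver V E) (d : ℤ) (x : PathWord V E × PathWord V E) : k :=
  match x.1.arrows with
  | [] => 1
  | α :: _ => sgn k (d * Q.deg α)

variable (k) in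
/-- The coefficient of the right part of the Bardzell differential. -/
def bSign (x : PathWord V E × PathWord V E) : k := (-1) ^ x.1.arrows.length

variable (Q) in
/-- The Bardzell differential, without global sign, on functions on pairs. -/
def bardzellDiff (d : ℤ) (Z : PathWord V E × PathWord V E → k)
    (x : PathWord V E × PathWord V E) : k :=
  aSign k Q d x * (Q.lam x).elim 0 Z + bSign k x * (Q.rho x).elim 0 Z

section Restr

variable [Fintype V]

open Classical in
/-- The restriction of a cochain to anti-paths, as a function on pairs. -/
def restr {n : ℕ} (f : Cochain k (Q.Alg k) n) (x : PathWord V E × PathWord V E) : k :=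
  if Q.IsPair x then Q.coeff k x.2 (onWords f (x.1.arrows.map Q.arrowPath)) else 0

theorem restr_of_isPair {n : ℕ} (f : Cochain k (Q.Alg k) n) {x : PathWord V E × PathWord V E}
    (hx : Q.IsPair x) :
    restr f x = Q.coeff k x.2 (onWords f (x.1.arrows.map Q.arrowPath)) := if_pos hx

theorem restr_of_not {n : ℕ} (f : Cochain k (Q.Alg k) n) {x : PathWord V E × PathWord V E}
    (hx : ¬ Q.IsPair x) : restr f x = 0 := if_neg hx

theorem restr_of_length {n : ℕ} (f : Cochain k (Q.Alg k) n) {x : PathWord V E × PathWord V E}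
    (hx : x.1.arrows.length ≠ n) : restr f x = 0 := by
  unfold restr
  rw [onWords_of_length f (by simpa using hx), map_zero, ite_self]

theorem restr_add {n : ℕ} (f g : Cochain k (Q.Alg k) n) : restr (f + g) = restr f + restr g := by
  funext x
  by_cases hx : Q.IsPair x
  · simp [restr, hx, onWords_add]
  · simp [restr, hx]

theorem restr_smul {n : ℕ} (c : k) (f : Cochain k (Q.Alg k) n) :
    restr (c • f) = c • restr f := by
  funext x
  by_cases hx : Q.IsPair x
  · simp [restr, hx, onWords_smul]
  · simp [restr, hx]

variable (Q k) in
/-- The restriction of cochains to anti-paths as a linear map. -/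
def restrLin (n : ℕ) : Cochain k (Q.Alg k) n →ₗ[k] (PathWord V E × PathWord V E → k) where
  toFun := restr
  map_add' := restr_add
  map_smul' := restr_smul

/-- On an anti-path all inner products are zero; only the right multiplication by the last arrow
remains. -/
theorem wordDiff_antipath {F : List (PathWord V E) → Q.Alg k} {m : List E} {β : E}
    (h : (m ++ [β]).IsChain Q.rel) :
    wordDiff F ((m ++ [β]).map Q.arrowPath) =
      (-1 : k) ^ (m.length + 1) • (F (m.map Q.arrowPath) * Q.pathElem k (Q.arrowPath β)) := by
  classical
  induction m generalizing F with
  | nil => simp [wordDiff]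
  | cons α m ih =>
    have ih' := @ih (fun l => F (Q.arrowPath α :: l)) h.tail
    have : ∃ γ m', m ++ [β] = γ :: m' := List.exists_cons_of_ne_nil (by simp)
    obtain ⟨γ, m', hm⟩ := this
    rw [hm] at ih'
    rw [List.cons_append, hm] at h ⊢
    have h1 : ¬ Q.Ok (Q.arrowPath α) (Q.arrowPath γ) :=
      not_ok_arrow (List.isChain_cons_cons.1 h).1 (m := []) rfl
    simp only [List.map_cons, wordDiff, if_neg h1] at ih' ⊢
    rw [ih', List.length_cons, pow_succ _ (_ + 1)]
    simp

/-- On the arrows of an anti-path only the two outer multiplications survive. The coefficient of q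
in `α a` is non-zero only if q starts with `α`, that is, if the pair has a left face; on the other
side this is a right face. -/
theorem restr_differential (d : ℤ) {n : ℕ} (f : Cochain k (Q.Alg k) n) :
    restr (differential (Q.grading k) d n f) = sgn k d • Q.bardzellDiff d (restr f) := by
  funext x
  rw [Pi.smul_apply]
  by_cases hx : Q.IsPair x
  swap
  · have h1 : Q.lam x = none := Option.eq_none_iff_forall_ne_some.2
      fun y hy => hx (lam_eq_some_iff.1 hy).1
    have h2 : Q.rho x = none := Option.eq_none_iff_forall_ne_some.2
      fun y hy => hx (rho_eq_some_iff.1 hy).1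
    simp [restr_of_not _ hx, bardzellDiff, h1, h2]
  by_cases hn : x.1.arrows.length = n + 1
  swap
  · rw [restr_of_length _ hn]
    have h1 : (Q.lam x).elim 0 (restr f) = 0 := by
      cases h : Q.lam x with
      | none => rfl
      | some y =>
        obtain ⟨-, α, rfl, -⟩ := lam_eq_some_iff.1 h
        exact restr_of_length f (by simpa [consPair] using hn)
    have h2 : (Q.rho x).elim 0 (restr f) = 0 := by
      cases h : Q.rho x with
      | none => rfl
      | some y =>
        obtain ⟨-, α, rfl, -⟩ := rho_eq_some_iff.1 h
        exact restr_of_length f (by simpa [snocPair] using hn)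
    simp [bardzellDiff, h1, h2]
  · rw [restr_of_isPair _ hx, onWords_differential d f (allPaths_map_arrowPath _) (by simpa using hn),
      map_smul]
    congr 1
    obtain ⟨⟨a, b, p⟩, ⟨c, e, q⟩⟩ := x
    simp only at hn ⊢
    have hL : ∀ α m, p = α :: m → (Q.lam (⟨a, b, p⟩, ⟨c, e, q⟩)).elim 0 (restr f) =
        Q.coeff k ⟨c, e, q⟩
            (Q.pathElem k (Q.arrowPath α) * onWords f (m.map Q.arrowPath)) := by
      rintro α m rfl
      cases q with
      | nil =>
        rw [coeff_arrow_mul_of_ne (by simp)]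
        rfl
      | cons β m' =>
        by_cases h : α = β
        · subst h
          rw [coeff_arrow_mul hx.2.1 rfl]
          simp only [lam, hx, and_self, if_true, Option.elim_some]
          rw [restr_of_isPair _ (isPair_of_cons hx)]
        · rw [coeff_arrow_mul_of_ne (by simp [Ne.symm h])]
          simp [lam, h]
    have hR : ∀ m α, p = m ++ [α] → (Q.rho (⟨a, b, p⟩, ⟨c, e, q⟩)).elim 0 (restr f) =
        Q.coeff k ⟨c, e, q⟩
            (onWords f (m.map Q.arrowPath) * Q.pathElem k (Q.arrowPath α)) := by
      rintro m α rfl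
      rcases List.eq_nil_or_concat' q with rfl | ⟨m', β, rfl⟩
      · rw [coeff_mul_arrow_of_ne (by simp)]
        simp [rho]
      · by_cases h : α = β
        · subst h
          rw [coeff_mul_arrow hx.2.1 rfl]
          simp only [rho, List.getLast?_append, List.getLast?_singleton, Option.some_or, hx,
            and_self, if_true, Option.elim_some, List.dropLast_concat]
          rw [restr_of_isPair _ (isPair_of_snoc hx)]
        · rw [coeff_mul_arrow_of_ne (by simp [Ne.symm h])]
          simp [rho, h]
    obtain ⟨m, β, hm⟩ : ∃ m β, p = m ++ [β] := by
      rcases List.eq_nil_or_concat' p with rfl | h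
      · simp at hn
      · exact h
    have hW := @wordDiff_antipath _ _ Q k _ _ (onWords f) m β (by rw [← hm]; exact hx.1.2)
    rw [← hm] at hW
    rw [bardzellDiff, hR m β hm, bSign]
    have hlen : p.length = m.length + 1 := by simp [hm]
    cases p with
    | nil => simp at hn
    | cons α p =>
      rw [hL α p rfl]
      rw [List.map_cons] at hW ⊢
      rw [fullDiff_cons, hW, map_add, map_smul, map_smul, hlen]
      simp [aSign, pathDeg, wordDeg, arrowPath]

/-! ### The comparison map -/

open Classical in
/-- The functional on anti-paths with values given by `z`, used to extend `z` to all lists. -/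
def valueAt (z : List E → Q.Alg k) (p : List E) (w : PathWord V E) (l : List (PathWord V E)) :
    Q.Alg k := if l = [] then z p * Q.pathElem k w else 0

/-- With a single entry `x` behind the anti-path, the value on the merger of `β` and `x` cancels
against right multiplication by `x`. With more entries every term is zero, because `valueAt`
requires the list to be used up. -/
theorem readAntiDiff_valueAt (z : List E → Q.Alg k) (pre : List E) {β : E} {x : PathWord V E}
    (hx : Q.Bad β x) {l : List (PathWord V E)} (hl : Q.AllPaths (x :: l)) :
    readAntiDiff 0 β (fun p => valueAt z (pre ++ p)) (x :: l) = 0 := by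
  classical
  have h1 := allPaths_cons.1 hl
  have e : readAnti 0 β (.trivial E (Q.s β)) (fun p => valueAt z (pre ++ p)) =
      valueAt z pre (.trivial E (Q.s β)) := by
    funext m
    rw [readAnti_zero, List.append_nil]
  simp only [readAntiDiff, e, readAnti_zero, List.append_nil, ok_arrow_iff h1.1, and_iff_left hx]
  cases l with
  | nil =>
    simp only [valueAt, wordDiff, if_true, mul_assoc]
    split_ifs with h
    · rw [h, trivial_mul_pathElem h1.1, add_neg_cancel]
    · rw [pathElem_mul_of_ne _ _ (by exact h)]
      simp
  | cons y l =>
    have : wordDiff (fun m => valueAt z pre (.trivial E (Q.s β)) (x :: m)) (y :: l) = 0 :=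
      wordDiff_eq_zero h1.2 fun m _ _ => by simp [valueAt]
    simp only [wordDiff, this]
    simp [valueAt]

/-- The lift of a function on anti-paths to all tuples has a differential that is already
normalised, so lifts can be compared by their restrictions alone. -/
theorem vanishAt_fullDiff_valueAt (d : ℤ) (z : List E → Q.Alg k) {i j : ℕ} (hij : i ≤ j) :
    Q.VanishAt i (fullDiff d (readSum d j (valueAt z))) := by
  intro α pre x l hpre hx hl
  rcases Nat.lt_or_eq_of_le hij with h | rfl
  · exact fullDiff_readSum_eq_zero _ (by omega) hx hl
  · subst hpre
    rw [fullDiff_readSum_arrow d _ _ hx le_rfl hl, readAntiDiff_badAfter_eq hx _ hl]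
    have := readAntiDiff_valueAt z (α :: pre) (badAfter_iff.1 hx).2 hl
    simp only [List.cons_append] at this
    rw [this]
    simp

theorem vanishTrivial_fullDiff_valueAt (d : ℤ) (z : List E → Q.Alg k) (j : ℕ) :
    Q.VanishTrivial (fullDiff d (readSum d j (valueAt z))) :=
  fun y _ hl => fullDiff_readSum_trivial d j _ y hl

theorem readAnti_antipath {α : E} {pre : List E} (h : (α :: pre).IsChain Q.rel)
    (H : List E → PathWord V E → List (PathWord V E) → Q.Alg k) :
    readAnti pre.length α (.trivial E (Q.s α)) H (pre.map Q.arrowPath) =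
      H pre (.trivial E (Q.s (lastArrow α pre))) [] := by
  induction pre generalizing α H with
  | nil => rw [List.length_nil, readAnti_zero]; rfl
  | cons β pre ih =>
    have h1 := List.isChain_cons_cons.1 h
    rw [List.map_cons, List.length_cons, arrowPath, readAnti_step h1.1 rfl]
    exact ih h1.2 _

theorem readSum_valueAt_antipath (d : ℤ) (z : List E → Q.Alg k) {α : E} {pre : List E}
    (h : (α :: pre).IsChain Q.rel) :
    readSum d pre.length (valueAt z) ((α :: pre).map Q.arrowPath) =
      Q.pathElem k (.trivial E (Q.t α)) * (z (α :: pre) *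
        Q.pathElem k (.trivial E (Q.s (lastArrow α pre)))) := by
  rw [List.map_cons, readSum_arrow, readAnti_antipath h]
  simp [valueAt]

theorem src_eq_lastArrow {p : PathWord V E} (hp : Q.IsPath p) {α : E} {pre : List E}
    (h : p.arrows = α :: pre) : p.src = Q.s (lastArrow α pre) := by
  obtain ⟨a, b, l⟩ := p
  obtain rfl : l = α :: pre := h
  induction pre generalizing a α with
  | nil => exact hp.2.symm
  | cons β pre ih => exact ih (Q.s α) hp.2

/-- Lifting followed by restriction is the identity: the idempotents that appear on both sides do
not affect coefficients of parallel paths. -/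
theorem restr_readSum_valueAt (d : ℤ) (z : List E → Q.Alg k) (n : ℕ)
    (x : PathWord V E × PathWord V E) (hx : Q.IsPair x) (hn : x.1.arrows.length = n + 1) :
    restr (ofWords k (n + 1) (readSum d n (valueAt z))) x = Q.coeff k x.2 (z x.1.arrows) := by
  classical
  obtain ⟨α, pre, hp⟩ := List.exists_cons_of_length_eq_add_one hn
  rw [restr_of_isPair _ hx, onWords_ofWords _ (allPaths_map_arrowPath _) (by simpa using hn), hp]
  have hpre : pre.length = n := by rw [hp] at hn; simpa using hn
  subst hpre
  rw [readSum_valueAt_antipath d z (hp ▸ hx.1.2), coeff_trivial_mul, coeff_mul_trivial,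
    if_pos (by rw [← hx.2.2.1, hx.1.tgt_eq hp]),
    if_pos (by rw [← hx.2.2.2, src_eq_lastArrow hx.1.1 hp])]

/-- Together with `eq_zero_of_vanish` this says that a normalised cocycle is determined by its
restriction to anti-paths. -/
theorem eq_zero_of_restr {n : ℕ} {d : ℤ} {f : Cochain k (Q.Alg k) (n + 1)}
    (hf : differential (Q.grading k) d (n + 1) f = 0) (h0 : Q.VanishTrivial (onWords f))
    (hV : ∀ i < n, Q.VanishAt i (onWords f)) (hr : restr f = 0) : f = 0 := by
  classical
  have hF := (differential_eq_zero_iff d f).1 hf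
  have hV' : ∀ i, Q.VanishAt i (onWords f) := by
    intro i α pre x l hpre hx hl
    by_cases hi : i < n
    · exact hV i hi α pre x l hpre hx hl
    -- For `i ≥ n` the list has at least `n + 2` entries, one more than the arity of `f`.
    · exact onWords_of_length f (by simp; omega)
  refine ext_onWords fun l hl hn => ?_
  rw [onWords_zero]
  refine eq_zero_of_vanish h0 hF hV' (fun l => onWords_of_length f) (fun α pre hc hlen => ?_) hl
    (by rintro rfl; simp at hn)
  have h1 := h0.trivial_mul hF (v := Q.arrowPath α) (l := pre.map Q.arrowPath)
    (allPaths_map_arrowPath (α :: pre))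
  have h2 := cocycle_after_antipath h0 hF (fun i _ => hV' i) hc allPaths_nil
  simp only [wordDiff, List.append_nil, neg_inj] at h2
  refine eq_zero_of_coeff fun q hq => ?_
  -- By `h1` and `h2` the value is fixed by the idempotents at the ends of the anti-path, so
  -- coefficients of paths that are not parallel to it vanish; the others are values of `restr f`.
  by_cases hq' : q.tgt = Q.t α ∧ q.src = Q.s (lastArrow α pre)
  · by_cases hw : Q.IsWalk (Q.t α) (α :: pre) (Q.s (lastArrow α pre))
    · have hp : Q.IsPair (⟨Q.t α, Q.s (lastArrow α pre), α :: pre⟩, q) :=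
        ⟨⟨hw, hc⟩, hq, hq'.1.symm, hq'.2.symm⟩
      have := congrFun hr (⟨Q.t α, Q.s (lastArrow α pre), α :: pre⟩, q)
      rwa [restr_of_isPair f hp] at this
    · refine absurd ?_ hw
      clear h1 h2 hq' hlen hw
      induction pre generalizing α with
      | nil => exact ⟨rfl, rfl⟩
      | cons β pre ih =>
        have h3 := List.isChain_cons_cons.1 hc
        have h4 := ih β h3.2
        exact ⟨rfl, (Q.comp_of_rel h3.1).symm ▸ h4⟩
  · rw [not_and_or] at hq'
    rcases hq' with h | h
    · rw [List.map_cons, ← h1, coeff_trivial_mul, if_neg (by exact h)]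
    · rw [← h2, coeff_mul_trivial, if_neg h]

/-- Normalising `f` by a coboundary `d g` may create non-zero values on anti-paths, namely those of
`d g`. They are removed by adding `d g'`, where `g'` has the same restriction as `g` and a
normalised differential. -/
theorem mem_coboundaries_of_restr {n : ℕ} {d : ℤ} {f : Cochain k (Q.Alg k) n}
    (hf : f ∈ cocycles (Q.grading k) n d) (hr : restr f = 0) :
    f ∈ coboundaries (Q.grading k) n d := by
  classical
  cases n with
  | zero =>
    change f = 0
    refine ext_onWords fun l hl hn => ?_
    obtain rfl := List.length_eq_zero_iff.1 hn
    rw [onWords_zero]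
    have h1 := (differential_eq_zero_iff d f).1 hf.2
    rw [← one_mul (onWords f []), ← sum_trivial, Finset.sum_mul]
    refine Finset.sum_eq_zero fun x _ => eq_zero_of_coeff fun q hq => ?_
    -- A 0-cocycle commutes with every trivial path, so it only involves closed paths, and those
    -- coefficients are recorded by `restr`.
    have h2 := h1 [.trivial E x] (allPaths_cons.2 ⟨isPathOfA_trivial x, allPaths_nil⟩)
    simp only [fullDiff_cons, wordDiff, pathDeg, wordDeg, PathWord.trivial, List.map_nil,
      List.sum_nil, mul_zero, sgn_zero, one_smul] at h2
    have h3 := eq_neg_of_add_eq_zero_left h2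
    rw [neg_neg] at h3
    change Q.pathElem k (.trivial E x) * _ = _ * Q.pathElem k (.trivial E x) at h3
    by_cases hs : q.src = x
    · rw [coeff_trivial_mul]
      split_ifs with ht
      · have hp : Q.IsPair (.trivial E x, q) :=
          ⟨⟨rfl, List.isChain_nil⟩, hq, ht.symm, hs.symm⟩
        have h4 := congrFun hr (.trivial E x, q)
        rwa [restr_of_isPair f hp] at h4
      · rfl
    · rw [h3, coeff_mul_trivial, if_neg hs]
  | succ n =>
    obtain ⟨g, hg, h0, hV⟩ := exists_vanish hf (n + 1)
    obtain ⟨g', hg', hgr, h0', hV'⟩ : ∃ g' ∈ homogeneous (Q.grading k) n d, restr g' = restr g ∧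
        Q.VanishTrivial (onWords (differential (Q.grading k) d n g')) ∧
        ∀ i < n, Q.VanishAt i (onWords (differential (Q.grading k) d n g')) := by
      cases n with
      | zero =>
        -- In arity 0 the required cochain is the diagonal part of `g` with respect to the
        -- idempotents; it commutes with all trivial paths.
        refine ⟨ofWords k 0 fun _ => ∑ x : V, Q.pathElem k (.trivial E x) *
          (onWords g [] * Q.pathElem k (.trivial E x)), ?_, ?_, ?_, by simp⟩
        · refine mem_homogeneous fun l hl hn => ?_
          obtain rfl := List.length_eq_zero_iff.1 hn
          rw [onWords_ofWords _ hl hn]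
          have h3 := onWords_mem_grading hg []
          refine sum_mem fun x _ => mul_mem_grading (pathElem_mem_grading _)
            (mul_mem_grading h3 (pathElem_mem_grading _) rfl) ?_
          simp [pathDeg, wordDeg, PathWord.trivial]
        · funext x
          by_cases hx : Q.IsPair x
          · by_cases hn : x.1.arrows.length = 0
            · rw [restr_of_isPair _ hx, restr_of_isPair _ hx, onWords_ofWords _
                (allPaths_map_arrowPath _) (by simpa using hn), List.length_eq_zero_iff.1 hn,
                map_sum]
              simp only [coeff_trivial_mul, coeff_mul_trivial, List.map_nil]
              rw [Finset.sum_eq_single x.2.tgt]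
              · have : x.1.tgt = x.1.src := by
                  have := hx.1.1
                  rwa [IsPath, List.length_eq_zero_iff.1 hn] at this
                rw [if_pos rfl, if_pos (by rw [← hx.2.2.2, ← hx.2.2.1, this])]
              · intro y _ hy
                rw [if_neg hy.symm]
              · simp
            · rw [restr_of_length _ hn, restr_of_length _ hn]
          · rw [restr_of_not _ hx, restr_of_not _ hx]
        · intro y l hl
          by_cases hn : l.length = 0
          · obtain rfl := List.length_eq_zero_iff.1 hn
            rw [onWords_differential_ofWords (n := 0) d _
              (allPaths_cons.2 ⟨isPathOfA_trivial y, hl⟩) rfl]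
            simp only [fullDiff_cons, wordDiff, Finset.sum_mul, Finset.mul_sum]
            have e1 : ∀ x : V, Q.pathElem k (.trivial E y) * (Q.pathElem k (.trivial E x) *
                (onWords g [] * Q.pathElem k (.trivial E x))) = if y = x then
                Q.pathElem k (.trivial E y) * (onWords g [] * Q.pathElem k (.trivial E y))
                else 0 := by
              intro x
              split_ifs with h
              · subst h
                rw [← mul_assoc, trivial_mul_trivial]
              · rw [← mul_assoc, trivial_mul_trivial_of_ne h, zero_mul]
            have e2 : ∀ x : V, Q.pathElem k (.trivial E x) *
                (onWords g [] * Q.pathElem k (.trivial E x)) * Q.pathElem k (.trivial E y) =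
                if y = x then
                Q.pathElem k (.trivial E y) * (onWords g [] * Q.pathElem k (.trivial E y))
                else 0 := by
              intro x
              split_ifs with h
              · subst h
                rw [mul_assoc, mul_assoc, trivial_mul_trivial]
              · rw [mul_assoc, mul_assoc, trivial_mul_trivial_of_ne (Ne.symm h), mul_zero,
                  mul_zero]
            simp only [e1, e2]
            simp [pathDeg, wordDeg, PathWord.trivial, sgn_zero]
          · exact onWords_of_length _ (by simpa using hn)
      | succ n =>
        set z : List E → Q.Alg k := fun p => onWords g (p.map Q.arrowPath) with hz
        have key : ∀ l, Q.AllPaths l → l.length = n + 2 →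
            onWords (differential (Q.grading k) d (n + 1)
              (ofWords k (n + 1) (readSum d n (valueAt z)))) l =
            sgn k d • fullDiff d (readSum d n (valueAt z)) l := fun l hl hn =>
          onWords_differential_ofWords d _ hl hn
        -- In positive arity it is the lift of the restriction of `g` by the comparison map.
        refine ⟨ofWords k (n + 1) (readSum d n (valueAt z)), ?_, ?_, ?_, ?_⟩
        · refine ofWords_mem_homogeneous (readSum_mem_grading (fun p w l => ?_) n)
          unfold valueAt
          split_ifs with h
          · subst h
            refine mul_mem_grading (onWords_mem_grading hg _) (pathElem_mem_grading w) ?_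
            rw [listDeg_map_arrowPath]
            simp [listDeg]
            ring
          · exact zero_mem _
        · funext x
          by_cases hx : Q.IsPair x
          · by_cases hn : x.1.arrows.length = n + 1
            · rw [restr_readSum_valueAt d z n x hx hn, restr_of_isPair _ hx]
            · rw [restr_of_length _ hn, restr_of_length _ hn]
          · rw [restr_of_not _ hx, restr_of_not _ hx]
        · intro y l hl
          by_cases hn : l.length = n + 1
          · rw [key _ (allPaths_cons.2 ⟨isPathOfA_trivial y, hl⟩) (by simpa using hn),
              vanishTrivial_fullDiff_valueAt d z n y l hl, smul_zero]
          · exact onWords_of_length _ (by simpa using hn)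
        · intro i hi α pre x l hpre hx hl
          by_cases hn : (Q.arrowPath α :: (pre.map Q.arrowPath ++ x :: l)).length = n + 2
          · rw [key _ (allPaths_cons.2 ⟨isPathOfA_arrowPath α,
              allPaths_append.2 ⟨allPaths_map_arrowPath _, hl⟩⟩) hn,
              vanishAt_fullDiff_valueAt d z (by omega) α pre x l hpre hx hl, smul_zero]
          · exact onWords_of_length _ hn
    -- Both differentials are under control on the normalised lists and the restrictions of `g` and
    -- `g'` cancel, so `f - d (g - g')` is a normalised cocycle with restriction zero.
    refine ⟨g - g', sub_mem hg hg', ?_⟩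
    have e : f - differential (Q.grading k) d n (g - g') =
        f - differential (Q.grading k) d n g + differential (Q.grading k) d n g' := by
      rw [map_sub]
      abel
    refine (sub_eq_zero.1 (eq_zero_of_restr (d := d) ?_ ?_ ?_ ?_)).symm
    · rw [map_sub, differential_differential, sub_zero]
      exact hf.2
    · intro y l hl
      rw [e, onWords_add, h0 y l hl, h0' y l hl, add_zero]
    · intro i hi α pre x l hpre hx hl
      rw [e, onWords_add, hV i (by omega) α pre x l hpre hx hl, hV' i hi α pre x l hpre hx hl,
        add_zero]
    · have h1 : restr (g - g') = 0 := by
        have : restr (g - g') = Q.restrLin k n (g - g') := rfl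
        rw [this, map_sub]
        exact sub_eq_zero.2 hgr.symm
      have h2 : restr (f - differential (Q.grading k) d n (g - g')) =
          Q.restrLin k (n + 1) (f - differential (Q.grading k) d n (g - g')) := rfl
      rw [h2, map_sub]
      change restr f - restr (differential (Q.grading k) d n (g - g')) = 0
      rw [hr, restr_differential, h1]
      funext x
      have : ∀ o : Option (PathWord V E × PathWord V E), o.elim (0 : k) 0 = 0 := by
        intro o; cases o <;> rfl
      simp [bardzellDiff, this]

end Restr

section PairCochain

variable [Fintype V]

/-! ### The cochains attached to pairs -/

theorem wordElem_cons (α : E) (l : List E) :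
    Q.wordElem k (α :: l) = Q.pathElem k (Q.arrowPath α) * Q.wordElem k l := by
  simp [wordElem]

theorem wordElem_nil : Q.wordElem k [] = 1 := rfl

theorem wordElem_mem_grading (l : List E) : Q.wordElem k l ∈ Q.grading k (Q.wordDeg l) := by
  induction l with
  | nil => exact SetLike.GradedOne.one_mem
  | cons α l ih =>
    rw [wordElem_cons]
    refine mul_mem_grading (pathElem_mem_grading _) ih ?_
    simp [pathDeg, wordDeg, arrowPath]

theorem wordElem_arrows {w : PathWord V E} (hw : Q.IsPathOfA w) (hne : w.arrows ≠ []) :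
    Q.wordElem k w.arrows = Q.pathElem k w := by
  obtain ⟨a, b, m⟩ := w
  induction m generalizing a with
  | nil => simp at hne
  | cons α m ih =>
    obtain rfl : Q.t α = a := hw.1.1
    have h1 := hw.tail (α := α) (m := m) rfl
    cases m with
    | nil =>
      obtain rfl : Q.s α = b := hw.1.2
      simp [wordElem, arrowPath]
    | cons β m =>
      have := ih (Q.s α) h1 (by simp)
      simp only at this ⊢
      rw [wordElem_cons, this, pathElem_mul _ _ (isPathOfA_arrowPath α).1 h1.1 rfl]
      rfl

open Classical in
variable (k) in
/-- The value of the cochain attached to `(p, q)` on a list of paths with concatenation `L`. -/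
def pairSum (Q : QuadraticQuiver V E) (d : ℤ) (n : ℕ) (p : List E) (q : PathWord V E)
    (L : List E) : Q.Alg k :=
  ∑ i ∈ Finset.range (L.length + 1),
    if (L.drop i).take n = p then
      sgn k (d * Q.wordDeg (L.take i)) •
        (Q.wordElem k (L.take i) * Q.pathElem k q * Q.wordElem k (L.drop (i + n)))
    else 0

theorem pairCochain_eq (p q : PathWord V E) :
    Q.pairCochain k p.length p q = ofWords k p.length fun l =>
      pairSum k Q (Q.pathDeg q - Q.pathDeg p) p.length p.arrows q (l.map (·.arrows)).flatten := by
  rw [pairCochain, if_pos rfl, ofWords]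
  congr 1
  funext v
  rw [List.map_ofFn]
  simp only [pairSum, zsmul_negOnePow (k := k)]
  rfl

open Classical in
theorem pairSum_nil (d : ℤ) {n : ℕ} {p : List E} (hp : p ≠ []) (q : PathWord V E) :
    pairSum k Q d n p q [] = 0 := by
  simp [pairSum, Ne.symm hp]

-- Splitting off the occurrence of `p` at the very beginning gives the same recursion as that of
-- `leftExtend`, which is why the sum over factorisations agrees with `readSum`.
open Classical in
theorem pairSum_cons (d : ℤ) (n : ℕ) (p : List E) (q : PathWord V E) (α : E) (L : List E) :
    pairSum k Q d n p q (α :: L) =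
      (if (α :: L).take n = p then
        Q.pathElem k q * Q.wordElem k ((α :: L).drop n) else 0) +
      sgn k (d * Q.deg α) • (Q.pathElem k (Q.arrowPath α) * pairSum k Q d n p q L) := by
  rw [pairSum, List.length_cons, Finset.sum_range_succ', add_comm]
  congr 1
  · simp [wordElem_nil, wordDeg, sgn_zero]
  · rw [pairSum, Finset.mul_sum, Finset.smul_sum]
    refine Finset.sum_congr rfl fun i _ => ?_
    rw [List.drop_succ_cons, List.take_succ_cons, wordElem_cons, add_right_comm,
      List.drop_succ_cons]
    split_ifs
    · rw [show Q.wordDeg (α :: L.take i) = Q.deg α + Q.wordDeg (L.take i) by simp [wordDeg],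
        mul_add, sgn_add, mul_smul_comm, smul_smul, mul_assoc, mul_assoc, mul_assoc]
    · simp

theorem pairSum_mem_grading (n : ℕ) (p : List E) (q : PathWord V E) (L : List E) :
    pairSum k Q (Q.pathDeg q - Q.wordDeg p) n p q L ∈
      Q.grading k (Q.wordDeg L + (Q.pathDeg q - Q.wordDeg p)) := by
  refine sum_mem fun i _ => ?_
  split_ifs with h
  · refine Submodule.smul_mem _ _ (mul_mem_grading (mul_mem_grading (wordElem_mem_grading _)
      (pathElem_mem_grading q) rfl) (wordElem_mem_grading _) ?_)
    have e : L = L.take i ++ (p ++ L.drop (i + n)) := by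
      rw [← h, ← List.drop_drop, List.take_append_drop, List.take_append_drop]
    conv_rhs => rw [e]
    simp only [wordDeg, List.map_append, List.sum_append]
    ring
  · exact zero_mem _

theorem listDeg_eq (l : List (PathWord V E)) :
    Q.listDeg l = Q.wordDeg (l.map (·.arrows)).flatten := by
  induction l with
  | nil => rfl
  | cons x l ih =>
    rw [listDeg_cons, ih]
    simp [wordDeg, pathDeg]

theorem pairCochain_mem_homogeneous (p q : PathWord V E) :
    Q.pairCochain k p.length p q ∈
      homogeneous (Q.grading k) p.length (Q.pathDeg q - Q.pathDeg p) := by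
  rw [pairCochain_eq]
  refine ofWords_mem_homogeneous fun l => ?_
  rw [listDeg_eq]
  exact pairSum_mem_grading _ _ _ _

/-- Two consecutive arrows of an anti-path cannot lie in the same path of A, so every entry of the
list contributes at most one arrow. -/
theorem length_le_of_prefix {p : List E} (hp : p.IsChain Q.rel)
    {l : List (PathWord V E)} (hl : Q.AllPaths l) (h : p <+: (l.map (·.arrows)).flatten) :
    p.length ≤ l.length := by
  induction l generalizing p with
  | nil =>
    have := List.prefix_nil.1 (by simpa using h)
    simp [this]
  | cons v l ih =>
    have hl' := allPaths_cons.1 hl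
    obtain ⟨a, b, m⟩ := v
    cases m with
    | nil => exact (ih hp hl'.2 (by simpa using h)).trans (by simp)
    | cons β m =>
      cases p with
      | nil => simp
      | cons γ p =>
        simp only [List.map_cons, List.flatten_cons, List.cons_append, List.cons_prefix_cons] at h
        obtain ⟨rfl, h⟩ := h
        cases p with
        | nil => simp
        | cons δ p =>
          have h1 := List.isChain_cons_cons.1 hp
          cases m with
          | nil => exact Nat.succ_le_succ (ih h1.2 hl'.2 (by simpa using h))
          | cons ε m =>
            rw [List.cons_append, List.cons_prefix_cons] at h
            exact absurd (h.1 ▸ h1.1) (List.isChain_cons_cons.1 hl'.1.2).1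

theorem pairSum_eq_zero (d : ℤ) {p : List E} (hp : p.IsChain Q.rel) (q : PathWord V E)
    {l : List (PathWord V E)} (hl : Q.AllPaths l) (hlp : l.length < p.length) :
    pairSum k Q d p.length p q (l.map (·.arrows)).flatten = 0 := by
  classical
  induction l with
  | nil => exact pairSum_nil d (by rintro rfl; simp at hlp) q
  | cons v l ih =>
    have hl' := allPaths_cons.1 hl
    obtain ⟨a, b, m⟩ := v
    induction m generalizing a with
    | nil =>
      simpa using ih hl'.2 (by simp at hlp; omega)
    | cons α m ihm =>
      have hw := hl'.1.tail (α := α) (m := m) rfl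
      have h1 := ihm (Q.s α) (allPaths_cons.2 ⟨hw, hl'.2⟩) hlp ⟨hw, hl'.2⟩
      simp only [List.map_cons, List.flatten_cons, List.cons_append] at h1 ⊢
      rw [pairSum_cons, h1, mul_zero, smul_zero, add_zero, if_neg]
      intro h2
      have h3 := length_le_of_prefix hp hl (by
        simp only [List.map_cons, List.flatten_cons, List.cons_append]
        rw [← h2]
        exact List.take_prefix _ _)
      omega

theorem readAnti_const_zero (j : ℕ) (β : E) (w : PathWord V E) (l : List (PathWord V E)) :
    readAnti j β w (fun _ _ _ => (0 : Q.Alg k)) l = 0 := by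
  induction j generalizing β w l with
  | zero => rw [readAnti_zero]
  | succ j ih =>
    cases l with
    | nil => rfl
    | cons y l =>
      rw [readAnti]
      split_ifs
      · split
        · rfl
        · split_ifs
          · exact ih _ _ _
          · rfl
      · rfl

-- For a function concentrated on one anti-path, reading succeeds exactly if the concatenated word
-- starts with `p`. The entries behind the first must each supply one arrow, and since there is
-- exactly one arrow per entry, only the last entry may have a remainder.
open Classical in
theorem readAnti_single {q : PathWord V E} (hq : Q.IsPathOfA q) {p : List E}
    (hp : p.IsChain Q.rel) {α : E} {w : PathWord V E}
    (hw : Q.IsPathOfA w) (hwt : w.tgt = Q.s α) (hαw : Q.Bad α w)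
    (hps : ∀ β ∈ p.getLast?, Q.s β = q.src)
    {l : List (PathWord V E)} (hl : Q.AllPaths l) (hlp : p.length = l.length + 1) :
    readAnti l.length α w
      (fun p' => valueAt (fun p'' => if p'' = p then Q.pathElem k q else 0) (α :: p')) l =
    if (α :: (w.arrows ++ (l.map (·.arrows)).flatten)).take p.length = p then
      Q.pathElem k q *
        Q.wordElem k ((α :: (w.arrows ++ (l.map (·.arrows)).flatten)).drop p.length)
    else 0 := by
  induction l generalizing α w p with
  | nil =>
    obtain ⟨β, rfl⟩ := List.length_eq_one_iff.1 hlp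
    rw [List.length_nil, readAnti_zero]
    simp only [valueAt, if_true, List.map_nil, List.flatten_nil, List.append_nil,
      List.length_singleton, List.take_succ_cons, List.take_zero, List.drop_succ_cons,
      List.drop_zero]
    by_cases h : α = β
    · subst h
      simp only [if_true]
      by_cases hne : w.arrows = []
      · rw [hne, wordElem_nil, mul_one, hw.eq_trivial hne, hwt, hps α (by simp),
          pathElem_mul_trivial hq]
      · rw [wordElem_arrows hw hne]
    · simp [h]
  | cons y l ih =>
    have hl' := allPaths_cons.1 hl
    obtain ⟨γ, p, rfl⟩ := List.exists_cons_of_length_eq_add_one hlp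
    have hlp' : p.length = l.length + 1 := by simpa using hlp
    have hne : p ≠ [] := by rintro rfl; simp at hlp'
    have hps' : ∀ β ∈ p.getLast?, Q.s β = q.src := by
      intro β hβ
      refine hps β ?_
      rw [List.getLast?_cons, Option.mem_def.1 hβ]
      simp
    by_cases hγ : α = γ
    swap
    · rw [if_neg (by simp [hγ])]
      have : (fun p' => valueAt (fun p'' => if p'' = γ :: p then Q.pathElem k q else 0)
          (α :: p')) = fun _ _ _ => (0 : Q.Alg k) := by
        funext p' w' l'
        simp [valueAt, hγ]
      rw [this, readAnti_const_zero]
    subst hγ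
    by_cases hwn : w.arrows = []
    swap
    · rw [List.length_cons, readAnti_ne hwn, if_neg]
      obtain ⟨δ, m, hm⟩ := List.exists_cons_of_ne_nil hwn
      obtain ⟨ε, p, rfl⟩ := List.exists_cons_of_ne_nil hne
      intro h
      simp only [hm, List.length_cons, List.take_succ_cons, List.cons_append, List.cons.injEq,
        true_and] at h
      exact hαw δ m hm (h.1 ▸ (List.isChain_cons_cons.1 hp).1)
    obtain ⟨a, b, m⟩ := y
    rw [hwn, List.nil_append]
    cases m with
    | nil =>
      have : readAnti (⟨a, b, []⟩ :: l : List (PathWord V E)).length α w (fun p' =>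
          valueAt (fun p'' => if p'' = α :: p then Q.pathElem k q else 0) (α :: p'))
          (⟨a, b, []⟩ :: l) = 0 := by
        simp [readAnti]
      rw [this, if_neg]
      intro h
      simp only [List.map_cons, List.flatten_cons, List.nil_append, List.length_cons,
        List.take_succ_cons, List.cons.injEq, true_and] at h
      have := length_le_of_prefix hp.tail hl'.2 (by
        rw [List.tail_cons, ← h]
        exact List.take_prefix _ _)
      simp only [List.tail_cons] at this
      omega
    | cons β m =>
      by_cases hr : Q.rel α β
      · rw [List.length_cons, readAnti_step hr hwn]
        have hb : Q.Bad β ⟨Q.s β, b, m⟩ := by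
          intro ε m' hm'
          have := hl'.1.2
          simp only at hm'
          rw [hm'] at this
          exact (List.isChain_cons_cons.1 this).1
        have hpt : p.IsChain Q.rel := hp.tail
        have := ih hpt (hl'.1.tail (α := β) (m := m) rfl) rfl hb hps' hl'.2 hlp'
        have e : (fun p' => valueAt (fun p'' => if p'' = p then Q.pathElem k q else 0)
            (β :: p')) = fun p' => valueAt (fun p'' => if p'' = α :: p then Q.pathElem k q else 0)
            (α :: β :: p') := by
          funext p' w' l'
          simp [valueAt]
        rw [e] at this
        rw [this]
        simp
      · have h1 : readAnti (⟨a, b, β :: m⟩ :: l : List (PathWord V E)).length α w (fun p' =>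
            valueAt (fun p'' => if p'' = α :: p then Q.pathElem k q else 0) (α :: p'))
            (⟨a, b, β :: m⟩ :: l) = 0 := by
          simp [readAnti, hr]
        rw [h1, if_neg]
        obtain ⟨ε, p, rfl⟩ := List.exists_cons_of_ne_nil hne
        intro h
        simp only [List.map_cons, List.flatten_cons, List.cons_append, List.length_cons,
          List.take_succ_cons, List.cons.injEq, true_and] at h
        exact hr (h.1 ▸ (List.isChain_cons_cons.1 hp).1)

-- An occurrence of `p` starting behind the first entry would need more arrows than there are
-- entries left. Hence every occurrence starts inside the first entry, and the sum over
-- factorisations is the lift of the function concentrated on `p` with value q.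
open Classical in
theorem pairSum_eq_readSum (d : ℤ) {p q : PathWord V E} (hx : Q.IsPair (p, q)) {n : ℕ}
    (hn : p.arrows.length = n + 1) {l : List (PathWord V E)} (hl : Q.AllPaths l)
    (hln : l.length = n + 1) :
    pairSum k Q d p.arrows.length p.arrows q (l.map (·.arrows)).flatten =
      readSum d n (valueAt fun p' => if p' = p.arrows then Q.pathElem k q else 0) l := by
  obtain ⟨v, l, rfl⟩ := List.exists_cons_of_length_eq_add_one hln
  have hl' := allPaths_cons.1 hl
  have hln' : l.length = n := by simpa using hln
  subst hln'
  obtain ⟨a, b, m⟩ := v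
  rw [readSum]
  simp only [List.map_cons, List.flatten_cons]
  have hv := hl'.1
  clear hl hln
  induction m generalizing a with
  | nil =>
    rw [List.nil_append, pairSum_eq_zero d hx.1.2 q hl'.2
      (by have : p.arrows.length = l.length + 1 := hn; show l.length < p.arrows.length; omega)]
    rfl
  | cons α m ih =>
    have hw := hv.tail (α := α) (m := m) rfl
    have hb : Q.Bad α ⟨Q.s α, b, m⟩ := by
      intro ε m' hm'
      have := hv.2
      simp only at hm'
      rw [hm'] at this
      exact (List.isChain_cons_cons.1 this).1
    have hps : ∀ β ∈ p.arrows.getLast?, Q.s β = q.src := by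
      intro β hβ
      obtain ⟨m, hm⟩ := List.getLast?_eq_some_iff.1 hβ
      rw [← hx.1.1.src_eq hm]
      exact hx.2.2.2
    rw [List.cons_append, pairSum_cons, ih (Q.s α) ⟨hw, hl'.2⟩ hw, leftExtend, add_comm,
      readAnti_single hx.2.1 hx.1.2 hw rfl hb hps hl'.2 hn]
    congr 1
    split_ifs with h
    · have h1 : ∃ p', p.arrows = α :: p' := by
        rw [← h, hn]
        exact ⟨_, rfl⟩
      obtain ⟨p', hp'⟩ := h1
      rw [← mul_assoc, show Q.t α = q.tgt by rw [← hx.1.tgt_eq hp']; exact hx.2.2.1,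
        trivial_mul_pathElem hx.2.1]
    · rw [mul_zero]

open Classical in
theorem onWords_pairCochain {p q : PathWord V E} (hx : Q.IsPair (p, q)) {n : ℕ}
    (hn : p.arrows.length = n + 1) :
    Q.pairCochain k (n + 1) p q = ofWords k (n + 1) (readSum (Q.pathDeg q - Q.pathDeg p) n
      (valueAt fun p' => if p' = p.arrows then Q.pathElem k q else 0)) := by
  have h : p.length = n + 1 := hn
  rw [← h, pairCochain_eq]
  refine ext_onWords fun l hl hln => ?_
  rw [onWords_ofWords _ hl hln, onWords_ofWords _ hl hln]
  exact pairSum_eq_readSum _ hx hn hl (hln.trans hn)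

open Classical in
theorem restr_pairCochain {p q : PathWord V E} (hx : Q.IsPair (p, q)) (n : ℕ)
    (hn : p.arrows.length = n) :
    restr (Q.pairCochain k n p q) = fun x => if x = (p, q) then 1 else 0 := by
  funext x
  by_cases hx' : Q.IsPair x
  swap
  · rw [restr_of_not _ hx', if_neg]
    rintro rfl
    exact hx' hx
  by_cases hn' : x.1.arrows.length = n
  swap
  · rw [restr_of_length _ hn', if_neg]
    rintro rfl
    exact hn' hn
  have key : restr (Q.pairCochain k n p q) x =
      Q.coeff k x.2 (if x.1.arrows = p.arrows then Q.pathElem k q else 0) := by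
    cases n with
    | zero =>
      have h : p.length = 0 := hn
      have h2 := List.length_eq_zero_iff.1 hn
      have h3 := List.length_eq_zero_iff.1 hn'
      rw [restr_of_isPair _ hx', ← h, pairCochain_eq, onWords_ofWords _ (allPaths_map_arrowPath _)
        (by simp [h, h3])]
      congr 1
      simp [h3, h2, pairSum, h, wordElem_nil, wordDeg, sgn_zero]
    | succ n =>
      rw [onWords_pairCochain hx hn, restr_readSum_valueAt _ _ _ _ hx' hn']
  rw [key]
  by_cases h1 : x.1.arrows = p.arrows
  · rw [if_pos h1, coeff_pathElem hx.2.1]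
    refine if_congr ?_ rfl rfl
    constructor
    · intro h2
      have h3 := hx.2.2
      have h4 := hx'.2.2
      rw [← h2] at h4
      exact Prod.ext (PathWord.ext (h4.1.trans h3.1.symm) (h4.2.trans h3.2.symm) h1) h2.symm
    · rintro rfl
      rfl
  · rw [if_neg h1, map_zero, if_neg]
    rintro rfl
    exact h1 rfl

/-- In positive arity the cochain of a pair is a lift, so its differential is normalised. In arity 0
it is a closed path, which commutes with trivial paths. -/
theorem vanish_differential_pairCochain {p q : PathWord V E} (hx : Q.IsPair (p, q)) (n : ℕ)
    (hn : p.arrows.length = n) :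
    Q.VanishTrivial (onWords (differential (Q.grading k) (Q.pathDeg q - Q.pathDeg p) n
      (Q.pairCochain k n p q))) ∧
    ∀ i < n, Q.VanishAt i (onWords (differential (Q.grading k) (Q.pathDeg q - Q.pathDeg p) n
      (Q.pairCochain k n p q))) := by
  classical
  cases n with
  | zero =>
    refine ⟨fun y l hl => ?_, by simp⟩
    by_cases hn' : l.length = 0
    · obtain rfl := List.length_eq_zero_iff.1 hn'
      have h : p.length = 0 := hn
      have h2 := List.length_eq_zero_iff.1 hn
      rw [← h, pairCochain_eq, onWords_differential_ofWords _ _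
        (allPaths_cons.2 ⟨isPathOfA_trivial y, hl⟩) (by simp [h])]
      have h3 : q.tgt = q.src := by
        have := hx.1.1
        rw [IsPath, h2] at this
        rw [← hx.2.2.1, ← hx.2.2.2]
        exact this
      have h4 : Q.pathElem k (.trivial E y) * Q.pathElem k q =
          Q.pathElem k q * Q.pathElem k (.trivial E y) := by
        by_cases hy : y = q.tgt
        · conv_rhs => rw [hy, h3, pathElem_mul_trivial hx.2.1]
          rw [hy, trivial_mul_pathElem hx.2.1]
        · rw [pathElem_mul_of_ne _ _ (by exact hy), pathElem_mul_of_ne _ _ (by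
            rw [← h3]; exact fun h => hy h.symm)]
      have h5 : pairSum k Q (Q.pathDeg q - Q.pathDeg p) 0 [] q [] = Q.pathElem k q := by
        simp [pairSum, wordElem_nil, wordDeg, sgn_zero]
      simp only [fullDiff_cons, wordDiff, h, h2, List.map_nil, List.flatten_nil, h5]
      rw [h4]
      simp [pathDeg, wordDeg, PathWord.trivial, sgn_zero]
    · exact onWords_of_length _ (by simpa using hn')
  | succ n =>
    rw [onWords_pairCochain hx hn]
    constructor
    · intro y l hl
      by_cases hln : l.length = n + 1
      · rw [onWords_differential_ofWords _ _ (allPaths_cons.2 ⟨isPathOfA_trivial y, hl⟩)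
          (by simpa using hln), vanishTrivial_fullDiff_valueAt _ _ n y l hl, smul_zero]
      · exact onWords_of_length _ (by simpa using hln)
    · intro i hi α pre x l hpre hx hl
      by_cases hln : (Q.arrowPath α :: (pre.map Q.arrowPath ++ x :: l)).length = n + 2
      · rw [onWords_differential_ofWords _ _ (allPaths_cons.2 ⟨isPathOfA_arrowPath α,
          allPaths_append.2 ⟨allPaths_map_arrowPath _, hl⟩⟩) hln,
          vanishAt_fullDiff_valueAt _ _ (by omega) α pre x l hpre hx hl, smul_zero]
      · exact onWords_of_length _ hln

/-! ### Chains of pairs -/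

variable (Q) in
/-- The linear combination only involves pairs of bidegree `(n, d)`. -/
def IsChainOf (n : ℕ) (d : ℤ) (c : PairChain V E k) : Prop :=
  ∀ x ∈ c.support, Q.IsPair x ∧ x.1.arrows.length = n ∧ Q.pathDeg x.2 - Q.pathDeg x.1 = d

theorem toHochschild_eq_sum (n : ℕ) (c : PairChain V E k) :
    Q.toHochschild k n c = ∑ x ∈ c.support, c x • Q.pairCochain k n x.1 x.2 := by
  rw [toHochschild, Finsupp.linearCombination_apply, Finsupp.sum]

theorem toHochschild_mem_homogeneous {n : ℕ} {d : ℤ} {c : PairChain V E k}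
    (hc : Q.IsChainOf n d c) : Q.toHochschild k n c ∈ homogeneous (Q.grading k) n d := by
  rw [toHochschild_eq_sum]
  refine sum_mem fun x hx => Submodule.smul_mem _ _ ?_
  obtain ⟨-, h2, h3⟩ := hc x hx
  have := pairCochain_mem_homogeneous (Q := Q) (k := k) x.1 x.2
  rwa [h3, show x.1.length = n from h2] at this

/-- The comparison map sends Bardzell cochains to Hochschild cochains with the same values on
anti-paths. -/
theorem restr_toHochschild {n : ℕ} {d : ℤ} {c : PairChain V E k}
    (hc : Q.IsChainOf n d c) : restr (Q.toHochschild k n c) = c := by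
  classical
  have : restr (Q.toHochschild k n c) = Q.restrLin k n (Q.toHochschild k n c) := rfl
  rw [this, toHochschild_eq_sum, map_sum]
  funext x
  rw [Finset.sum_apply]
  have h1 : ∀ y ∈ c.support, Q.restrLin k n (c y • Q.pairCochain k n y.1 y.2) x =
      if x = y then c y else 0 := by
    intro y hy
    obtain ⟨h1, h2, -⟩ := hc y hy
    rw [map_smul, Pi.smul_apply]
    change c y • restr (Q.pairCochain k n y.1 y.2) x = _
    rw [restr_pairCochain h1 n h2]
    simp
  rw [Finset.sum_congr rfl h1, Finset.sum_ite_eq]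
  simp only [Finsupp.mem_support_iff, ne_eq, ite_not]
  split_ifs with h
  · exact h.symm
  · rfl

/-- The differential is itself a normalised cocycle, hence zero as soon as its restriction, the
Bardzell differential of the chain, is zero. -/
theorem differential_toHochschild_eq_zero {n : ℕ} {d : ℤ} {c : PairChain V E k}
    (hc : Q.IsChainOf n d c) (hd : Q.bardzellDiff d c = 0) :
    differential (Q.grading k) d n (Q.toHochschild k n c) = 0 := by
  have key : ∀ l, onWords (differential (Q.grading k) d n (Q.toHochschild k n c)) l =
      ∑ x ∈ c.support, c x •
        onWords (differential (Q.grading k) d n (Q.pairCochain k n x.1 x.2)) l := by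
    intro l
    let φ : Cochain k (Q.Alg k) (n + 1) →ₗ[k] Q.Alg k :=
      { toFun := fun f => onWords f l
        map_add' := fun f g => onWords_add f g l
        map_smul' := fun c f => onWords_smul c f l }
    change φ _ = ∑ x ∈ c.support, c x • φ _
    rw [toHochschild_eq_sum, map_sum, map_sum]
    exact Finset.sum_congr rfl fun x _ => by rw [map_smul, map_smul]
  refine eq_zero_of_restr (d := d) (differential_differential _ _ _) ?_ ?_ ?_
  · intro y l hl
    rw [key]
    refine Finset.sum_eq_zero fun x hx => ?_
    obtain ⟨h1, h2, h3⟩ := hc x hx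
    rw [← h3, (vanish_differential_pairCochain h1 n h2).1 y l hl, smul_zero]
  · intro i hi α pre v l hpre hv hl
    rw [key]
    refine Finset.sum_eq_zero fun x hx => ?_
    obtain ⟨h1, h2, h3⟩ := hc x hx
    rw [← h3, (vanish_differential_pairCochain h1 n h2).2 i hi α pre v l hpre hv hl, smul_zero]
  · rw [restr_differential, restr_toHochschild hc, hd, smul_zero]

theorem toHochschild_mem_cocycles {n : ℕ} {d : ℤ} {c : PairChain V E k}
    (hc : Q.IsChainOf n d c) (hd : Q.bardzellDiff d c = 0) :
    Q.toHochschild k n c ∈ cocycles (Q.grading k) n d :=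
  ⟨toHochschild_mem_homogeneous hc, differential_toHochschild_eq_zero hc hd⟩

end PairCochain

/-! ### Combinatorics of parallel pairs of a gentle quiver -/

theorem IsPair.isChain_fst {x : PathWord V E × PathWord V E} (hx : Q.IsPair x) :
    x.1.arrows.IsChain Q.rel := hx.1.2

theorem IsPair.isChain_snd {x : PathWord V E × PathWord V E} (hx : Q.IsPair x) :
    x.2.arrows.IsChain fun β α => ¬ Q.rel β α := hx.2.1.2

theorem IsPath.ext {p p' : PathWord V E} (hp : Q.IsPath p) (hp' : Q.IsPath p')
    (h : p.arrows = p'.arrows) (hne : p.arrows ≠ []) : p = p' := by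
  obtain ⟨a, b, l⟩ := p
  obtain ⟨a', b', l'⟩ := p'
  obtain rfl : l = l' := h
  obtain ⟨α, m, rfl⟩ := List.exists_cons_of_ne_nil hne
  obtain rfl : a = a' := hp.1.symm.trans hp'.1
  obtain rfl : b = b' := isWalk_unique' hp hp'
  rfl

theorem lam_consPair {α : E} {y : PathWord V E × PathWord V E} (hx : Q.IsPair (Q.consPair α y))
    (h1 : y.1.tgt = Q.s α) (h2 : y.2.tgt = Q.s α) : Q.lam (Q.consPair α y) = some y :=
  lam_eq_some_iff.2 ⟨hx, α, rfl, h1, h2⟩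

theorem rho_snocPair {α : E} {y : PathWord V E × PathWord V E} (hx : Q.IsPair (Q.snocPair y α))
    (h1 : y.1.src = Q.t α) (h2 : y.2.src = Q.t α) : Q.rho (Q.snocPair y α) = some y :=
  rho_eq_some_iff.2 ⟨hx, α, rfl, h1, h2⟩

/-- An arrow put in front has to form a relation with the first arrow of the anti-path and a
non-zero product with the first arrow of the path. As soon as one of the two words has an arrow,
gentleness leaves one choice. -/
theorem lam_inj (hQ : Q.IsGentle) {x x' y : PathWord V E × PathWord V E}
    (h : Q.lam x = some y) (h' : Q.lam x' = some y)
    (hy : y.1.arrows ≠ [] ∨ y.2.arrows ≠ []) : x = x' := by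
  obtain ⟨hx, α, rfl, h1, h2⟩ := lam_eq_some_iff.1 h
  obtain ⟨hx', β, rfl, h1', h2'⟩ := lam_eq_some_iff.1 h'
  suffices α = β by rw [this]
  rcases hy with hy | hy
  · obtain ⟨γ, m, hm⟩ := List.exists_cons_of_ne_nil hy
    have e := hx.isChain_fst
    have e' := hx'.isChain_fst
    simp only [consPair, hm, List.isChain_cons_cons] at e e'
    exact hQ.rel_left _ _ _ e.1 e'.1
  · obtain ⟨γ, m, hm⟩ := List.exists_cons_of_ne_nil hy
    have e := hx.isChain_snd
    have e' := hx'.isChain_snd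
    simp only [consPair, hm, List.isChain_cons_cons] at e e'
    have ht : y.2.tgt = Q.t γ := (isPair_of_lam h).2.1.tgt_eq hm
    exact hQ.nonrel_left _ _ _ (h2.symm.trans ht) e.1 (h2'.symm.trans ht) e'.1

theorem isChain_snoc_snoc {R : E → E → Prop} {m : List E} {γ α : E} :
    ((m ++ [γ]) ++ [α]).IsChain R ↔ (m ++ [γ]).IsChain R ∧ R γ α := by
  rw [List.isChain_append]
  simp

theorem rho_inj (hQ : Q.IsGentle) {x x' y : PathWord V E × PathWord V E}
    (h : Q.rho x = some y) (h' : Q.rho x' = some y)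
    (hy : y.1.arrows ≠ [] ∨ y.2.arrows ≠ []) : x = x' := by
  obtain ⟨hx, α, rfl, h1, h2⟩ := rho_eq_some_iff.1 h
  obtain ⟨hx', β, rfl, h1', h2'⟩ := rho_eq_some_iff.1 h'
  suffices α = β by rw [this]
  rcases hy with hy | hy
  · obtain ⟨m, γ, hm⟩ := (List.eq_nil_or_concat' _).resolve_left hy
    have e := hx.isChain_fst
    have e' := hx'.isChain_fst
    simp only [snocPair, hm, isChain_snoc_snoc] at e e'
    exact hQ.rel_right _ _ _ e.2 e'.2
  · obtain ⟨m, γ, hm⟩ := (List.eq_nil_or_concat' _).resolve_left hy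
    have e := hx.isChain_snd
    have e' := hx'.isChain_snd
    simp only [snocPair, hm, isChain_snoc_snoc] at e e'
    have ht : y.2.src = Q.s γ := (isPair_of_rho h).2.1.1.src_eq hm
    exact hQ.nonrel_right _ _ _ (ht.symm.trans h2) e.2 (ht.symm.trans h2') e'.2

/-- A pair has no left extension if it has a left restriction. -/
theorem lam_lam {x y z : PathWord V E × PathWord V E} (h : Q.lam x = some y)
    (h' : Q.lam y = some z) : False := by
  obtain ⟨hx, α, rfl, -⟩ := lam_eq_some_iff.1 h
  obtain ⟨-, β, rfl, -⟩ := lam_eq_some_iff.1 h'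
  exact (List.isChain_cons_cons.1 hx.2.1.2).1 (List.isChain_cons_cons.1 hx.1.2).1

/-- A pair has no right extension if it has a right restriction. -/
theorem rho_rho {x y z : PathWord V E × PathWord V E} (h : Q.rho x = some y)
    (h' : Q.rho y = some z) : False := by
  obtain ⟨hx, α, rfl, -⟩ := rho_eq_some_iff.1 h
  obtain ⟨-, β, rfl, -⟩ := rho_eq_some_iff.1 h'
  exact (isChain_snoc_snoc.1 hx.2.1.2).2 (isChain_snoc_snoc.1 hx.1.2).2

theorem isChain_cons_snoc {R : E → E → Prop} {l : List E} {α β : E} (h1 : (α :: l).IsChain R)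
    (h2 : (l ++ [β]).IsChain R) (h3 : l = [] → R α β) : (α :: (l ++ [β])).IsChain R := by
  cases l with
  | nil => simpa using h3 rfl
  | cons γ m => exact List.isChain_cons_cons.2 ⟨(List.isChain_cons_cons.1 h1).1, h2⟩

/-- The exceptional pairs at which squares of restrictions need not close: a pair of trivial paths,
or a complete anti-path or a complete path with a trivial path. -/
inductive Exceptional (Q : QuadraticQuiver V E) : PathWord V E × PathWord V E → Prop
  | trivial (v : V) : Exceptional Q (.trivial E v, .trivial E v)
  | anti (p : PathWord V E) (hp : Q.IsCompleteAntiPath p) : Exceptional Q (p, .trivial E p.src)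
  | path (q : PathWord V E) (hq : Q.IsCompletePath q) : Exceptional Q (.trivial E q.src, q)

theorem IsPair.fst_eq_trivial {x : PathWord V E × PathWord V E} (hx : Q.IsPair x)
    (h : x.1.arrows = []) : x.1 = .trivial E x.2.src := by
  obtain ⟨⟨a, b, p⟩, ⟨c, d, q⟩⟩ := x
  obtain rfl : p = [] := h
  obtain rfl : a = b := hx.1.1
  obtain rfl : a = d := hx.2.2.2
  rfl

theorem IsPair.snd_eq_trivial {x : PathWord V E × PathWord V E} (hx : Q.IsPair x)
    (h : x.2.arrows = []) : x.2 = .trivial E x.1.src := by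
  obtain ⟨⟨a, b, p⟩, ⟨c, d, q⟩⟩ := x
  obtain rfl : q = [] := h
  obtain rfl : c = d := hx.2.1.1
  obtain rfl : b = c := hx.2.2.2
  rfl

theorem IsPair.exceptional_of_nil {x : PathWord V E × PathWord V E} (hx : Q.IsPair x)
    (h1 : x.1.arrows = []) (h2 : x.2.arrows = []) : Q.Exceptional x := by
  have e1 := hx.fst_eq_trivial h1
  obtain ⟨⟨a, b, p⟩, ⟨c, d, q⟩⟩ := x
  obtain rfl : q = [] := h2
  obtain rfl : c = d := hx.2.1.1
  rw [show (⟨a, b, p⟩ : PathWord V E) = .trivial E c from e1]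
  exact .trivial c

theorem IsPair.exceptional_anti {x : PathWord V E × PathWord V E} (hx : Q.IsPair x)
    {α β : E} (hα : x.1.arrows.head? = some α) (hβ : x.1.arrows.getLast? = some β)
    (hr : Q.rel β α) (h2 : x.2.arrows = []) : Q.Exceptional x := by
  have e2 := hx.snd_eq_trivial h2
  obtain ⟨p, q⟩ := x
  simp only at e2
  subst e2
  exact .anti p ⟨hx.1, hx.2.2.1, α, β, hα, hβ, hr⟩

theorem IsPair.exceptional_path {x : PathWord V E × PathWord V E} (hx : Q.IsPair x)
    {α β : E} (hα : x.2.arrows.head? = some α) (hβ : x.2.arrows.getLast? = some β)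
    (hr : ¬ Q.rel β α) (h1 : x.1.arrows = []) : Q.Exceptional x := by
  have e1 := hx.fst_eq_trivial h1
  obtain ⟨p, q⟩ := x
  simp only at e1
  subst e1
  exact .path q ⟨hx.2.1, hx.2.2.1.symm, α, β, hα, hβ, hr⟩

/-- The square closes as soon as both words of the pair are non-trivial. If one is trivial, the
product of the new arrows `α` and `β` must be of the right kind; if it is not, gentleness forces the
other word to start with `β` and to end with `α`, so that this word is complete. -/
theorem exists_common_extension (hQ : Q.IsGentle) {x x' w : PathWord V E × PathWord V E}
    (h : Q.rho x = some w) (h' : Q.lam x' = some w) (hw : ¬ Q.Exceptional w) :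
    ∃ y, Q.lam y = some x ∧ Q.rho y = some x' := by
  have hpw := isPair_of_rho h
  obtain ⟨hx, β, rfl, h1, h2⟩ := rho_eq_some_iff.1 h
  obtain ⟨hx', α, rfl, h1', h2'⟩ := lam_eq_some_iff.1 h'
  have hp : Q.IsPair (Q.consPair α (Q.snocPair w β)) := by
    refine ⟨⟨⟨rfl, ?_⟩, isChain_cons_snoc hx'.1.2 hx.1.2 ?_⟩, ⟨⟨rfl, ?_⟩,
      isChain_cons_snoc hx'.2.1.2 hx.2.1.2 ?_⟩, rfl, rfl⟩
    · have := hx.1.1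
      rwa [IsPath, snocPair, h1'] at this
    · intro hn
      by_contra hr
      by_cases hn2 : w.2.arrows = []
      · exact hw (hpw.exceptional_of_nil hn hn2)
      have hsα : Q.s α = Q.t β := by
        rw [← h1', ← h1, hpw.fst_eq_trivial hn]
        rfl
      obtain ⟨γ, m, hm⟩ := List.exists_cons_of_ne_nil hn2
      obtain ⟨m', δ, hm'⟩ := (List.eq_nil_or_concat' _).resolve_left hn2
      have e1 := hx'.isChain_snd
      have e2 := hx.isChain_snd
      have e3 := hpw.2.1.tgt_eq hm
      have e4 := hpw.2.1.1.src_eq hm'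
      simp only [consPair, hm, List.isChain_cons_cons] at e1
      simp only [snocPair, hm', isChain_snoc_snoc] at e2
      -- `α` and the last arrow of the path both compose with `β` to a non-zero product, hence are
      -- equal; the next equality is the mirror image.
      have hαδ : α = δ := hQ.nonrel_left β _ _ hsα hr (e4.symm.trans h2) e2.2
      have hβγ : β = γ := hQ.nonrel_right α _ _ hsα hr (h2'.symm.trans e3) e1.1
      subst hαδ
      subst hβγ
      exact hw (hpw.exceptional_path (by rw [hm]; rfl) (by rw [hm']; simp) hr hn)
    · have := hx.2.1.1
      rwa [IsPath, snocPair, h2'] at this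
    · intro hn hr
      by_cases hn1 : w.1.arrows = []
      · exact hw (hpw.exceptional_of_nil hn1 hn)
      obtain ⟨γ, m, hm⟩ := List.exists_cons_of_ne_nil hn1
      obtain ⟨m', δ, hm'⟩ := (List.eq_nil_or_concat' _).resolve_left hn1
      have e1 := hx'.isChain_fst
      have e2 := hx.isChain_fst
      simp only [consPair, hm, List.isChain_cons_cons] at e1
      simp only [snocPair, hm', isChain_snoc_snoc] at e2
      have hαδ : α = δ := hQ.rel_left β _ _ hr e2.2
      have hβγ : β = γ := hQ.rel_right α _ _ hr e1.1
      subst hαδ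
      subst hβγ
      exact hw (hpw.exceptional_anti (by rw [hm]; rfl) (by rw [hm']; simp) hr hn)
  exact ⟨Q.consPair α (Q.snocPair w β), lam_consPair hp h1' h2',
    rho_snocPair (y := Q.consPair α w) hp h1 h2⟩

theorem IsPair.exists_lam {x : PathWord V E × PathWord V E} (hx : Q.IsPair x) {α : E}
    {m m' : List E} (h1 : x.1.arrows = α :: m) (h2 : x.2.arrows = α :: m') :
    ∃ z, Q.lam x = some z :=
  ⟨(⟨Q.s α, x.1.src, m⟩, ⟨Q.s α, x.2.src, m'⟩), lam_eq_some_iff.2 ⟨hx, α,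
    Prod.ext (PathWord.ext (hx.1.tgt_eq h1) rfl h1) (PathWord.ext (hx.2.1.tgt_eq h2) rfl h2),
    rfl, rfl⟩⟩

theorem IsPair.exists_rho {x : PathWord V E × PathWord V E} (hx : Q.IsPair x) {α : E}
    {m m' : List E} (h1 : x.1.arrows = m ++ [α]) (h2 : x.2.arrows = m' ++ [α]) :
    ∃ z, Q.rho x = some z :=
  ⟨(⟨x.1.tgt, Q.t α, m⟩, ⟨x.2.tgt, Q.t α, m'⟩), rho_eq_some_iff.2 ⟨hx, α,
    Prod.ext (PathWord.ext rfl (hx.1.1.src_eq h1) h1) (PathWord.ext rfl (hx.2.1.1.src_eq h2) h2),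
    rfl, rfl⟩⟩

theorem IsPair.lam_cons {x : PathWord V E × PathWord V E} (hx : Q.IsPair x) {α : E}
    (hs : x.1.tgt = Q.s α) (h1 : (α :: x.1.arrows).IsChain Q.rel)
    (h2 : (α :: x.2.arrows).IsChain fun β α => ¬ Q.rel β α) :
    Q.lam (Q.consPair α x) = some x := by
  have hs' : x.2.tgt = Q.s α := hx.2.2.1.symm.trans hs
  refine lam_consPair ⟨⟨⟨rfl, ?_⟩, h1⟩, ⟨⟨rfl, ?_⟩, h2⟩, rfl, hx.2.2.2⟩ hs hs'
  · exact hs ▸ hx.1.1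
  · exact hs' ▸ hx.2.1.1

theorem IsPair.rho_snoc {x : PathWord V E × PathWord V E} (hx : Q.IsPair x) {α : E}
    (hs : x.1.src = Q.t α) (h1 : (x.1.arrows ++ [α]).IsChain Q.rel)
    (h2 : (x.2.arrows ++ [α]).IsChain fun β α => ¬ Q.rel β α) :
    Q.rho (Q.snocPair x α) = some x := by
  have hs' : x.2.src = Q.t α := hx.2.2.2.symm.trans hs
  refine rho_snocPair ⟨⟨isPath_snoc.2 ⟨?_, rfl⟩, h1⟩, ⟨isPath_snoc.2 ⟨?_, rfl⟩, h2⟩,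
    hx.2.2.1, rfl⟩ hs hs'
  · exact hs ▸ hx.1.1
  · exact hs' ▸ hx.2.1.1

/-- The last arrows of both words of `x'` agree. They are also the last arrows of `x`, unless a word
of `x` is trivial; then the arrow removed on the left is also the last arrow of the other word,
which is therefore complete. -/
theorem exceptional_or_rho {x x' w : PathWord V E × PathWord V E} (h : Q.lam x' = some x)
    (h' : Q.rho x' = some w) : Q.Exceptional x ∨ ∃ z, Q.rho x = some z := by
  have hp := isPair_of_lam h
  obtain ⟨hx, α, rfl, h1, h2⟩ := lam_eq_some_iff.1 h
  obtain ⟨-, β, e, h3, h4⟩ := rho_eq_some_iff.1 h'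
  have e1 : α :: x.1.arrows = w.1.arrows ++ [β] := congrArg (fun x => x.1.arrows) e
  have e2 : α :: x.2.arrows = w.2.arrows ++ [β] := congrArg (fun x => x.2.arrows) e
  rcases List.eq_nil_or_concat' x.1.arrows with hn1 | ⟨m, γ, hm⟩
  · rcases List.eq_nil_or_concat' x.2.arrows with hn2 | ⟨m', γ', hm'⟩
    · exact Or.inl (hp.exceptional_of_nil hn1 hn2)
    · rw [hn1] at e1
      rw [hm', ← List.cons_append] at e2
      have e3 := (List.append_inj' e2 rfl).2
      have e4 := (List.append_inj' (s₁ := []) e1 rfl).2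
      obtain rfl : α = γ' := by simp_all
      obtain ⟨δ, m, hm⟩ := List.exists_cons_of_ne_nil (l := x.2.arrows) (by simp [hm'])
      have e5 := hx.isChain_snd
      simp only [consPair, hm, List.isChain_cons_cons] at e5
      exact Or.inl (hp.exceptional_path (by rw [hm]; rfl) (by rw [hm']; simp) e5.1 hn1)
  · rcases List.eq_nil_or_concat' x.2.arrows with hn2 | ⟨m', γ', hm'⟩
    · rw [hn2] at e2
      rw [hm, ← List.cons_append] at e1
      have e3 := (List.append_inj' e1 rfl).2
      have e4 := (List.append_inj' (s₁ := []) e2 rfl).2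
      obtain rfl : α = γ := by simp_all
      obtain ⟨δ, m, hm'⟩ := List.exists_cons_of_ne_nil (l := x.1.arrows) (by simp [hm])
      have e5 := hx.isChain_fst
      simp only [consPair, hm', List.isChain_cons_cons] at e5
      exact Or.inl (hp.exceptional_anti (by rw [hm']; rfl) (by rw [hm]; simp) e5.1 hn2)
    · rw [hm', ← List.cons_append] at e2
      rw [hm, ← List.cons_append] at e1
      have e3 := (List.append_inj' e1 rfl).2
      have e4 := (List.append_inj' e2 rfl).2
      obtain rfl : γ = β := by simpa using e3
      obtain rfl : γ' = γ := by simpa using e4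
      exact Or.inr (hp.exists_rho hm hm')

theorem exceptional_or_lam {x x' w : PathWord V E × PathWord V E} (h : Q.rho x' = some x)
    (h' : Q.lam x' = some w) : Q.Exceptional x ∨ ∃ z, Q.lam x = some z := by
  have hp := isPair_of_rho h
  obtain ⟨hx, α, rfl, h1, h2⟩ := rho_eq_some_iff.1 h
  obtain ⟨-, β, e, h3, h4⟩ := lam_eq_some_iff.1 h'
  have e1 : x.1.arrows ++ [α] = β :: w.1.arrows := congrArg (fun x => x.1.arrows) e
  have e2 : x.2.arrows ++ [α] = β :: w.2.arrows := congrArg (fun x => x.2.arrows) e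
  rcases hn1 : x.1.arrows with _ | ⟨γ, m⟩
  · rcases hn2 : x.2.arrows with _ | ⟨γ', m'⟩
    · exact Or.inl (hp.exceptional_of_nil hn1 hn2)
    · rw [hn1] at e1
      rw [hn2] at e2
      obtain rfl : α = γ' := by simp_all
      obtain ⟨m, δ, hm⟩ := (List.eq_nil_or_concat' x.2.arrows).resolve_left (by simp [hn2])
      have e5 := hx.isChain_snd
      simp only [snocPair, hm, isChain_snoc_snoc] at e5
      exact Or.inl (hp.exceptional_path (by rw [hn2]; rfl) (by rw [hm]; simp) e5.2 hn1)
  · rcases hn2 : x.2.arrows with _ | ⟨γ', m'⟩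
    · rw [hn1] at e1
      rw [hn2] at e2
      obtain rfl : α = γ := by simp_all
      obtain ⟨m, δ, hm⟩ := (List.eq_nil_or_concat' x.1.arrows).resolve_left (by simp [hn1])
      have e5 := hx.isChain_fst
      simp only [snocPair, hm, isChain_snoc_snoc] at e5
      exact Or.inl (hp.exceptional_anti (by rw [hn1]; rfl) (by rw [hm]; simp) e5.2 hn2)
    · rw [hn1] at e1
      rw [hn2] at e2
      obtain rfl : γ = β := by simp_all
      obtain rfl : γ' = γ := by simp_all
      exact Or.inr (hp.exists_lam hn1 hn2)

/-- A word which admits no extension by one arrow is not properly contained in a longer one. -/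
theorem eq_of_infix {R : E → E → Prop} {u l : List E} (hu : u ≠ []) {a b : V}
    (hl : Q.IsPath ⟨a, b, l⟩) (hR : l.IsChain R) (h : u <:+: l)
    (h1 : ∀ α γ m, u = γ :: m → Q.s α = Q.t γ → ¬ R α γ)
    (h2 : ∀ m γ α, u = m ++ [γ] → Q.s γ = Q.t α → ¬ R γ α) : l = u := by
  obtain ⟨s, t, rfl⟩ := h
  have hs : s = [] := by
    rcases List.eq_nil_or_concat' s with h | ⟨s, α, rfl⟩
    · exact h
    obtain ⟨γ, m, rfl⟩ := List.exists_cons_of_ne_nil hu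
    simp only [List.append_assoc, List.cons_append] at hl hR
    obtain ⟨z, -, -, hz⟩ := isWalk_append.1 hl
    exact absurd (List.isChain_cons_cons.1 hR.right_of_append).1 (h1 α γ m rfl hz.1.symm)
  have ht : t = [] := by
    rcases t with _ | ⟨α, t⟩
    · rfl
    obtain ⟨m, γ, rfl⟩ := (List.eq_nil_or_concat' _).resolve_left hu
    subst hs
    simp only [List.append_assoc, List.singleton_append, List.nil_append] at hl hR
    obtain ⟨z, -, -, hz⟩ := isWalk_append.1 hl
    exact absurd (List.isChain_cons_cons.1 hR.right_of_append).1 (h2 m γ α rfl hz.1.symm)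
  subst hs
  subst ht
  simp

/-- A pair without restrictions and extensions which is not exceptional is one of the pairs attached
to maximal paths and anti-paths. -/
theorem isolated_cases (hQ : Q.IsGentle) {x : PathWord V E × PathWord V E} (hx : Q.IsPair x)
    (hex : ¬ Q.Exceptional x) (h1 : Q.lam x = none) (h2 : Q.rho x = none)
    (h3 : ∀ y, Q.lam y ≠ some x) (h4 : ∀ y, Q.rho y ≠ some x) :
    (Q.IsMaximalAntiPath x.1 ∧ Q.IsOpposite x.1 x.2) ∨
      (Q.IsMaximalPath x.2 ∧ x.2.tgt = x.2.src ∧ x.1 = .trivial E x.2.src) := by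
  by_cases hn : x.1.arrows = []
  · right
    have e := hx.fst_eq_trivial hn
    have e1 : x.2.tgt = x.2.src := by rw [← hx.2.2.1, e]; rfl
    have hn2 : x.2.arrows ≠ [] := fun h => hex (hx.exceptional_of_nil hn h)
    refine ⟨⟨hx.2.1, hn2, fun p hp hi => eq_of_infix (Q := Q) hn2 hp.1 hp.2 hi ?_ ?_⟩, e1, e⟩
    · intro α γ m hm hs hr
      refine h3 _ (hx.lam_cons (α := α) ?_ (by simp [hn]) ?_)
      · rw [hx.2.2.1, hx.2.1.tgt_eq hm, hs]
      · rw [hm]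
        exact List.isChain_cons_cons.2 ⟨hr, hm ▸ hx.2.1.2⟩
    · intro m γ α hm hs hr
      refine h4 _ (hx.rho_snoc (α := α) ?_ (by simp [hn]) ?_)
      · rw [hx.2.2.2, hx.2.1.1.src_eq hm, hs]
      · rw [hm]
        exact isChain_snoc_snoc.2 ⟨hm ▸ hx.2.1.2, hr⟩
  · left
    refine ⟨⟨hx.1, hn, fun p hp hi => eq_of_infix (Q := Q) hn hp.1 hp.2 hi ?_ ?_⟩, hx.2.1,
      hx.2.2.1.symm, hx.2.2.2.symm, ?_, ?_⟩
    · intro α γ m hm hs hr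
      refine h3 _ (hx.lam_cons (α := α) ?_ ?_ ?_)
      · rw [hx.1.tgt_eq hm, hs]
      · rw [hm]
        exact List.isChain_cons_cons.2 ⟨hr, hm ▸ hx.1.2⟩
      · rcases hm' : x.2.arrows with _ | ⟨γ', m'⟩
        · simp
        -- If `α` also formed a relation with the first arrow of the path, gentleness would identify
        -- the first arrows of both words, and the pair would have a left face.
        · refine List.isChain_cons_cons.2 ⟨fun hr' => ?_, hm' ▸ hx.2.1.2⟩
          obtain rfl := hQ.rel_right _ _ _ hr hr'
          obtain ⟨z, hz⟩ := hx.exists_lam hm hm'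
          simp [hz] at h1
    · intro m γ α hm hs hr
      refine h4 _ (hx.rho_snoc (α := α) ?_ ?_ ?_)
      · rw [hx.1.1.src_eq hm, hs]
      · rw [hm]
        exact isChain_snoc_snoc.2 ⟨hm ▸ hx.1.2, hr⟩
      · rcases List.eq_nil_or_concat' x.2.arrows with hm' | ⟨m', γ', hm'⟩
        · simp [hm']
        · rw [hm']
          refine isChain_snoc_snoc.2 ⟨hm' ▸ hx.2.1.2, fun hr' => ?_⟩
          obtain rfl := hQ.rel_left _ _ _ hr hr'
          obtain ⟨z, hz⟩ := hx.exists_rho hm hm'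
          simp [hz] at h2
    · intro α h h'
      obtain ⟨m, hm⟩ := List.head?_eq_some_iff.1 h
      obtain ⟨m', hm'⟩ := List.head?_eq_some_iff.1 h'
      obtain ⟨z, hz⟩ := hx.exists_lam hm' hm
      simp [hz] at h1
    · intro α h h'
      obtain ⟨m, hm⟩ := List.getLast?_eq_some_iff.1 h
      obtain ⟨m', hm'⟩ := List.getLast?_eq_some_iff.1 h'
      obtain ⟨z, hz⟩ := hx.exists_rho hm' hm
      simp [hz] at h2

theorem exists_of_bardzellDiff_ne_zero {d : ℤ} {Z : PathWord V E × PathWord V E → k}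
    {x : PathWord V E × PathWord V E} (h : Q.bardzellDiff d Z x ≠ 0) :
    (∃ z, Q.lam x = some z ∧ Z z ≠ 0) ∨ ∃ z, Q.rho x = some z ∧ Z z ≠ 0 := by
  by_contra! H
  refine h ?_
  have h1 : (Q.lam x).elim 0 Z = 0 := by
    rcases hl : Q.lam x with _ | z
    · rfl
    · exact H.1 z hl
  have h2 : (Q.rho x).elim 0 Z = 0 := by
    rcases hr : Q.rho x with _ | z
    · rfl
    · exact H.2 z hr
  rw [bardzellDiff, h1, h2, mul_zero, mul_zero, add_zero]

/-! ### Rotation of closed words -/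

theorem arrows_rot (p : PathWord V E) : (Q.rot p).arrows = p.arrows.rotate 1 := by
  obtain ⟨a, b, l⟩ := p
  cases l <;> simp [rot]

theorem arrows_rot_iterate (p : PathWord V E) (i : ℕ) :
    (Q.rot^[i] p).arrows = p.arrows.rotate i := by
  induction i with
  | zero => simp
  | succ i ih => rw [Function.iterate_succ_apply', arrows_rot, ih, List.rotate_rotate]

theorem length_rot_iterate (p : PathWord V E) (i : ℕ) :
    (Q.rot^[i] p).arrows.length = p.arrows.length := by
  rw [arrows_rot_iterate, List.length_rotate]

variable (Q) in
/-- The degree of the first arrow of a word. -/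
def headDeg (p : PathWord V E) : ℤ := (p.arrows.head?.map Q.deg).getD 0

/-- As a sum over rotations the partial degree makes sense for every number of steps, and it can be
continued over several periods. -/
theorem wordDeg_take (p : PathWord V E) {i : ℕ} (hi : i ≤ p.arrows.length) :
    Q.wordDeg (p.arrows.take i) = ∑ j ∈ Finset.range i, Q.headDeg (Q.rot^[j] p) := by
  induction i with
  | zero => simp [wordDeg]
  | succ i ih =>
    rw [Finset.sum_range_succ, ← ih (by omega), List.take_succ_eq_append_getElem (by omega),
      headDeg, arrows_rot_iterate, List.head?_rotate (by omega)]
    rw [List.getElem?_eq_getElem (by omega)]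
    simp only [wordDeg, List.map_append, List.sum_append, List.map_cons, List.map_nil,
      List.sum_singleton, Option.map_some, Option.getD_some]

/-- A closed path of `Q` of positive length. -/
structure IsClosedWord (Q : QuadraticQuiver V E) (p : PathWord V E) : Prop where
  isPath : Q.IsPath p
  closed : p.tgt = p.src
  ne_nil : p.arrows ≠ []

theorem IsClosedWord.rot {p : PathWord V E} (hp : Q.IsClosedWord p) : Q.IsClosedWord (Q.rot p) := by
  obtain ⟨a, b, l⟩ := p
  obtain ⟨h1, h2, h3⟩ := hp
  cases l with
  | nil => exact absurd rfl h3
  | cons α l =>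
    obtain rfl : a = b := h2
    exact ⟨isPath_snoc.2 ⟨h1.1.symm ▸ h1.2, rfl⟩, rfl, by simp [QuadraticQuiver.rot]⟩

theorem IsClosedWord.rot_iterate {p : PathWord V E} (hp : Q.IsClosedWord p) (i : ℕ) :
    Q.IsClosedWord (Q.rot^[i] p) := by
  induction i with
  | zero => exact hp
  | succ i ih => rw [Function.iterate_succ_apply']; exact ih.rot

theorem IsClosedWord.isPeriodicPt {p : PathWord V E} (hp : Q.IsClosedWord p) :
    Function.IsPeriodicPt Q.rot p.arrows.length p := by
  refine (hp.rot_iterate _).isPath.ext hp.isPath ?_ (hp.rot_iterate _).ne_nil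
  rw [arrows_rot_iterate, List.rotate_length]

theorem IsClosedWord.length_pos {p : PathWord V E} (hp : Q.IsClosedWord p) :
    0 < p.arrows.length := List.length_pos_of_ne_nil hp.ne_nil

theorem IsClosedWord.period_pos {p : PathWord V E} (hp : Q.IsClosedWord p) : 0 < Q.period p :=
  hp.isPeriodicPt.minimalPeriod_pos hp.length_pos

theorem rot_period (p : PathWord V E) : Q.rot^[Q.period p] p = p :=
  Function.isPeriodicPt_minimalPeriod Q.rot p

theorem IsClosedWord.period_le {p : PathWord V E} (hp : Q.IsClosedWord p) :
    Q.period p ≤ p.arrows.length := hp.isPeriodicPt.minimalPeriod_le hp.length_pos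

/-- The length and the degree of a closed word are multiples, by the same factor, of its period and
the degree of its primitive root. -/
theorem IsClosedWord.exists_mul {p : PathWord V E} (hp : Q.IsClosedWord p) :
    ∃ m : ℕ, p.arrows.length = m * Q.period p ∧
      Q.pathDeg p = m * Q.wordDeg (p.arrows.take (Q.period p)) := by
  obtain ⟨m, hm⟩ := hp.isPeriodicPt.minimalPeriod_dvd
  refine ⟨m, by rw [hm, mul_comm, period], ?_⟩
  have h : ∀ j : ℕ, ∑ i ∈ Finset.range (j * Q.period p), Q.headDeg (Q.rot^[i] p) =
      j * ∑ i ∈ Finset.range (Q.period p), Q.headDeg (Q.rot^[i] p) := by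
    intro j
    induction j with
    | zero => simp
    | succ j ih =>
      rw [Nat.succ_mul, Finset.sum_range_add, ih]
      have : ∀ i, Q.rot^[j * Q.period p + i] p = Q.rot^[i] p := by
        intro i
        rw [add_comm, Function.iterate_add_apply]
        congr 1
        rw [mul_comm]
        exact (Function.isPeriodicPt_minimalPeriod Q.rot p).mul_const j
      simp only [this]
      push_cast
      ring
  have h' := wordDeg_take (Q := Q) p le_rfl
  rw [List.take_length] at h'
  rw [pathDeg, h', wordDeg_take p hp.period_le, ← h, hm, mul_comm, period]

/-! ### Cycles of pairs attached to closed words -/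

/-- A family of pairs attached to a class of closed words stable under rotation. The restrictions
of `W p` are `J p` and the pair attached to the previous rotation. The anti-path in `W p` has
length `N n + 1` if `p` has length `n`. -/
structure IsCycleSystem (Q : QuadraticQuiver V E) (C : PathWord V E → Prop)
    (J W : PathWord V E → PathWord V E × PathWord V E) (N : ℕ → ℕ) : Prop where
  closed {p} : C p → Q.IsClosedWord p
  rot {p} : C p → C (Q.rot p)
  lam {p} : C p → Q.lam (W p) = some (J p)
  rho {p} : C p → Q.rho (W (Q.rot p)) = some (J p)
  inj : Function.Injective J
  ne_nil {p} : C p → (J p).1.arrows ≠ [] ∨ (J p).2.arrows ≠ []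
  head {p} : C p → (W (Q.rot p)).1.arrows.head? = p.arrows.head?
  length {p} : C p → (J p).1.arrows.length = N p.arrows.length

namespace IsCycleSystem

variable {C : PathWord V E → Prop} {J W : PathWord V E → PathWord V E × PathWord V E} {N : ℕ → ℕ}

variable (k) in
/-- The signs of the pairs in the cycle of a closed word, as elements of `k`. -/
def sign (Q : QuadraticQuiver V E) (d n : ℤ) (p : PathWord V E) (i : ℕ) : k :=
  sgn k (i * n + d * ∑ j ∈ Finset.range i, Q.headDeg (Q.rot^[j] p))

theorem rot_iterate (hC : Q.IsCycleSystem C J W N) {p : PathWord V E} (hp : C p) (i : ℕ) :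
    C (Q.rot^[i] p) := by
  induction i with
  | zero => exact hp
  | succ i ih => rw [Function.iterate_succ_apply']; exact hC.rot ih

/-- Uniqueness of extensions shows that the pairs `W` are the only ones attached to the pairs `J`,
so the cycle is a separate piece of the complex. -/
theorem lam_iff (hC : Q.IsCycleSystem C J W N) (hQ : Q.IsGentle) {p : PathWord V E} (hp : C p)
    {y : PathWord V E × PathWord V E} : Q.lam y = some (J p) ↔ y = W p :=
  ⟨fun h => lam_inj hQ h (hC.lam hp) (hC.ne_nil hp), fun h => h ▸ hC.lam hp⟩

theorem rho_iff (hC : Q.IsCycleSystem C J W N) (hQ : Q.IsGentle) {p : PathWord V E} (hp : C p)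
    {y : PathWord V E × PathWord V E} : Q.rho y = some (J p) ↔ y = W (Q.rot p) :=
  ⟨fun h => rho_inj hQ h (hC.rho hp) (hC.ne_nil hp), fun h => h ▸ hC.rho hp⟩

theorem aSign_eq (hC : Q.IsCycleSystem C J W N) (d : ℤ) {p : PathWord V E} (hp : C p) :
    aSign k Q d (W (Q.rot p)) = sgn k (d * Q.headDeg p) := by
  have h := hC.head hp
  obtain ⟨α, m, hm⟩ := List.exists_cons_of_ne_nil (hC.closed hp).ne_nil
  rw [hm, List.head?_cons, List.head?_eq_some_iff] at h
  obtain ⟨m', hm'⟩ := h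
  simp [aSign, hm', headDeg, hm]

theorem bSign_eq (hC : Q.IsCycleSystem C J W N) {p : PathWord V E} (hp : C p) :
    bSign k (W p) = - sgn k (N p.arrows.length) := by
  obtain ⟨-, α, h, -⟩ := lam_eq_some_iff.1 (hC.lam hp)
  rw [bSign, h, sgn_natCast, ← hC.length hp]
  simp [consPair, pow_succ]

theorem sign_zero (d n : ℤ) (p : PathWord V E) : sign k Q d n p 0 = 1 := by
  simp [sign, sgn_zero]

theorem sign_ne_zero (d n : ℤ) (p : PathWord V E) (i : ℕ) : sign k Q d n p i ≠ 0 := sgn_ne_zero _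

theorem sign_succ (d n : ℤ) (p : PathWord V E) (i : ℕ) : sign k Q d n p (i + 1) =
    sign k Q d n p i * (sgn k n * sgn k (d * Q.headDeg (Q.rot^[i] p))) := by
  simp only [sign, ← sgn_add, Finset.sum_range_succ]
  congr 1
  push_cast
  ring

/-- The signs are the unique solution, starting with 1, of the cocycle condition along the
consecutive pairs of the cycle. The minus sign in `bSign_eq` comes from the anti-path in `W` having
one arrow more than that in `J`. -/
theorem sign_rel (hC : Q.IsCycleSystem C J W N) (d : ℤ) {p : PathWord V E} (hp : C p) (i : ℕ) :
    aSign k Q d (W (Q.rot^[i + 1] p)) * sign k Q d (N p.arrows.length) p (i + 1) +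
      bSign k (W (Q.rot^[i + 1] p)) * sign k Q d (N p.arrows.length) p i = 0 := by
  rw [hC.bSign_eq (hC.rot_iterate hp _), Function.iterate_succ_apply',
    hC.aSign_eq d (hC.rot_iterate hp _), ← Function.iterate_succ_apply' Q.rot,
    length_rot_iterate, sign_succ]
  have := sgn_mul_self (k := k) (d * Q.headDeg (Q.rot^[i] p))
  linear_combination sign k Q d (N p.arrows.length) p i * sgn k (N p.arrows.length) * this

theorem bardzellDiff_W (hC : Q.IsCycleSystem C J W N) (d : ℤ) {p : PathWord V E} (hp : C p)
    (Z : PathWord V E × PathWord V E → k) (i : ℕ) :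
    Q.bardzellDiff d Z (W (Q.rot^[i + 1] p)) =
      aSign k Q d (W (Q.rot^[i + 1] p)) * Z (J (Q.rot^[i + 1] p)) +
        bSign k (W (Q.rot^[i + 1] p)) * Z (J (Q.rot^[i] p)) := by
  rw [bardzellDiff, hC.lam (hC.rot_iterate hp _), Function.iterate_succ_apply',
    hC.rho (hC.rot_iterate hp _)]
  rfl

theorem aSign_mul_self (d : ℤ) (x : PathWord V E × PathWord V E) :
    aSign k Q d x * aSign k Q d x = 1 := by
  unfold aSign
  split
  · simp
  · exact sgn_mul_self _

/-- Following the cycle, a cocycle is determined by its value at `J p`; over a whole period this is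
the monodromy of the cycle. -/
theorem eq_sign_mul (hC : Q.IsCycleSystem C J W N) {d : ℤ} {p : PathWord V E} (hp : C p)
    {Z : PathWord V E × PathWord V E → k} {m : ℕ}
    (hZ : ∀ i < m, Q.bardzellDiff d Z (W (Q.rot^[i + 1] p)) = 0) :
    Z (J (Q.rot^[m] p)) = sign k Q d (N p.arrows.length) p m * Z (J p) := by
  induction m with
  | zero => simp [sign_zero]
  | succ m ih =>
    have h1 := hZ m (by omega)
    rw [hC.bardzellDiff_W d hp, ih fun i hi => hZ i (by omega)] at h1
    have h2 := hC.sign_rel (k := k) d hp m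
    have h3 := aSign_mul_self (k := k) (Q := Q) d (W (Q.rot^[m + 1] p))
    linear_combination aSign k Q d (W (Q.rot^[m + 1] p)) * (h1 - Z (J p) * h2) -
      (Z (J (Q.rot^[m + 1] p)) - sign k Q d (N p.arrows.length) p (m + 1) * Z (J p)) * h3

/-- The signed sum of the pairs `J (rot^i p)` over a period. -/
def cycleSum (Q : QuadraticQuiver V E) (J : PathWord V E → PathWord V E × PathWord V E)
    (c : ℕ → k) (p : PathWord V E) : PairChain V E k :=
  ∑ i ∈ Finset.range (Q.period p), Finsupp.single (J (Q.rot^[i] p)) (c i)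

theorem cycleSum_of_lt (hC : Q.IsCycleSystem C J W N) (c : ℕ → k) (p : PathWord V E)
    {i : ℕ} (hi : i < Q.period p) : cycleSum Q J c p (J (Q.rot^[i] p)) = c i := by
  rw [cycleSum, Finsupp.finsetSum_apply, Finset.sum_eq_single_of_mem i (by simpa using hi)]
  · simp
  · intro j hj hne
    refine Finsupp.single_eq_of_ne' fun h => hne ?_
    exact Function.iterate_injOn_Iio_minimalPeriod (by simpa [period] using hj)
      (by simpa [period] using hi) (hC.inj h)

theorem exists_of_cycleSum_ne_zero {c : ℕ → k} {p : PathWord V E}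
    {x : PathWord V E × PathWord V E} (h : cycleSum Q J c p x ≠ 0) :
    ∃ i < Q.period p, x = J (Q.rot^[i] p) := by
  rw [cycleSum, Finsupp.finsetSum_apply] at h
  obtain ⟨i, hi, h⟩ := Finset.exists_ne_zero_of_sum_ne_zero h
  refine ⟨i, by simpa using hi, ?_⟩
  by_contra hne
  exact h (Finsupp.single_eq_of_ne hne)

theorem bardzellDiff_cycleSum (hC : Q.IsCycleSystem C J W N) (hQ : Q.IsGentle) {d : ℤ}
    {p : PathWord V E} (hp : C p)
    (hper : sign k Q d (N p.arrows.length) p (Q.period p) = 1) :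
    Q.bardzellDiff d (cycleSum Q J (sign k Q d (N p.arrows.length) p) p) = 0 := by
  set c := sign k Q d (N p.arrows.length) p with hc
  have hval : ∀ i ≤ Q.period p, cycleSum Q J c p (J (Q.rot^[i] p)) = c i := by
    intro i hi
    rcases hi.lt_or_eq with hi | rfl
    · exact hC.cycleSum_of_lt c p hi
    -- At `i` equal to the period the pair is `J p` again, whose coefficient is 1; the hypothesis on
    -- the monodromy makes `c` agree.
    · have := hC.cycleSum_of_lt c p (hC.closed hp).period_pos
      rw [rot_period, hper, ← this.trans (sign_zero _ _ _)]
      rfl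
  have hW : ∀ i < Q.period p, Q.bardzellDiff d (cycleSum Q J c p) (W (Q.rot^[i + 1] p)) = 0 := by
    intro i hi
    rw [hC.bardzellDiff_W d hp, hval _ hi, hval _ hi.le]
    exact hC.sign_rel d hp i
  funext y
  by_contra hy
  rcases exists_of_bardzellDiff_ne_zero hy with ⟨z, hl, h⟩ | ⟨z, hr, h⟩
  · obtain ⟨i, hi, rfl⟩ := exists_of_cycleSum_ne_zero h
    -- Only the pairs `W (rot^(j+1) p)` are treated by `hW`, so the index 0 is replaced by the
    -- period.
    obtain ⟨j, hj, hij⟩ : ∃ j < Q.period p, Q.rot^[i] p = Q.rot^[j + 1] p := by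
      rcases i with _ | i
      · exact ⟨Q.period p - 1, by omega, by
          rw [Nat.sub_add_cancel (by omega), rot_period]; rfl⟩
      · exact ⟨i, by omega, rfl⟩
    rw [hij, hC.lam_iff hQ (hC.rot_iterate hp _)] at hl
    exact hy (hl ▸ hW j hj)
  · obtain ⟨i, hi, rfl⟩ := exists_of_cycleSum_ne_zero h
    rw [(hC.rho_iff hQ (hC.rot_iterate hp i)), ← Function.iterate_succ_apply' Q.rot] at hr
    exact hy (hr ▸ hW i hi)

end IsCycleSystem

/-! ### The cycle systems of complete anti-paths and of complete paths -/

/-- The pair `(αₙ p, αₙ)` attached to a word `p = α₁ ⋯ αₙ`. -/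
def antiLoop (Q : QuadraticQuiver V E) (p : PathWord V E) : PathWord V E × PathWord V E :=
  match p.arrows.getLast? with
  | some α => (⟨Q.t α, p.src, α :: p.arrows⟩, Q.arrowPath α)
  | none => (p, p)

/-- The pair `(βₙ, βₙ q)` attached to a word `q = β₁ ⋯ βₙ`. -/
def pathLoop (Q : QuadraticQuiver V E) (q : PathWord V E) : PathWord V E × PathWord V E :=
  match q.arrows.getLast? with
  | some β => (Q.arrowPath β, ⟨Q.t β, q.src, β :: q.arrows⟩)
  | none => (q, q)

theorem IsCompleteAntiPath.isClosedWord {p : PathWord V E} (hp : Q.IsCompleteAntiPath p) :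
    Q.IsClosedWord p := by
  obtain ⟨h1, h2, α, β, h3, -, -⟩ := hp
  exact ⟨h1.1, h2, by rintro h; simp [h] at h3⟩

theorem IsCompletePath.isClosedWord {p : PathWord V E} (hp : Q.IsCompletePath p) :
    Q.IsClosedWord p := by
  obtain ⟨h1, h2, α, β, h3, -, -⟩ := hp
  exact ⟨h1.1, h2, by rintro h; simp [h] at h3⟩

/-- A closed word all of whose cyclically consecutive arrows are related. -/
theorem isChain_rotate {R : E → E → Prop} {α β : E} {m : List E}
    (h : (α :: m).IsChain R) (hl : (α :: m).getLast? = some β) (hr : R β α) :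
    (m ++ [α]).IsChain R ∧ ∃ γ, (m ++ [α]).head? = some γ ∧ R α γ := by
  cases m with
  | nil =>
    obtain rfl : α = β := by simpa using hl
    exact ⟨by simp, α, rfl, hr⟩
  | cons γ m =>
    have h' := List.isChain_cons_cons.1 h
    refine ⟨?_, γ, rfl, h'.1⟩
    rw [List.isChain_append]
    refine ⟨h'.2, by simp, ?_⟩
    intro x hx y hy
    rw [List.getLast?_cons_cons, Option.mem_def.1 hx] at hl
    obtain rfl : α = y := by simpa using hy
    obtain rfl : x = β := by simpa using hl
    exact hr

theorem IsCompleteAntiPath.rot {p : PathWord V E} (hp : Q.IsCompleteAntiPath p) :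
    Q.IsCompleteAntiPath (Q.rot p) := by
  have hc := hp.isClosedWord.rot
  obtain ⟨h1, h2, α, β, h3, h4, h5⟩ := hp
  obtain ⟨a, b, l⟩ := p
  obtain ⟨m, rfl⟩ := List.head?_eq_some_iff.1 h3
  obtain ⟨h6, γ, h7, h8⟩ := isChain_rotate h1.2 h4 h5
  exact ⟨⟨hc.isPath, h6⟩, hc.closed, γ, α, h7, by simp [QuadraticQuiver.rot], h8⟩

theorem IsCompletePath.rot {p : PathWord V E} (hp : Q.IsCompletePath p) :
    Q.IsCompletePath (Q.rot p) := by
  have hc := hp.isClosedWord.rot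
  obtain ⟨h1, h2, α, β, h3, h4, h5⟩ := hp
  obtain ⟨a, b, l⟩ := p
  obtain ⟨m, rfl⟩ := List.head?_eq_some_iff.1 h3
  obtain ⟨h6, γ, h7, h8⟩ := isChain_rotate (R := fun β α => ¬ Q.rel β α) h1.2 h4 h5
  exact ⟨⟨hc.isPath, h6⟩, hc.closed, γ, α, h7, by simp [QuadraticQuiver.rot], h8⟩

theorem IsCompleteAntiPath.isPair {p : PathWord V E} (hp : Q.IsCompleteAntiPath p) :
    Q.IsPair (p, .trivial E p.src) :=
  ⟨hp.1, isPathOfA_trivial _, hp.2.1, rfl⟩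

theorem IsCompletePath.isPair {p : PathWord V E} (hp : Q.IsCompletePath p) :
    Q.IsPair (.trivial E p.src, p) :=
  ⟨⟨rfl, by simp [PathWord.trivial]⟩, hp.1, hp.2.1.symm, rfl⟩

/-- For p = α₁ ⋯ αₙ the pair (αₙ p, αₙ) is also (p' αₙ, αₙ), where p' is the rotation αₙ α₁ ⋯ αₙ₋₁.
Removing the first or the last arrow leaves a neighbouring rotation paired with a trivial path. -/
theorem isCycleSystem_anti : Q.IsCycleSystem Q.IsCompleteAntiPath
    (fun p => (p, .trivial E p.src)) Q.antiLoop id where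
  closed := IsCompleteAntiPath.isClosedWord
  rot := IsCompleteAntiPath.rot
  lam {p} hp := by
    have hpair := hp.isPair
    obtain ⟨h1, h2, α, β, h3, h4, h5⟩ := hp
    have hs : Q.s β = p.src := by
      obtain ⟨m, hm⟩ := List.getLast?_eq_some_iff.1 h4
      exact (h1.1.src_eq hm).symm
    have e : Q.antiLoop p = Q.consPair β (p, .trivial E p.src) := by
      simp [antiLoop, h4, consPair, arrowPath, PathWord.trivial, hs]
    rw [e]
    refine hpair.lam_cons (h2.trans hs.symm) ?_ (by simp [PathWord.trivial])
    obtain ⟨m, hm⟩ := List.head?_eq_some_iff.1 h3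
    simp only [hm]
    exact List.isChain_cons_cons.2 ⟨h5, hm ▸ h1.2⟩
  rho {p} hp := by
    have hpair := hp.isPair
    obtain ⟨h1, h2, α, β, h3, h4, h5⟩ := hp
    have ht : p.src = Q.t α := by
      obtain ⟨m, hm⟩ := List.head?_eq_some_iff.1 h3
      exact h2.symm.trans (h1.tgt_eq hm)
    have e : Q.antiLoop (Q.rot p) = Q.snocPair (p, .trivial E p.src) α := by
      obtain ⟨m, hm⟩ := List.head?_eq_some_iff.1 h3
      simp [antiLoop, QuadraticQuiver.rot, hm, snocPair, arrowPath, PathWord.trivial, ht,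
        h2.trans ht]
    rw [e]
    refine hpair.rho_snoc ht ?_ (by simp [PathWord.trivial])
    obtain ⟨m, hm⟩ := List.getLast?_eq_some_iff.1 h4
    simp only [hm]
    exact isChain_snoc_snoc.2 ⟨hm ▸ h1.2, h5⟩
  inj p p' h := congrArg Prod.fst h
  ne_nil hp := Or.inl hp.isClosedWord.ne_nil
  head {p} hp := by
    obtain ⟨h1, h2, α, β, h3, h4, h5⟩ := hp
    obtain ⟨m, hm⟩ := List.head?_eq_some_iff.1 h3
    simp [antiLoop, QuadraticQuiver.rot, hm]
  length _ := rfl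

theorem isCycleSystem_path : Q.IsCycleSystem Q.IsCompletePath
    (fun p => (.trivial E p.src, p)) Q.pathLoop fun _ => 0 where
  closed := IsCompletePath.isClosedWord
  rot := IsCompletePath.rot
  lam {p} hp := by
    have hpair := hp.isPair
    obtain ⟨h1, h2, α, β, h3, h4, h5⟩ := hp
    have hs : Q.s β = p.src := by
      obtain ⟨m, hm⟩ := List.getLast?_eq_some_iff.1 h4
      exact (h1.1.src_eq hm).symm
    have e : Q.pathLoop p = Q.consPair β (.trivial E p.src, p) := by
      simp [pathLoop, h4, consPair, arrowPath, PathWord.trivial, hs]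
    rw [e]
    refine hpair.lam_cons hs.symm (by simp [PathWord.trivial]) ?_
    obtain ⟨m, hm⟩ := List.head?_eq_some_iff.1 h3
    simp only [hm]
    exact List.isChain_cons_cons.2 ⟨h5, hm ▸ h1.2⟩
  rho {p} hp := by
    have hpair := hp.isPair
    obtain ⟨h1, h2, α, β, h3, h4, h5⟩ := hp
    have ht : p.src = Q.t α := by
      obtain ⟨m, hm⟩ := List.head?_eq_some_iff.1 h3
      exact h2.symm.trans (h1.tgt_eq hm)
    have e : Q.pathLoop (Q.rot p) = Q.snocPair (.trivial E p.src, p) α := by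
      obtain ⟨m, hm⟩ := List.head?_eq_some_iff.1 h3
      simp [pathLoop, QuadraticQuiver.rot, hm, snocPair, arrowPath, PathWord.trivial, ht,
        h2.trans ht]
    rw [e]
    refine hpair.rho_snoc ht (by simp [PathWord.trivial]) ?_
    obtain ⟨m, hm⟩ := List.getLast?_eq_some_iff.1 h4
    simp only [hm]
    exact isChain_snoc_snoc.2 ⟨hm ▸ h1.2, h5⟩
  inj p p' h := congrArg Prod.snd h
  ne_nil hp := Or.inr hp.isClosedWord.ne_nil
  head {p} hp := by
    obtain ⟨h1, h2, α, β, h3, h4, h5⟩ := hp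
    obtain ⟨m, hm⟩ := List.head?_eq_some_iff.1 h3
    simp [pathLoop, QuadraticQuiver.rot, hm, arrowPath]
  length _ := rfl

theorem sgn_congr {m n : ℤ} (h : Even (m - n)) : sgn k m = sgn k n := by
  rw [sgn, sgn, ← sub_add_cancel m n, Int.negOnePow_add, Int.negOnePow_even _ h, one_mul]

/-- The cycle signs use the internal degree -|p|, while the formula for N⁰ uses |p|; the exponents
differ by an even number. -/
theorem antiN0_eq {p : PathWord V E} (hp : Q.IsCompleteAntiPath p) :
    Q.antiN0 k p = IsCycleSystem.cycleSum Q (fun p => (p, .trivial E p.src))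
      (IsCycleSystem.sign k Q (-Q.pathDeg p) p.arrows.length p) p := by
  refine Finset.sum_congr rfl fun i hi => ?_
  have hi' : i ≤ p.arrows.length :=
    (Finset.mem_range.1 hi).le.trans hp.isClosedWord.period_le
  congr 1
  rw [wordDeg_take p hi', IsCycleSystem.sign]
  refine sgn_congr (k := k) ⟨Q.pathDeg p * ∑ j ∈ Finset.range i, Q.headDeg (Q.rot^[j] p), ?_⟩
  rw [PathWord.length]
  ring

theorem pathN0_eq {p : PathWord V E} (hp : Q.IsCompletePath p) :
    Q.pathN0 k p = IsCycleSystem.cycleSum Q (fun p => (.trivial E p.src, p))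
      (IsCycleSystem.sign k Q (Q.pathDeg p) 0 p) p := by
  refine Finset.sum_congr rfl fun i hi => ?_
  have hi' : i ≤ p.arrows.length :=
    (Finset.mem_range.1 hi).le.trans hp.isClosedWord.period_le
  congr 1
  rw [wordDeg_take p hi', IsCycleSystem.sign]
  refine sgn_congr (k := k) ⟨0, ?_⟩
  ring

/-- Let r be the period, S the degree of the primitive root and m the exponent, so that the length
is mr and |p| is mS. The monodromy exponent is mr² - mS², and it agrees with mS - mr modulo 2
because a number and its square have the same parity. -/
theorem sign_anti {p : PathWord V E} (hp : Q.IsCompleteAntiPath p) :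
    IsCycleSystem.sign k Q (-Q.pathDeg p) p.arrows.length p (Q.period p) =
      sgn k (Q.antiWinding p) := by
  obtain ⟨m, h1, h2⟩ := hp.isClosedWord.exists_mul
  rw [IsCycleSystem.sign, ← wordDeg_take p hp.isClosedWord.period_le]
  refine sgn_congr ?_
  rw [antiWinding, PathWord.length, h2, h1]
  generalize Q.wordDeg _ = S
  generalize Q.period p = r
  have e1 := Int.even_mul_succ_self (r : ℤ)
  have e2 := Int.even_mul_succ_self S
  have := (e1.mul_left (m : ℤ)).sub (e2.mul_left (m : ℤ))
  have e3 : (r : ℤ) * ((m * r : ℕ) : ℤ) + -(m * S) * S - (m * S - ((m * r : ℕ) : ℤ)) =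
      m * (r * (r + 1)) - m * (S * (S + 1)) := by
    push_cast
    ring
  rwa [e3]

theorem sign_path {p : PathWord V E} (hp : Q.IsCompletePath p) :
    IsCycleSystem.sign k Q (Q.pathDeg p) 0 p (Q.period p) = sgn k (Q.pathWinding p) := by
  obtain ⟨m, h1, h2⟩ := hp.isClosedWord.exists_mul
  rw [IsCycleSystem.sign, ← wordDeg_take p hp.isClosedWord.period_le]
  refine sgn_congr ?_
  rw [pathWinding, h2]
  generalize Q.wordDeg _ = S
  have e2 := (Int.even_mul_succ_self S).mul_left (m : ℤ)
  have : (Q.period p : ℤ) * 0 + m * S * S - -(m * S) = m * (S * (S + 1)) := by ring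
  rwa [this]

theorem antiN1_eq {p : PathWord V E} (hp : p.arrows ≠ []) :
    Q.antiN1 k p = Finsupp.single (Q.antiLoop p) 1 := by
  obtain ⟨m, α, h⟩ := (List.eq_nil_or_concat' _).resolve_left hp
  simp [antiN1, antiLoop, h]

theorem pathN1_eq {p : PathWord V E} (hp : p.arrows ≠ []) :
    Q.pathN1 k p = Finsupp.single (Q.pathLoop p) 1 := by
  obtain ⟨m, α, h⟩ := (List.eq_nil_or_concat' _).resolve_left hp
  simp [pathN1, pathLoop, h]

/-! ### The representing chains are cocycles -/

variable (Q) in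
/-- The pairs of an anti-path of length `n` and a path of `A` whose degrees differ by `d`. -/
def IsPairOf (n : ℕ) (d : ℤ) (x : PathWord V E × PathWord V E) : Prop :=
  Q.IsPair x ∧ x.1.arrows.length = n ∧ Q.pathDeg x.2 - Q.pathDeg x.1 = d

theorem isPairOf_of_lam {n : ℕ} {d : ℤ} {x y : PathWord V E × PathWord V E}
    (h : Q.lam x = some y) : Q.IsPairOf (n + 1) d x ↔ Q.IsPairOf n d y := by
  have hy := isPair_of_lam h
  obtain ⟨hx, α, rfl, -⟩ := lam_eq_some_iff.1 h
  simp only [IsPairOf, hx, hy, true_and]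
  simp [consPair, pathDeg, wordDeg]

theorem isPairOf_of_rho {n : ℕ} {d : ℤ} {x y : PathWord V E × PathWord V E}
    (h : Q.rho x = some y) : Q.IsPairOf (n + 1) d x ↔ Q.IsPairOf n d y := by
  have hy := isPair_of_rho h
  obtain ⟨hx, α, rfl, -⟩ := rho_eq_some_iff.1 h
  simp only [IsPairOf, hx, hy, true_and]
  simp [snocPair, pathDeg, wordDeg]

theorem exists_isPairOf_of_lam {n : ℕ} {d : ℤ} {x y : PathWord V E × PathWord V E}
    (h : Q.lam x = some y) (hx : Q.IsPairOf n d x) : ∃ m, n = m + 1 ∧ Q.IsPairOf m d y := by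
  have h' := lam_eq_some_iff.1 h
  obtain ⟨-, α, h', -⟩ := h'
  have h1 := hx.2.1
  simp only [h', consPair, List.length_cons] at h1
  subst h1
  exact ⟨_, rfl, (isPairOf_of_lam h).1 hx⟩

theorem exists_isPairOf_of_rho {n : ℕ} {d : ℤ} {x y : PathWord V E × PathWord V E}
    (h : Q.rho x = some y) (hx : Q.IsPairOf n d x) : ∃ m, n = m + 1 ∧ Q.IsPairOf m d y := by
  have h' := rho_eq_some_iff.1 h
  obtain ⟨-, α, h', -⟩ := h'
  have h1 := hx.2.1
  simp only [h', snocPair, List.length_append, List.length_singleton] at h1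
  subst h1
  exact ⟨_, rfl, (isPairOf_of_rho h).1 hx⟩

theorem isChainOf_single {n : ℕ} {d : ℤ} {x : PathWord V E × PathWord V E}
    (hx : Q.IsPairOf n d x) (c : k) : Q.IsChainOf n d (Finsupp.single x c) := by
  intro y hy
  obtain rfl := Finset.mem_singleton.1 (Finsupp.support_single_subset hy)
  exact hx

variable (Q k) in
/-- The Bardzell differential as a linear map. -/
def bardzellLin (d : ℤ) :
    (PathWord V E × PathWord V E → k) →ₗ[k] (PathWord V E × PathWord V E → k) where
  toFun := Q.bardzellDiff d
  map_add' Z Z' := by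
    funext x
    rcases hl : Q.lam x with _ | z <;> rcases hr : Q.rho x with _ | z' <;>
      simp [bardzellDiff, hl, hr] <;> ring
  map_smul' c Z := by
    funext x
    rcases hl : Q.lam x with _ | z <;> rcases hr : Q.rho x with _ | z' <;>
      simp [bardzellDiff, hl, hr] <;> ring

theorem bardzellDiff_single_eq_zero {d : ℤ} {x : PathWord V E × PathWord V E} {c : k}
    (h1 : ∀ y, Q.lam y ≠ some x) (h2 : ∀ y, Q.rho y ≠ some x) :
    Q.bardzellDiff d (Finsupp.single x c) = 0 := by
  funext y
  by_contra hy
  rcases exists_of_bardzellDiff_ne_zero hy with ⟨z, hl, h⟩ | ⟨z, hr, h⟩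
  · obtain rfl : z = x := by
      by_contra hne
      exact h (Finsupp.single_eq_of_ne hne)
    exact h1 _ hl
  · obtain rfl : z = x := by
      by_contra hne
      exact h (Finsupp.single_eq_of_ne hne)
    exact h2 _ hr

/-- A pair with a left and a right face is not a face of anything, by `lam_lam` and `rho_rho`. This
is why the N¹ elements and the pairs of arrows are cocycles irrespective of signs. -/
theorem bardzellDiff_single_of_restr {d : ℤ} {x y z : PathWord V E × PathWord V E} {c : k}
    (h1 : Q.lam x = some y) (h2 : Q.rho x = some z) :
    Q.bardzellDiff d (Finsupp.single x c) = 0 :=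
  bardzellDiff_single_eq_zero (fun _ h => lam_lam h h1) fun _ h => rho_rho h h2

/-! ### The complex of vertices and arrows -/

variable (V E) in
/-- The pair of trivial paths at a vertex. -/
def vertexPair (v : V) : PathWord V E × PathWord V E := (.trivial E v, .trivial E v)

variable (Q) in
/-- The pair of an arrow with itself. -/
def arrowPair (α : E) : PathWord V E × PathWord V E := (Q.arrowPath α, Q.arrowPath α)

theorem isPair_arrowPair (α : E) : Q.IsPair (Q.arrowPair α) :=
  ⟨⟨⟨rfl, rfl⟩, by simp [arrowPair, arrowPath]⟩, isPathOfA_arrowPath α, rfl, rfl⟩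

theorem isPair_vertexPair (v : V) : Q.IsPair (vertexPair V E v) :=
  ⟨⟨rfl, by simp [vertexPair, PathWord.trivial]⟩, isPathOfA_trivial v, rfl, rfl⟩

theorem lam_arrowPair (α : E) : Q.lam (Q.arrowPair α) = some (vertexPair V E (Q.s α)) :=
  lam_consPair (y := vertexPair V E (Q.s α)) (isPair_arrowPair α) rfl rfl

theorem rho_arrowPair (α : E) : Q.rho (Q.arrowPair α) = some (vertexPair V E (Q.t α)) :=
  rho_snocPair (y := vertexPair V E (Q.t α)) (isPair_arrowPair α) rfl rfl

theorem eq_arrowPair_of_lam {x : PathWord V E × PathWord V E} {v : V}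
    (h : Q.lam x = some (vertexPair V E v)) : ∃ α, Q.s α = v ∧ x = Q.arrowPair α := by
  obtain ⟨-, α, rfl, h1, h2⟩ := lam_eq_some_iff.1 h
  obtain rfl : v = Q.s α := h1
  exact ⟨α, rfl, rfl⟩

theorem eq_arrowPair_of_rho {x : PathWord V E × PathWord V E} {v : V}
    (h : Q.rho x = some (vertexPair V E v)) : ∃ α, Q.t α = v ∧ x = Q.arrowPair α := by
  obtain ⟨-, α, rfl, h1, h2⟩ := rho_eq_some_iff.1 h
  obtain rfl : v = Q.t α := h1
  exact ⟨α, rfl, rfl⟩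

theorem bardzellDiff_arrowPair (Z : PathWord V E × PathWord V E → k) (α : E) :
    Q.bardzellDiff 0 Z (Q.arrowPair α) =
      Z (vertexPair V E (Q.s α)) - Z (vertexPair V E (Q.t α)) := by
  rw [bardzellDiff, lam_arrowPair, rho_arrowPair]
  simp [aSign, bSign, arrowPair, arrowPath, sgn_zero]
  ring

theorem isPairOf_vertexPair {n : ℕ} {d : ℤ} {v : V} (h : Q.IsPairOf n d (vertexPair V E v)) :
    n = 0 ∧ d = 0 := by
  obtain ⟨-, h1, h2⟩ := h
  simp [vertexPair, PathWord.trivial] at h1 h2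
  exact ⟨h1.symm, h2.symm⟩

theorem isPairOf_arrowPair {n : ℕ} {d : ℤ} {α : E} (h : Q.IsPairOf n d (Q.arrowPair α)) :
    n = 1 ∧ d = 0 := by
  obtain ⟨-, h1, h2⟩ := h
  simp [arrowPair, arrowPath] at h1 h2
  exact ⟨h1.symm, h2.symm⟩

theorem pathDeg_rot_iterate (p : PathWord V E) (i : ℕ) :
    Q.pathDeg (Q.rot^[i] p) = Q.pathDeg p := by
  rw [pathDeg, arrows_rot_iterate, pathDeg, wordDeg, wordDeg]
  exact ((List.rotate_perm p.arrows i).map _).sum_eq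

theorem isPairOf_anti {p : PathWord V E} (hp : Q.IsCompleteAntiPath p) :
    Q.IsPairOf p.length (-Q.pathDeg p) (p, .trivial E p.src) :=
  ⟨hp.isPair, rfl, by simp [pathDeg, PathWord.trivial, wordDeg]⟩

theorem isPairOf_path {p : PathWord V E} (hp : Q.IsCompletePath p) :
    Q.IsPairOf 0 (Q.pathDeg p) (.trivial E p.src, p) :=
  ⟨hp.isPair, rfl, by simp [pathDeg, PathWord.trivial, wordDeg]⟩

theorem isPairOf_maxAnti {u q : PathWord V E} (hu : Q.IsMaximalAntiPath u)
    (hq : Q.IsOpposite u q) : Q.IsPairOf u.length (Q.pathDeg q - Q.pathDeg u) (u, q) :=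
  ⟨⟨hu.1, hq.1, hq.2.1.symm, hq.2.2.1.symm⟩, rfl, rfl⟩

theorem isPairOf_maxPath {u : PathWord V E} (hu : Q.IsMaximalPath u) (h : u.tgt = u.src) :
    Q.IsPairOf 0 (Q.pathDeg u) (.trivial E u.src, u) :=
  ⟨⟨⟨rfl, by simp [PathWord.trivial]⟩, hu.1, h.symm, rfl⟩, rfl,
    by simp [pathDeg, PathWord.trivial, wordDeg]⟩

theorem sgn_eq_one {w : ℤ} (h : Even w ∨ ringChar k = 2) : sgn k w = 1 := by
  rcases h with h | h
  · simp [sgn, Int.negOnePow_even _ h]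
  · have : CharP k 2 := ringChar.of_eq h
    rcases Int.even_or_odd w with h' | h'
    · simp [sgn, Int.negOnePow_even _ h']
    · simp [sgn, Int.negOnePow_odd _ h', CharTwo.neg_eq]

/-- This is the case in which the monodromy differs from 1, so that the cycle is acyclic and carries
no basis element. -/
theorem sgn_eq_neg_one {w : ℤ} (h : ¬ (Even w ∨ ringChar k = 2)) :
    sgn k w = -1 ∧ (2 : k) ≠ 0 := by
  push Not at h
  refine ⟨?_, Ring.two_ne_zero h.2⟩
  simp [sgn, Int.negOnePow_odd _ (Int.not_even_iff_odd.1 h.1)]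

/-! ### The pairs and the cocycle condition of the basis elements -/

section Chains

variable [Fintype V]

/-- The sum of all pairs of trivial paths. -/
theorem unitChain_vertexPair (v : V) :
    (∑ x : V, Finsupp.single (PathWord.trivial E x, PathWord.trivial E x) (1 : k))
      (vertexPair V E v) = 1 := by
  rw [Finsupp.finsetSum_apply, Finset.sum_eq_single_of_mem v (Finset.mem_univ v)]
  · exact Finsupp.single_eq_same
  · intro w _ hw
    refine Finsupp.single_eq_of_ne' fun h => hw ?_
    exact congrArg (fun x => x.1.tgt) h

theorem exists_of_unitChain_ne_zero {x : PathWord V E × PathWord V E}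
    (h : (∑ x : V, Finsupp.single (PathWord.trivial E x, PathWord.trivial E x) (1 : k)) x ≠ 0) :
    ∃ v, x = vertexPair V E v := by
  rw [Finsupp.finsetSum_apply] at h
  obtain ⟨v, -, h⟩ := Finset.exists_ne_zero_of_sum_ne_zero h
  refine ⟨v, ?_⟩
  by_contra hne
  exact h (Finsupp.single_eq_of_ne hne)

variable {T : Set E} {Pc Qc : Set (PathWord V E)}

/-- The pairs which occur in the chain which represents a basis element. -/
def BasisIndex.Occurs : Q.BasisIndex k T Pc Qc → PathWord V E × PathWord V E → Prop
  | unit, x => ∃ v, x = vertexPair V E v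
  | anti s p _ _, x => if s = 0 then
      ∃ i < Q.period p, x = (Q.rot^[i] p, .trivial E (Q.rot^[i] p).src) else x = Q.antiLoop p
  | path s p _ _, x => if s = 0 then
      ∃ i < Q.period p, x = (.trivial E (Q.rot^[i] p).src, Q.rot^[i] p) else x = Q.pathLoop p
  | maxAnti u q _ _, x => x = (u, q)
  | maxPath u _ _, x => x = (.trivial E u.src, u)
  | arrow α _, x => x = Q.arrowPair α

theorem single_ne_zero_imp {X : Type*} {x y : X} (h : Finsupp.single x (1 : k) y ≠ 0) : y = x := by
  by_contra hne
  exact h (Finsupp.single_eq_of_ne hne)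

theorem BasisIndex.occurs_of_chain_ne_zero (hPc : ∀ p ∈ Pc, Q.IsCompleteAntiPath p)
    (hQc : ∀ p ∈ Qc, Q.IsCompletePath p) (b : Q.BasisIndex k T Pc Qc)
    {x : PathWord V E × PathWord V E} (h : b.chain x ≠ 0) : b.Occurs x := by
  cases b with
  | unit => exact exists_of_unitChain_ne_zero h
  | anti s p hp _ =>
    by_cases hs : s = 0
    · simp only [chain, hs, if_true, antiN0_eq (hPc p hp), Occurs] at h ⊢
      exact IsCycleSystem.exists_of_cycleSum_ne_zero h
    · simp only [chain, hs, if_false, antiN1_eq (hPc p hp).isClosedWord.ne_nil, Occurs] at h ⊢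
      exact single_ne_zero_imp h
  | path s p hp _ =>
    by_cases hs : s = 0
    · simp only [chain, hs, if_true, pathN0_eq (hQc p hp), Occurs] at h ⊢
      exact IsCycleSystem.exists_of_cycleSum_ne_zero h
    · simp only [chain, hs, if_false, pathN1_eq (hQc p hp).isClosedWord.ne_nil, Occurs] at h ⊢
      exact single_ne_zero_imp h
  | maxAnti u q _ _ => exact single_ne_zero_imp h
  | maxPath u _ _ => exact single_ne_zero_imp h
  | arrow α _ => exact single_ne_zero_imp h

theorem BasisIndex.isPairOf_of_occurs (hPc : ∀ p ∈ Pc, Q.IsCompleteAntiPath p)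
    (hQc : ∀ p ∈ Qc, Q.IsCompletePath p) (b : Q.BasisIndex k T Pc Qc)
    {x : PathWord V E × PathWord V E} (h : b.Occurs x) :
    Q.IsPairOf b.bidegree.1 b.bidegree.2 x := by
  cases b with
  | unit =>
    obtain ⟨v, rfl⟩ := h
    exact ⟨isPair_vertexPair v, rfl, sub_self _⟩
  | anti s p hp _ =>
    by_cases hs : s = 0
    · simp only [hs, if_true, Occurs] at h
      obtain ⟨i, -, rfl⟩ := h
      have := isPairOf_anti (isCycleSystem_anti.rot_iterate (hPc p hp) i)
      rw [pathDeg_rot_iterate, PathWord.length, length_rot_iterate] at this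
      simpa [bidegree, hs, PathWord.length] using this
    · simp only [hs, if_false, Occurs] at h
      subst h
      obtain rfl : s = 1 := by omega
      exact (isPairOf_of_lam (isCycleSystem_anti.lam (hPc p hp))).2 (isPairOf_anti (hPc p hp))
  | path s p hp _ =>
    by_cases hs : s = 0
    · simp only [hs, if_true, Occurs] at h
      obtain ⟨i, -, rfl⟩ := h
      have := isPairOf_path (isCycleSystem_path.rot_iterate (hQc p hp) i)
      rw [pathDeg_rot_iterate] at this
      simpa [bidegree, hs] using this
    · simp only [hs, if_false, Occurs] at h
      subst h
      obtain rfl : s = 1 := by omega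
      exact (isPairOf_of_lam (isCycleSystem_path.lam (hQc p hp))).2 (isPairOf_path (hQc p hp))
  | maxAnti u q hu hq =>
    obtain rfl := h
    exact isPairOf_maxAnti hu hq
  | maxPath u hu hc =>
    obtain rfl := h
    exact isPairOf_maxPath hu hc
  | arrow α _ =>
    obtain rfl := h
    exact ⟨isPair_arrowPair α, rfl, sub_self _⟩

theorem BasisIndex.isChainOf_chain (hPc : ∀ p ∈ Pc, Q.IsCompleteAntiPath p)
    (hQc : ∀ p ∈ Qc, Q.IsCompletePath p) (b : Q.BasisIndex k T Pc Qc) :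
    Q.IsChainOf b.bidegree.1 b.bidegree.2 b.chain := fun _ hx =>
  b.isPairOf_of_occurs hPc hQc (b.occurs_of_chain_ne_zero hPc hQc (Finsupp.mem_support_iff.1 hx))

theorem IsMaximalAntiPath.not_lam {x y : PathWord V E × PathWord V E}
    (hu : Q.IsMaximalAntiPath x.1) : Q.lam y ≠ some x := by
  intro h
  obtain ⟨hy, α, rfl, -⟩ := lam_eq_some_iff.1 h
  have := congrArg List.length (hu.2.2 _ hy.1 ⟨[α], [], by simp [consPair]⟩)
  simp [consPair] at this

theorem IsMaximalAntiPath.not_rho {x y : PathWord V E × PathWord V E}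
    (hu : Q.IsMaximalAntiPath x.1) : Q.rho y ≠ some x := by
  intro h
  obtain ⟨hy, α, rfl, -⟩ := rho_eq_some_iff.1 h
  have := congrArg List.length (hu.2.2 _ hy.1 ⟨[], [α], by simp [snocPair]⟩)
  simp [snocPair] at this

theorem IsMaximalPath.not_lam {x y : PathWord V E × PathWord V E}
    (hu : Q.IsMaximalPath x.2) : Q.lam y ≠ some x := by
  intro h
  obtain ⟨hy, α, rfl, -⟩ := lam_eq_some_iff.1 h
  have := congrArg List.length (hu.2.2 _ hy.2.1 ⟨[α], [], by simp [consPair]⟩)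
  simp [consPair] at this

theorem IsMaximalPath.not_rho {x y : PathWord V E × PathWord V E}
    (hu : Q.IsMaximalPath x.2) : Q.rho y ≠ some x := by
  intro h
  obtain ⟨hy, α, rfl, -⟩ := rho_eq_some_iff.1 h
  have := congrArg List.length (hu.2.2 _ hy.2.1 ⟨[], [α], by simp [snocPair]⟩)
  simp [snocPair] at this

theorem IsCycleSystem.exists_rho {C : PathWord V E → Prop}
    {J W : PathWord V E → PathWord V E × PathWord V E} {N : ℕ → ℕ}
    (hC : Q.IsCycleSystem C J W N) {p : PathWord V E} (hp : C p) :
    ∃ i, Q.rho (W p) = some (J (Q.rot^[i] p)) := by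
  refine ⟨Q.period p - 1, ?_⟩
  have h := hC.rho (hC.rot_iterate hp (Q.period p - 1))
  rwa [← Function.iterate_succ_apply' Q.rot, Nat.succ_eq_add_one,
    Nat.sub_add_cancel (hC.closed hp).period_pos, rot_period] at h

/-- N⁰ is closed because the parity condition makes the monodromy 1; maximality excludes extensions
of the pairs of maximal words; the remaining non-unit elements have both faces. -/
theorem BasisIndex.bardzellDiff_chain (hQ : Q.IsGentle) (hPc : ∀ p ∈ Pc, Q.IsCompleteAntiPath p)
    (hQc : ∀ p ∈ Qc, Q.IsCompletePath p) (b : Q.BasisIndex k T Pc Qc) :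
    Q.bardzellDiff b.bidegree.2 b.chain = 0 := by
  cases b with
  | unit =>
    funext x
    by_contra hx
    have : ∃ α, x = Q.arrowPair α := by
      rcases exists_of_bardzellDiff_ne_zero hx with ⟨z, hl, h⟩ | ⟨z, hr, h⟩
      · obtain ⟨v, rfl⟩ := exists_of_unitChain_ne_zero h
        obtain ⟨α, -, h⟩ := eq_arrowPair_of_lam hl
        exact ⟨α, h⟩
      · obtain ⟨v, rfl⟩ := exists_of_unitChain_ne_zero h
        obtain ⟨α, -, h⟩ := eq_arrowPair_of_rho hr
        exact ⟨α, h⟩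
    obtain ⟨α, rfl⟩ := this
    refine hx ?_
    simp only [bidegree, bardzellDiff_arrowPair, chain, unitChain_vertexPair]
    simp
  | anti s p hp par =>
    have hc := hPc p hp
    by_cases hs : s = 0
    · simp only [chain, hs, if_true, antiN0_eq hc, bidegree]
      exact isCycleSystem_anti.bardzellDiff_cycleSum hQ hc ((sign_anti hc).trans (sgn_eq_one par))
    · simp only [chain, hs, if_false, antiN1_eq hc.isClosedWord.ne_nil]
      obtain ⟨i, hi⟩ := isCycleSystem_anti.exists_rho hc
      exact bardzellDiff_single_of_restr (isCycleSystem_anti.lam hc) hi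
  | path s p hp par =>
    have hc := hQc p hp
    by_cases hs : s = 0
    · simp only [chain, hs, if_true, pathN0_eq hc, bidegree]
      exact isCycleSystem_path.bardzellDiff_cycleSum hQ hc ((sign_path hc).trans (sgn_eq_one par))
    · simp only [chain, hs, if_false, pathN1_eq hc.isClosedWord.ne_nil]
      obtain ⟨i, hi⟩ := isCycleSystem_path.exists_rho hc
      exact bardzellDiff_single_of_restr (isCycleSystem_path.lam hc) hi
  | maxAnti u q hu hq =>
    exact bardzellDiff_single_eq_zero (fun _ => IsMaximalAntiPath.not_lam (x := (u, q)) hu)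
      fun _ => IsMaximalAntiPath.not_rho (x := (u, q)) hu
  | maxPath u hu hc =>
    exact bardzellDiff_single_eq_zero
      (fun _ => IsMaximalPath.not_lam (x := (.trivial E u.src, u)) hu)
      fun _ => IsMaximalPath.not_rho (x := (.trivial E u.src, u)) hu
  | arrow α _ => exact bardzellDiff_single_of_restr (lam_arrowPair α) (rho_arrowPair α)

end Chains

/-! ### The representing chains span the cohomology of the Bardzell complex -/

section Delta

variable (k) in
/-- The indicator function of a pair. -/
def delta (x : PathWord V E × PathWord V E) : PathWord V E × PathWord V E → k :=
  Finsupp.single x (1 : k)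

theorem delta_self (x : PathWord V E × PathWord V E) : delta k x x = 1 := Finsupp.single_eq_same

theorem delta_of_ne {x y : PathWord V E × PathWord V E} (h : y ≠ x) : delta k x y = 0 :=
  Finsupp.single_eq_of_ne h

theorem eq_of_delta_ne_zero {x y : PathWord V E × PathWord V E} (h : delta k x y ≠ 0) : y = x :=
  single_ne_zero_imp h

theorem bardzellDiff_delta_apply (d : ℤ) {x y : PathWord V E × PathWord V E}
    (h : Q.bardzellDiff d (delta k y) x ≠ 0) : Q.lam x = some y ∨ Q.rho x = some y := by
  rcases exists_of_bardzellDiff_ne_zero h with ⟨z, hl, h⟩ | ⟨z, hl, h⟩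
  · exact Or.inl (eq_of_delta_ne_zero h ▸ hl)
  · exact Or.inr (eq_of_delta_ne_zero h ▸ hl)

theorem bSign_mul_self (x : PathWord V E × PathWord V E) : bSign k x * bSign k x = 1 := by
  rw [bSign, ← pow_add, Even.neg_one_pow ⟨_, rfl⟩]

end Delta

namespace IsCycleSystem

variable {C : PathWord V E → Prop} {J W : PathWord V E → PathWord V E × PathWord V E} {N : ℕ → ℕ}

/-- The pair `J p` is a face of exactly two pairs, its neighbours `W p` and `W (rot p)` in the
cycle. If these coincide, the two terms add up. -/
theorem bardzellDiff_delta (hC : Q.IsCycleSystem C J W N) (hQ : Q.IsGentle) (d : ℤ)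
    {p : PathWord V E} (hp : C p) : Q.bardzellDiff d (delta k (J p)) =
      aSign k Q d (W p) • delta k (W p) + bSign k (W (Q.rot p)) • delta k (W (Q.rot p)) := by
  classical
  funext y
  have h1 : aSign k Q d y * (Q.lam y).elim 0 (delta k (J p)) =
      aSign k Q d (W p) * delta k (W p) y := by
    by_cases hy : y = W p
    · rw [hy, hC.lam hp, delta_self]
      simp [delta_self]
    · rw [delta_of_ne hy, mul_zero]
      rcases hl : Q.lam y with _ | z
      · simp
      · rw [Option.elim_some, delta_of_ne, mul_zero]
        rintro rfl
        exact hy ((hC.lam_iff hQ hp).1 hl)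
  have h2 : bSign k y * (Q.rho y).elim 0 (delta k (J p)) =
      bSign k (W (Q.rot p)) * delta k (W (Q.rot p)) y := by
    by_cases hy : y = W (Q.rot p)
    · rw [hy, hC.rho hp, delta_self]
      simp [delta_self]
    · rw [delta_of_ne hy, mul_zero]
      rcases hl : Q.rho y with _ | z
      · simp
      · rw [Option.elim_some, delta_of_ne, mul_zero]
        rintro rfl
        exact hy ((hC.rho_iff hQ hp).1 hl)
  rw [bardzellDiff, h1, h2]
  rfl

/-- Modulo the boundaries of the pairs of a cycle and the class of `W p`, if it is present, all
pairs `W (rot^i p)` vanish. -/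
theorem delta_mem (hC : Q.IsCycleSystem C J W N) (hQ : Q.IsGentle) (d : ℤ) {p : PathWord V E}
    (hp : C p) (S : Submodule k (PathWord V E × PathWord V E → k))
    (hB : ∀ i, Q.bardzellDiff d (delta k (J (Q.rot^[i] p))) ∈ S)
    (hS : delta k (W p) ∈ S ∨
      (sign k Q d (N p.arrows.length) p (Q.period p) = -1 ∧ (2 : k) ≠ 0)) (i : ℕ) :
    delta k (W (Q.rot^[i] p)) ∈ S := by
  set c := sign k Q d (N p.arrows.length) p with hc
  -- Each coboundary identifies neighbouring pairs `W` up to sign; the signs multiply up along the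
  -- cycle.
  have key : ∀ i, (c i * aSign k Q d (W (Q.rot^[i] p))) • delta k (W (Q.rot^[i] p)) -
      aSign k Q d (W p) • delta k (W p) ∈ S := by
    intro i
    induction i with
    | zero => simp [hc, sign_zero]
    | succ i ih =>
      have h1 := hC.bardzellDiff_delta (k := k) hQ d (hC.rot_iterate hp i)
      rw [← Function.iterate_succ_apply' Q.rot] at h1
      have h2 := hC.sign_rel (k := k) d hp i
      rw [← hc] at h2
      have h3 := S.sub_mem ih (S.smul_mem (c i) (hB i))
      rw [h1] at h3
      have h4 : c (i + 1) * aSign k Q d (W (Q.rot^[i + 1] p)) =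
          - (c i * bSign k (W (Q.rot^[i + 1] p))) := by linear_combination h2
      rw [h4]
      convert h3 using 1
      rw [smul_add, smul_smul, smul_smul, neg_smul]
      abel
  have h0 : delta k (W p) ∈ S := by
    rcases hS with hS | ⟨h1, h2⟩
    · exact hS
    -- Once around the cycle, `W p` is identified with its negative, and 2 is invertible.
    · have h3 := key (Q.period p)
      rw [rot_period, h1, neg_one_mul, neg_smul, ← neg_add', ← two_smul k, smul_smul] at h3
      have h4 : (2 : k) * aSign k Q d (W p) ≠ 0 :=
        mul_ne_zero h2 (left_ne_zero_of_mul_eq_one (aSign_mul_self d _))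
      exact (S.smul_mem_iff h4).1 (S.neg_mem_iff.1 h3)
  have h5 := S.add_mem (key i) (S.smul_mem (aSign k Q d (W p)) h0)
  rw [sub_add_cancel] at h5
  exact (S.smul_mem_iff (mul_ne_zero (sign_ne_zero _ _ _ _)
    (left_ne_zero_of_mul_eq_one (aSign_mul_self d _)))).1 h5

/-- On the cycle a cocycle is a multiple of the signed sum if the monodromy is 1, and zero if it is
-1 and 2 is invertible. -/
theorem exists_reduction (hC : Q.IsCycleSystem C J W N) {d : ℤ} {p : PathWord V E}
    (hp : C p) {Z : PathWord V E × PathWord V E → k} (hZ : Q.bardzellDiff d Z = 0)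
    (S : Submodule k (PathWord V E × PathWord V E → k))
    (hS : ⇑(cycleSum Q J (sign k Q d (N p.arrows.length) p) p) ∈ S ∨
      (sign k Q d (N p.arrows.length) p (Q.period p) = -1 ∧ (2 : k) ≠ 0)) (i : ℕ) :
    ∃ g ∈ S, (∀ y, Z y = 0 → g y = 0) ∧ g (J (Q.rot^[i] p)) = Z (J (Q.rot^[i] p)) := by
  set c := sign k Q d (N p.arrows.length) p with hc
  have hval : ∀ i, Z (J (Q.rot^[i] p)) = c i * Z (J p) := fun i =>
    hC.eq_sign_mul hp fun i _ => congrFun hZ _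
  rcases hS with hS | ⟨h1, h2⟩
  · have hg : ∀ i < Q.period p, Z (J p) * cycleSum Q J c p (J (Q.rot^[i] p)) =
        Z (J (Q.rot^[i] p)) := by
      intro i hi
      rw [hC.cycleSum_of_lt c p hi, hval, mul_comm]
    refine ⟨Z (J p) • ⇑(cycleSum Q J c p), S.smul_mem _ hS, ?_, ?_⟩
    · intro y hy
      by_contra hne
      obtain ⟨j, hj, rfl⟩ := exists_of_cycleSum_ne_zero (right_ne_zero_of_mul hne)
      exact hne ((hg j hj).trans hy)
    · have : Q.rot^[i] p = Q.rot^[i % Q.period p] p :=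
        (Function.iterate_mod_minimalPeriod_eq (f := Q.rot) (x := p) (n := i)).symm
      rw [this]
      exact hg _ (Nat.mod_lt _ (hC.closed hp).period_pos)
  · have h3 := hval (Q.period p)
    rw [rot_period, h1] at h3
    have h4 : Z (J p) = 0 := by
      have : 2 * Z (J p) = 0 := by linear_combination h3
      exact (mul_eq_zero.1 this).resolve_left h2
    exact ⟨0, S.zero_mem, fun _ _ => rfl, by rw [hval, h4, mul_zero]; rfl⟩

end IsCycleSystem

section Span

variable [Fintype V]

variable (Q k) in
/-- The span of the representing chains of bidegree `(n, d)` and of the Bardzell coboundaries. -/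
def chainSpan (T : Set E) (Pc Qc : Set (PathWord V E)) (n : ℕ) (d : ℤ) :
    Submodule k (PathWord V E × PathWord V E → k) :=
  Submodule.span k ({f | ∃ b : Q.BasisIndex k T Pc Qc, b.bidegree = (n, d) ∧ f = b.chain} ∪
    {f | ∃ m y, n = m + 1 ∧ Q.IsPairOf m d y ∧ f = Q.bardzellDiff d (delta k y)})

variable {T : Set E} {Pc Qc : Set (PathWord V E)} {n : ℕ} {d : ℤ}

theorem chain_mem_chainSpan (b : Q.BasisIndex k T Pc Qc) (hb : b.bidegree = (n, d)) :
    ⇑b.chain ∈ Q.chainSpan k T Pc Qc n d := Submodule.subset_span (Or.inl ⟨b, hb, rfl⟩)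

theorem bardzellDiff_mem_chainSpan {y : PathWord V E × PathWord V E}
    (hy : Q.IsPairOf n d y) :
    Q.bardzellDiff d (delta k y) ∈ Q.chainSpan k T Pc Qc (n + 1) d :=
  Submodule.subset_span (Or.inr ⟨n, y, rfl, hy, rfl⟩)

/-- This is inherited from the Hochschild differential by lifting the chain and restricting again.
-/
theorem bardzellDiff_bardzellDiff {c : PairChain V E k} (hc : Q.IsChainOf n d c) :
    Q.bardzellDiff d (Q.bardzellDiff d c) = 0 := by
  have h1 := restr_differential d (Q.toHochschild k n c)
  rw [restr_toHochschild hc] at h1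
  have h2 := restr_differential d (differential (Q.grading k) d n (Q.toHochschild k n c))
  rw [differential_differential, h1] at h2
  have h3 : restr (0 : Cochain k (Q.Alg k) (n + 1 + 1)) =
      (0 : PathWord V E × PathWord V E → k) := (Q.restrLin k (n + 1 + 1)).map_zero
  rw [h3] at h2
  have h4 : Q.bardzellDiff d (sgn k d • Q.bardzellDiff d ⇑c) =
      sgn k d • Q.bardzellDiff d (Q.bardzellDiff d c) := (Q.bardzellLin k d).map_smul _ _
  rw [h4, smul_smul, sgn_mul_self, one_smul] at h2
  exact h2.symm

theorem bardzellDiff_of_mem_chainSpan (hQ : Q.IsGentle)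
    (hPc : ∀ p ∈ Pc, Q.IsCompleteAntiPath p) (hQc : ∀ p ∈ Qc, Q.IsCompletePath p)
    {g : PathWord V E × PathWord V E → k} (hg : g ∈ Q.chainSpan k T Pc Qc n d) :
    Q.bardzellDiff d g = 0 := by
  have : Q.chainSpan k T Pc Qc n d ≤ LinearMap.ker (Q.bardzellLin k d) := by
    refine Submodule.span_le.2 ?_
    rintro f (⟨b, hb, rfl⟩ | ⟨m, y, rfl, hy, rfl⟩)
    · have := b.bardzellDiff_chain hQ hPc hQc
      rw [hb] at this
      exact this
    · exact bardzellDiff_bardzellDiff (isChainOf_single hy 1)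
  exact this hg

/-- The part of the complex of a spanning tree: every function on its arrows is the difference of
the values of a function on vertices. -/
theorem IsSpanningTree.exists_potential [Finite E] (hT : Q.IsSpanningTree T) (f : E → k) :
    ∃ φ : V → k, ∀ α ∈ T, φ (Q.s α) - φ (Q.t α) = f α := by
  classical
  have : Fintype T := Fintype.ofFinite T
  obtain ⟨hne, hconn, hcard⟩ := hT
  let L : (V → k) →ₗ[k] (T → k) :=
    { toFun := fun φ α => φ (Q.s α) - φ (Q.t α)
      map_add' := fun φ ψ => by
        funext α
        simp only [Pi.add_apply]
        ring
      map_smul' := fun c φ => by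
        funext α
        simp only [Pi.smul_apply, smul_eq_mul, RingHom.id_apply]
        ring }
  -- Along the edges of a connected graph a function without differences is constant.
  have hker : LinearMap.ker L ≤ k ∙ (fun _ : V => (1 : k)) := by
    intro φ hφ
    obtain ⟨v⟩ := hne
    refine Submodule.mem_span_singleton.2 ⟨φ v, ?_⟩
    funext w
    rw [Pi.smul_apply, smul_eq_mul, mul_one]
    have hw := hconn v w
    induction hw with
    | refl => rfl
    | tail _ h ih =>
      rw [ih]
      obtain ⟨α, hα, h⟩ := h
      have h1 : φ (Q.s α) - φ (Q.t α) = 0 := congrFun hφ ⟨α, hα⟩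
      rcases h with ⟨rfl, rfl⟩ | ⟨rfl, rfl⟩
      · exact sub_eq_zero.1 h1
      · exact (sub_eq_zero.1 h1).symm
  have h1 : Module.finrank k (LinearMap.ker L) ≤ 1 :=
    (Submodule.finrank_mono hker).trans (finrank_span_le_card _ |>.trans (by simp))
  have h2 := L.finrank_range_add_finrank_ker
  rw [Module.finrank_fintype_fun_eq_card, ← Nat.card_eq_fintype_card, ← hcard] at h2
  have h3 : Module.finrank k (T → k) = T.ncard := by
    rw [Module.finrank_fintype_fun_eq_card, ← Nat.card_eq_fintype_card]
    rfl
  -- The source has dimension one more than the number of tree arrows and the kernel has dimension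
  -- at most one, so the map is onto.
  have h4 : LinearMap.range L = ⊤ := by
    refine Submodule.eq_top_of_finrank_eq (le_antisymm (Submodule.finrank_le _) ?_)
    omega
  obtain ⟨φ, hφ⟩ := LinearMap.range_eq_top.1 h4 fun α => f α
  exact ⟨φ, fun α hα => congrFun hφ ⟨α, hα⟩⟩

/-- A tree arrow is cohomologous to a combination of arrows outside the tree: take the coboundary of
a potential with difference 1 on it and 0 on the other tree arrows. -/
theorem delta_arrowPair_mem [Finite E] (hT : Q.IsSpanningTree T) (α : E) :
    delta k (Q.arrowPair α) ∈ Q.chainSpan k T Pc Qc 1 0 := by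
  classical
  have : Fintype E := Fintype.ofFinite E
  obtain ⟨φ, hφ⟩ := hT.exists_potential fun β => if β = α then (1 : k) else 0
  have hpair : ∀ v : V, Q.IsPairOf 0 0 (vertexPair V E v) := fun v =>
    ⟨isPair_vertexPair v, rfl, sub_self _⟩
  have h1 : Q.bardzellDiff 0 (∑ v, φ v • delta k (vertexPair V E v)) ∈
      Q.chainSpan k T Pc Qc 1 0 := by
    change Q.bardzellLin k 0 _ ∈ _
    rw [map_sum]
    refine Submodule.sum_mem _ fun v _ => ?_
    rw [map_smul]
    exact Submodule.smul_mem _ _ (bardzellDiff_mem_chainSpan (hpair v))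
  have hval : ∀ v, (∑ w, φ w • delta k (vertexPair V E w)) (vertexPair V E v) = φ v := by
    intro v
    rw [Finset.sum_apply, Finset.sum_eq_single_of_mem v (Finset.mem_univ v)]
    · simp [delta_self]
    · intro w _ hw
      rw [Pi.smul_apply, delta_of_ne, smul_zero]
      exact fun h => hw (congrArg (fun x => x.1.tgt) h).symm
  have h2 : Q.bardzellDiff 0 (∑ v, φ v • delta k (vertexPair V E v)) =
      ∑ β, (φ (Q.s β) - φ (Q.t β)) • delta k (Q.arrowPair β) := by
    funext x
    have hinj : ∀ β γ, Q.arrowPair β = Q.arrowPair γ → β = γ := fun β γ h => by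
      simpa [arrowPair, arrowPath] using congrArg (fun x => x.1.arrows) h
    by_cases hx : ∃ β, x = Q.arrowPair β
    · obtain ⟨β, rfl⟩ := hx
      rw [bardzellDiff_arrowPair, hval, hval, Finset.sum_apply,
        Finset.sum_eq_single_of_mem β (Finset.mem_univ β)]
      · simp [delta_self]
      · intro γ _ hγ
        rw [Pi.smul_apply, delta_of_ne fun h => hγ (hinj _ _ h).symm, smul_zero]
    · have h0 : (∑ β, (φ (Q.s β) - φ (Q.t β)) • delta k (Q.arrowPair β)) x = 0 := by
        rw [Finset.sum_apply]
        refine Finset.sum_eq_zero fun β _ => ?_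
        rw [Pi.smul_apply, delta_of_ne fun h => hx ⟨β, h⟩, smul_zero]
      · rw [h0]
        by_contra hne
        have hv : ∀ z, (∑ v, φ v • delta k (vertexPair V E v)) z ≠ 0 →
            ∃ v, z = vertexPair V E v := by
          intro z hz
          rw [Finset.sum_apply] at hz
          obtain ⟨v, -, hv⟩ := Finset.exists_ne_zero_of_sum_ne_zero hz
          exact ⟨v, eq_of_delta_ne_zero (right_ne_zero_of_mul hv)⟩
        rcases exists_of_bardzellDiff_ne_zero hne with ⟨z, hl, h⟩ | ⟨z, hl, h⟩
        · obtain ⟨v, rfl⟩ := hv z h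
          obtain ⟨β, -, hβ⟩ := eq_arrowPair_of_lam hl
          exact hx ⟨β, hβ⟩
        · obtain ⟨v, rfl⟩ := hv z h
          obtain ⟨β, -, hβ⟩ := eq_arrowPair_of_rho hl
          exact hx ⟨β, hβ⟩
  by_cases hα : α ∈ T
  · rw [h2, ← Finset.add_sum_erase _ _ (Finset.mem_univ α), hφ α hα, if_pos rfl, one_smul] at h1
    refine (Submodule.add_mem_iff_left _ ?_).1 h1
    refine Submodule.sum_mem _ fun β hβ => ?_
    by_cases hβT : β ∈ T
    · rw [hφ β hβT, if_neg (Finset.ne_of_mem_erase hβ), zero_smul]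
      exact Submodule.zero_mem _
    · exact Submodule.smul_mem _ _ (chain_mem_chainSpan (.arrow β hβT) rfl)
  · exact chain_mem_chainSpan (.arrow α hα) rfl

theorem bardzellDiff_const (hT : Q.IsSpanningTree T) {Z : PathWord V E × PathWord V E → k}
    (hZ : ∀ α ∈ T, Q.bardzellDiff 0 Z (Q.arrowPair α) = 0) (v w : V) :
    Z (vertexPair V E v) = Z (vertexPair V E w) := by
  have hw := hT.2.1 v w
  induction hw with
  | refl => rfl
  | tail _ h ih =>
    rw [ih]
    obtain ⟨α, hα, h⟩ := h
    have h1 := hZ α hα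
    rw [bardzellDiff_arrowPair] at h1
    rcases h with ⟨rfl, rfl⟩ | ⟨rfl, rfl⟩
    · exact sub_eq_zero.1 h1
    · exact (sub_eq_zero.1 h1).symm

/-- A cocycle can be reduced at a pair whose left restriction is not exceptional. -/
theorem exists_reduction_of_lam (hQ : Q.IsGentle) {Z : PathWord V E × PathWord V E → k}
    (hZ : Q.bardzellDiff d Z = 0) {x y : PathWord V E × PathWord V E} (hx : Q.IsPairOf n d x)
    (h : Q.lam x = some y) (hy : ¬ Q.Exceptional y) :
    ∃ g ∈ Q.chainSpan k T Pc Qc n d, (∀ u, Z u = 0 → g u = 0) ∧ g x = Z x := by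
  obtain ⟨m, rfl, hym⟩ := exists_isPairOf_of_lam h hx
  have hyp := isPair_of_lam h
  have hne : y.1.arrows ≠ [] ∨ y.2.arrows ≠ [] := by
    by_contra! H
    exact hy (hyp.exceptional_of_nil H.1 H.2)
  -- The coboundary of `y` is supported on the extensions of `y`. As `aSign` squares to 1, this
  -- multiple takes the value `Z x` at `x`.
  refine ⟨(aSign k Q d x * Z x) • Q.bardzellDiff d (delta k y),
    Submodule.smul_mem _ _ (bardzellDiff_mem_chainSpan hym), fun u hu => ?_, ?_⟩
  · by_contra hgu
    rcases bardzellDiff_delta_apply d (right_ne_zero_of_mul hgu) with hl | hr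
    · obtain rfl := lam_inj hQ hl h hne
      rw [Pi.smul_apply, hu, mul_zero, zero_smul] at hgu
      exact hgu rfl
    -- A right extension `u` of `y` completes a square with `x`, and the cocycle condition at its
    -- top `t` shows that `Z u = 0` forces `Z x = 0`.
    · obtain ⟨t, ht1, ht2⟩ := exists_common_extension hQ hr h hy
      have h1 : aSign k Q d t * Z u + bSign k t * Z x = 0 := by
        have := congrFun hZ t
        rwa [bardzellDiff, ht1, ht2] at this
      rw [hu, mul_zero, zero_add] at h1
      have h2 := (mul_eq_zero.1 h1).resolve_left
        (left_ne_zero_of_mul_eq_one (bSign_mul_self t))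
      rw [Pi.smul_apply, h2, mul_zero, zero_smul] at hgu
      exact hgu rfl
  · have hr : (Q.rho x).elim 0 (delta k y) = 0 := by
      rcases hr : Q.rho x with _ | w
      · rfl
      · refine delta_of_ne ?_
        rintro rfl
        rcases exceptional_or_rho h hr with h' | ⟨z, hz⟩
        · exact hy h'
        · exact rho_rho hr hz
    rw [Pi.smul_apply, bardzellDiff, hr, h, Option.elim_some, delta_self, smul_eq_mul]
    linear_combination Z x * IsCycleSystem.aSign_mul_self (k := k) (Q := Q) d x

/-- A cocycle can be reduced at a pair whose right restriction is not exceptional. -/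
theorem exists_reduction_of_rho (hQ : Q.IsGentle) {Z : PathWord V E × PathWord V E → k}
    (hZ : Q.bardzellDiff d Z = 0) {x y : PathWord V E × PathWord V E} (hx : Q.IsPairOf n d x)
    (h : Q.rho x = some y) (hy : ¬ Q.Exceptional y) :
    ∃ g ∈ Q.chainSpan k T Pc Qc n d, (∀ u, Z u = 0 → g u = 0) ∧ g x = Z x := by
  obtain ⟨m, rfl, hym⟩ := exists_isPairOf_of_rho h hx
  have hyp := isPair_of_rho h
  have hne : y.1.arrows ≠ [] ∨ y.2.arrows ≠ [] := by
    by_contra! H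
    exact hy (hyp.exceptional_of_nil H.1 H.2)
  refine ⟨(bSign k x * Z x) • Q.bardzellDiff d (delta k y),
    Submodule.smul_mem _ _ (bardzellDiff_mem_chainSpan hym), fun u hu => ?_, ?_⟩
  · by_contra hgu
    rcases bardzellDiff_delta_apply d (right_ne_zero_of_mul hgu) with hl | hr
    · obtain ⟨t, ht1, ht2⟩ := exists_common_extension hQ h hl hy
      have h1 : aSign k Q d t * Z x + bSign k t * Z u = 0 := by
        have := congrFun hZ t
        rwa [bardzellDiff, ht1, ht2] at this
      rw [hu, mul_zero, add_zero] at h1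
      have h2 := (mul_eq_zero.1 h1).resolve_left
        (left_ne_zero_of_mul_eq_one (IsCycleSystem.aSign_mul_self d t))
      rw [Pi.smul_apply, h2, mul_zero, zero_smul] at hgu
      exact hgu rfl
    · obtain rfl := rho_inj hQ hr h hne
      rw [Pi.smul_apply, hu, mul_zero, zero_smul] at hgu
      exact hgu rfl
  · have hl : (Q.lam x).elim 0 (delta k y) = 0 := by
      rcases hl : Q.lam x with _ | w
      · rfl
      · refine delta_of_ne ?_
        rintro rfl
        rcases exceptional_or_lam h hl with h' | ⟨z, hz⟩
        · exact hy h'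
        · exact lam_lam hl hz
    rw [Pi.smul_apply, bardzellDiff, hl, h, Option.elim_some, delta_self, smul_eq_mul]
    linear_combination Z x * bSign_mul_self (k := k) x

/-- The cases are the pieces of the complex. Pairs with a face that is not exceptional lie in an
edge or a square, exceptional faces lead to a cycle or to an arrow, and a pair in the support
without faces is exceptional or isolated. -/
theorem exists_reduction [Finite E] (hQ : Q.IsGentle) (hT : Q.IsSpanningTree T)
    (hPc : Q.IsTransversal {p | Q.IsCompleteAntiPath p} Pc)
    (hQc : Q.IsTransversal {q | Q.IsCompletePath q} Qc)
    {Z : PathWord V E × PathWord V E → k} (hZ : Q.bardzellDiff d Z = 0)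
    {x : PathWord V E × PathWord V E} (hx : Q.IsPairOf n d x) (hZx : Z x ≠ 0) :
    ∃ g ∈ Q.chainSpan k T Pc Qc n d, (∀ u, Z u = 0 → g u = 0) ∧ g x = Z x := by
  have hdelta : delta k x ∈ Q.chainSpan k T Pc Qc n d →
      ∃ g ∈ Q.chainSpan k T Pc Qc n d, (∀ u, Z u = 0 → g u = 0) ∧ g x = Z x := by
    intro h
    refine ⟨Z x • delta k x, Submodule.smul_mem _ _ h, fun u hu => ?_, by simp [delta_self]⟩
    rw [Pi.smul_apply, delta_of_ne, smul_zero]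
    rintro rfl
    exact hZx hu
  rcases hl : Q.lam x with _ | y
  · rcases hr : Q.rho x with _ | y
    · by_cases hex : Q.Exceptional x
      · cases hex with
        | trivial v =>
          obtain ⟨rfl, rfl⟩ := isPairOf_vertexPair hx
          refine ⟨Z (vertexPair V E v) • ⇑(BasisIndex.unit (Q := Q) (k := k) (T := T) (Pc := Pc)
            (Qc := Qc)).chain, Submodule.smul_mem _ _ (chain_mem_chainSpan _ rfl), ?_, ?_⟩
          · intro u hu
            by_contra hne
            obtain ⟨w, rfl⟩ := exists_of_unitChain_ne_zero (right_ne_zero_of_mul hne)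
            rw [bardzellDiff_const hT (fun α _ => congrFun hZ _) w v] at hu
            exact hZx hu
          · exact (congrArg (Z (vertexPair V E v) * ·) (unitChain_vertexPair v)).trans (mul_one _)
        | anti p hp =>
          obtain ⟨p₀, ⟨hp₀, i, rfl⟩, -⟩ := hPc.2 p hp
          have hc₀ := hPc.1 hp₀
          have hn := hx.2.1
          have hd := hx.2.2
          have hd' := (isPairOf_anti hp).2.2
          rw [hd', pathDeg_rot_iterate] at hd
          simp only [length_rot_iterate] at hn
          subst hn
          subst hd
          refine isCycleSystem_anti.exists_reduction hc₀ hZ _ ?_ i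
          by_cases hpar : Even (Q.antiWinding p₀) ∨ ringChar k = 2
          · left
            have := chain_mem_chainSpan (n := p₀.arrows.length) (d := -Q.pathDeg p₀)
              (.anti (Q := Q) (k := k) (T := T) (Pc := Pc) (Qc := Qc) 0 p₀ hp₀ hpar) rfl
            simp only [BasisIndex.chain, if_true, antiN0_eq hc₀] at this
            exact this
          · right
            exact (sgn_eq_neg_one hpar).imp_left (sign_anti hc₀).trans
        | path p hp =>
          obtain ⟨p₀, ⟨hp₀, i, rfl⟩, -⟩ := hQc.2 p hp
          have hc₀ := hQc.1 hp₀
          have hn := hx.2.1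
          have hd := hx.2.2
          have hd' := (isPairOf_path hp).2.2
          rw [hd', pathDeg_rot_iterate] at hd
          obtain rfl : 0 = n := hn
          subst hd
          refine isCycleSystem_path.exists_reduction hc₀ hZ _ ?_ i
          by_cases hpar : Even (Q.pathWinding p₀) ∨ ringChar k = 2
          · left
            have := chain_mem_chainSpan (n := 0) (d := Q.pathDeg p₀)
              (.path (Q := Q) (k := k) (T := T) (Pc := Pc) (Qc := Qc) 0 p₀ hp₀ hpar) rfl
            simp only [BasisIndex.chain, if_true, pathN0_eq hc₀] at this
            exact this
          · right
            exact (sgn_eq_neg_one hpar).imp_left (sign_path hc₀).trans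
      -- At an extension of `x` the cocycle condition would have `Z x` as its only term, unless the
      -- extension has a second face; but then `x` would have a face itself.
      · have h3 : ∀ y, Q.lam y ≠ some x := by
          intro y hy
          have h1 := congrFun hZ y
          rcases hy' : Q.rho y with _ | w
          · rw [bardzellDiff, hy, hy'] at h1
            simp only [Option.elim_some, Option.elim_none, mul_zero, add_zero] at h1
            exact hZx ((mul_eq_zero.1 h1).resolve_left
              (left_ne_zero_of_mul_eq_one (IsCycleSystem.aSign_mul_self d y)))
          · obtain ⟨z, hz⟩ := (exceptional_or_rho hy hy').resolve_left hex
            simp [hz] at hr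
        have h4 : ∀ y, Q.rho y ≠ some x := by
          intro y hy
          have h1 := congrFun hZ y
          rcases hy' : Q.lam y with _ | w
          · rw [bardzellDiff, hy, hy'] at h1
            simp only [Option.elim_some, Option.elim_none, mul_zero, zero_add] at h1
            exact hZx ((mul_eq_zero.1 h1).resolve_left
              (left_ne_zero_of_mul_eq_one (bSign_mul_self y)))
          · obtain ⟨z, hz⟩ := (exceptional_or_lam hy hy').resolve_left hex
            simp [hz] at hl
        refine hdelta ?_
        rcases isolated_cases hQ hx.1 hex hl hr h3 h4 with ⟨h5, h6⟩ | ⟨h5, h6, h7⟩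
        · refine chain_mem_chainSpan (.maxAnti x.1 x.2 h5 h6) ?_
          exact Prod.ext hx.2.1 hx.2.2
        · obtain ⟨p, q⟩ := x
          simp only at h5 h6 h7
          subst h7
          have h8 := hx.2.2
          rw [(isPairOf_maxPath h5 h6).2.2] at h8
          exact chain_mem_chainSpan (.maxPath q h5 h6) (Prod.ext hx.2.1 h8)
    · by_cases hex : Q.Exceptional y
      -- An exceptional right face belongs to a cycle or to an arrow, and in both cases there is
      -- also a left face.
      · exfalso
        cases hex with
        | trivial v =>
          obtain ⟨α, -, rfl⟩ := eq_arrowPair_of_rho hr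
          simp [lam_arrowPair] at hl
        | anti p hp =>
          rw [isCycleSystem_anti.rho_iff hQ hp] at hr
          rw [hr, isCycleSystem_anti.lam hp.rot] at hl
          simp at hl
        | path p hp =>
          rw [isCycleSystem_path.rho_iff hQ hp] at hr
          rw [hr, isCycleSystem_path.lam hp.rot] at hl
          simp at hl
      · exact exists_reduction_of_rho hQ hZ hx hr hex
  · by_cases hex : Q.Exceptional y
    · refine hdelta ?_
      cases hex with
      | trivial v =>
        obtain ⟨α, -, rfl⟩ := eq_arrowPair_of_lam hl
        obtain ⟨rfl, rfl⟩ := isPairOf_arrowPair hx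
        exact delta_arrowPair_mem hT α
      | anti p hp =>
        obtain ⟨m, rfl, hy⟩ := exists_isPairOf_of_lam hl hx
        rw [isCycleSystem_anti.lam_iff hQ hp] at hl
        subst hl
        obtain ⟨p₀, ⟨hp₀, i, rfl⟩, -⟩ := hPc.2 p hp
        have hc₀ := hPc.1 hp₀
        have hn := hy.2.1
        have hd := hy.2.2
        rw [(isPairOf_anti hp).2.2, pathDeg_rot_iterate] at hd
        simp only [length_rot_iterate] at hn
        subst hn
        subst hd
        refine isCycleSystem_anti.delta_mem hQ (-Q.pathDeg p₀) hc₀ _ (fun j => ?_) ?_ i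
        · refine bardzellDiff_mem_chainSpan ?_
          have := isPairOf_anti (isCycleSystem_anti.rot_iterate hc₀ j)
          rwa [pathDeg_rot_iterate, PathWord.length, length_rot_iterate] at this
        · by_cases hpar : Even (Q.antiWinding p₀) ∨ ringChar k = 2
          · left
            have := chain_mem_chainSpan (n := p₀.arrows.length + 1) (d := -Q.pathDeg p₀)
              (.anti (Q := Q) (k := k) (T := T) (Pc := Pc) (Qc := Qc) 1 p₀ hp₀ hpar) rfl
            simp only [BasisIndex.chain, one_ne_zero, if_false,
              antiN1_eq hc₀.isClosedWord.ne_nil] at this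
            exact this
          · right
            exact (sgn_eq_neg_one hpar).imp_left (sign_anti hc₀).trans
      | path p hp =>
        obtain ⟨m, rfl, hy⟩ := exists_isPairOf_of_lam hl hx
        rw [isCycleSystem_path.lam_iff hQ hp] at hl
        subst hl
        obtain ⟨p₀, ⟨hp₀, i, rfl⟩, -⟩ := hQc.2 p hp
        have hc₀ := hQc.1 hp₀
        have hn := hy.2.1
        have hd := hy.2.2
        rw [(isPairOf_path hp).2.2, pathDeg_rot_iterate] at hd
        obtain rfl : 0 = m := hn
        subst hd
        refine isCycleSystem_path.delta_mem hQ (Q.pathDeg p₀) hc₀ _ (fun j => ?_) ?_ i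
        · refine bardzellDiff_mem_chainSpan ?_
          have := isPairOf_path (isCycleSystem_path.rot_iterate hc₀ j)
          rwa [pathDeg_rot_iterate] at this
        · by_cases hpar : Even (Q.pathWinding p₀) ∨ ringChar k = 2
          · left
            have := chain_mem_chainSpan (n := 0 + 1) (d := Q.pathDeg p₀)
              (.path (Q := Q) (k := k) (T := T) (Pc := Pc) (Qc := Qc) 1 p₀ hp₀ hpar) rfl
            simp only [BasisIndex.chain, one_ne_zero, if_false,
              pathN1_eq hc₀.isClosedWord.ne_nil] at this
            exact this
          · right
            exact (sgn_eq_neg_one hpar).imp_left (sign_path hc₀).trans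
    · exact exists_reduction_of_lam hQ hZ hx hl hex

/-- Each reduction removes a pair from the finite support without adding new ones. -/
theorem mem_chainSpan [Finite E] (hQ : Q.IsGentle) (hT : Q.IsSpanningTree T)
    (hPc : Q.IsTransversal {p | Q.IsCompleteAntiPath p} Pc)
    (hQc : Q.IsTransversal {q | Q.IsCompletePath q} Qc)
    {Z : PathWord V E × PathWord V E → k} (hZ : Q.bardzellDiff d Z = 0)
    (hpair : ∀ x, Z x ≠ 0 → Q.IsPairOf n d x) (hfin : (Function.support Z).Finite) :
    Z ∈ Q.chainSpan k T Pc Qc n d := by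
  induction hm : (Function.support Z).ncard using Nat.strong_induction_on generalizing Z with
  | _ m ih =>
    by_cases h0 : Z = 0
    · exact h0 ▸ Submodule.zero_mem _
    obtain ⟨x, hx⟩ := Function.ne_iff.1 h0
    obtain ⟨g, hg, h1, h2⟩ := exists_reduction hQ hT hPc hQc hZ (hpair x hx) hx
    have hsub : Function.support (Z - g) ⊆ Function.support Z := by
      intro u hu hu'
      exact hu (by rw [Pi.sub_apply, hu', h1 u hu', sub_zero])
    have hlt : (Function.support (Z - g)).ncard < m := by
      rw [← hm]
      refine Set.ncard_lt_ncard ⟨hsub, fun h => ?_⟩ hfin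
      exact h (show x ∈ Function.support Z from hx) (by rw [Pi.sub_apply, h2, sub_self])
    have hZg : Q.bardzellDiff d (Z - g) = 0 := by
      have := (Q.bardzellLin k d).map_sub Z g
      refine this.trans ?_
      change Q.bardzellDiff d Z - Q.bardzellDiff d g = 0
      rw [hZ, bardzellDiff_of_mem_chainSpan hQ (fun p hp => hPc.1 hp) (fun p hp => hQc.1 hp) hg,
        sub_zero]
    have := ih _ hlt hZg (fun u hu => hpair u (hsub hu)) (hfin.subset hsub) rfl
    simpa using Submodule.add_mem _ this hg

end Span

/-! ### The representing chains are independent modulo coboundaries -/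

theorem lam_eq_none {x : PathWord V E × PathWord V E}
    (h : x.1.arrows.head? = none ∨ x.1.arrows.head? ≠ x.2.arrows.head?) : Q.lam x = none := by
  refine Option.eq_none_iff_forall_ne_some.2 fun y hy => ?_
  obtain ⟨-, α, rfl, -⟩ := lam_eq_some_iff.1 hy
  simp [consPair] at h

theorem rho_eq_none {x : PathWord V E × PathWord V E}
    (h : x.1.arrows.getLast? = none ∨ x.1.arrows.getLast? ≠ x.2.arrows.getLast?) :
    Q.rho x = none := by
  refine Option.eq_none_iff_forall_ne_some.2 fun y hy => ?_
  obtain ⟨-, α, rfl, -⟩ := rho_eq_some_iff.1 hy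
  simp [snocPair] at h

theorem bardzellDiff_of_none {d : ℤ} (Z : PathWord V E × PathWord V E → k)
    {x : PathWord V E × PathWord V E} (h1 : Q.lam x = none) (h2 : Q.rho x = none) :
    Q.bardzellDiff d Z x = 0 := by
  simp [bardzellDiff, h1, h2]

/-- For trivial monodromy the signed sum of a coboundary around the cycle is zero, so it cannot be
supported at a single pair `W p`. -/
theorem IsCycleSystem.bardzellDiff_W_eq_zero {C : PathWord V E → Prop}
    {J W : PathWord V E → PathWord V E × PathWord V E} {N : ℕ → ℕ}
    (hC : Q.IsCycleSystem C J W N) {d : ℤ} {p : PathWord V E} (hp : C p)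
    (hper : sign k Q d (N p.arrows.length) p (Q.period p) = 1)
    {Z : PathWord V E × PathWord V E → k}
    (hZ : ∀ i, i + 1 < Q.period p → Q.bardzellDiff d Z (W (Q.rot^[i + 1] p)) = 0) :
    Q.bardzellDiff d Z (W p) = 0 := by
  obtain ⟨r, hr⟩ := Nat.exists_eq_add_one.2 (hC.closed hp).period_pos
  have h1 := hC.eq_sign_mul (m := r) hp fun i hi => hZ i (by omega)
  have h2 := hC.sign_rel (k := k) d hp r
  have h3 := hC.bardzellDiff_W d hp Z r
  rw [← hr, hper] at h2
  rw [h1, ← hr] at h3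
  rw [rot_period] at h2 h3
  rw [h3]
  linear_combination Z (J p) * h2

open Classical in
variable (Q) in
/-- An invariant which tells to which type of basis elements a pair can contribute. -/
def pairKind (x : PathWord V E × PathWord V E) : ℕ :=
  if x.1.arrows = [] then
    if x.2.arrows = [] then 0 else if Q.IsCompletePath x.2 then 1 else 2
  else if x.2.arrows = [] then if Q.IsCompleteAntiPath x.1 then 3 else 4
  else if x.1.arrows.head? = x.2.arrows.head? then
    if x.1.arrows.length = 1 then if x.2.arrows.length = 1 then 5 else 7 else 6
  else 4

theorem pairKind_antiLoop {p : PathWord V E} (hp : p.arrows ≠ []) :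
    Q.pairKind (Q.antiLoop p) = 6 := by
  obtain ⟨m, α, hm⟩ := (List.eq_nil_or_concat' _).resolve_left hp
  simp [pairKind, antiLoop, hm, arrowPath]

theorem pairKind_pathLoop {p : PathWord V E} (hp : p.arrows ≠ []) :
    Q.pairKind (Q.pathLoop p) = 7 := by
  obtain ⟨m, α, hm⟩ := (List.eq_nil_or_concat' _).resolve_left hp
  simp [pairKind, pathLoop, hm, arrowPath]

section Independence

variable [Fintype V] {T : Set E} {Pc Qc : Set (PathWord V E)}

/-- The value of `pairKind` on the pairs which occur in a basis element. -/
def BasisIndex.kind : Q.BasisIndex k T Pc Qc → ℕ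
  | unit => 0
  | anti s _ _ _ => if s = 0 then 3 else 6
  | path s _ _ _ => if s = 0 then 1 else 7
  | maxAnti _ _ _ _ => 4
  | maxPath _ _ _ => 2
  | arrow _ _ => 5

theorem BasisIndex.pairKind_of_occurs (hPc : ∀ p ∈ Pc, Q.IsCompleteAntiPath p)
    (hQc : ∀ p ∈ Qc, Q.IsCompletePath p) (b : Q.BasisIndex k T Pc Qc)
    {x : PathWord V E × PathWord V E} (h : b.Occurs x) : Q.pairKind x = b.kind := by
  cases b with
  | unit =>
    obtain ⟨v, rfl⟩ := h
    simp [pairKind, vertexPair, PathWord.trivial, kind]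
  | anti s p hp _ =>
    by_cases hs : s = 0
    · simp only [hs, if_true, Occurs] at h
      obtain ⟨i, -, rfl⟩ := h
      have hc := isCycleSystem_anti.rot_iterate (hPc p hp) i
      simp [pairKind, PathWord.trivial, kind, hs, hc, hc.isClosedWord.ne_nil]
    · simp only [hs, if_false, Occurs] at h
      subst h
      rw [pairKind_antiLoop (hPc p hp).isClosedWord.ne_nil, kind, if_neg hs]
  | path s p hp _ =>
    by_cases hs : s = 0
    · simp only [hs, if_true, Occurs] at h
      obtain ⟨i, -, rfl⟩ := h
      have hc := isCycleSystem_path.rot_iterate (hQc p hp) i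
      simp [pairKind, PathWord.trivial, kind, hs, hc, hc.isClosedWord.ne_nil]
    · simp only [hs, if_false, Occurs] at h
      subst h
      rw [pairKind_pathLoop (hQc p hp).isClosedWord.ne_nil, kind, if_neg hs]
  | maxAnti u q hu hq =>
    obtain rfl := h
    -- A complete anti-path extends to the left by its own last arrow and is never maximal.
    have h1 : ¬ Q.IsCompleteAntiPath u := fun hc =>
      IsMaximalAntiPath.not_lam (x := (u, .trivial E u.src)) hu (isCycleSystem_anti.lam hc)
    have h2 : q.arrows ≠ [] → u.arrows.head? ≠ q.arrows.head? := by
      intro hne he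
      obtain ⟨α, m, hm⟩ := List.exists_cons_of_ne_nil hne
      exact hq.2.2.2.1 α (by rw [hm]; rfl) (by rw [he, hm]; rfl)
    by_cases h3 : q.arrows = []
    · simp [pairKind, kind, hu.2.1, h1, h3]
    · simp [pairKind, kind, hu.2.1, h2 h3, h3]
  | maxPath u hu _ =>
    obtain rfl := h
    have h1 : ¬ Q.IsCompletePath u := fun hc =>
      IsMaximalPath.not_lam (x := (.trivial E u.src, u)) hu (isCycleSystem_path.lam hc)
    simp [pairKind, PathWord.trivial, kind, hu.2.1, h1]
  | arrow α _ =>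
    obtain rfl := h
    simp [pairKind, kind, arrowPair, arrowPath]

theorem antiLoop_inj {p p' : PathWord V E} (hp : Q.IsCompleteAntiPath p)
    (hp' : Q.IsCompleteAntiPath p') (h : Q.antiLoop p = Q.antiLoop p') : p = p' := by
  have h1 := isCycleSystem_anti.lam hp
  rw [h, isCycleSystem_anti.lam hp'] at h1
  exact (isCycleSystem_anti (Q := Q)).inj (Option.some.inj h1).symm

theorem pathLoop_inj {p p' : PathWord V E} (hp : Q.IsCompletePath p)
    (hp' : Q.IsCompletePath p') (h : Q.pathLoop p = Q.pathLoop p') : p = p' := by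
  have h1 := isCycleSystem_path.lam hp
  rw [h, isCycleSystem_path.lam hp'] at h1
  exact (isCycleSystem_path (Q := Q)).inj (Option.some.inj h1).symm

theorem arrowPair_injective : Function.Injective Q.arrowPair := fun β γ h => by
  simpa [arrowPair, arrowPath] using congrArg (fun x => x.1.arrows) h

theorem IsTransversal.eq_of_rot {S R : Set (PathWord V E)} (hR : Q.IsTransversal S R)
    {p p' q : PathWord V E} (hp : p ∈ R) (hp' : p' ∈ R) (hq : q ∈ S) {i j : ℕ}
    (h : Q.rot^[i] p = q) (h' : Q.rot^[j] p' = q) : p = p' :=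
  (hR.2 q hq).unique ⟨hp, i, h⟩ ⟨hp', j, h'⟩

/-- A pair determines its kind and then the index: within one cycle the transversal contains a
single representative, and the other kinds can be read off from the pair. -/
theorem BasisIndex.eq_of_occurs (hPc : Q.IsTransversal {p | Q.IsCompleteAntiPath p} Pc)
    (hQc : Q.IsTransversal {q | Q.IsCompletePath q} Qc) {b b' : Q.BasisIndex k T Pc Qc}
    {x : PathWord V E × PathWord V E} (h : b.Occurs x) (h' : b'.Occurs x) : b = b' := by
  have hk : b.kind = b'.kind :=
    (b.pairKind_of_occurs (fun p hp => hPc.1 hp) (fun p hp => hQc.1 hp) h).symm.trans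
      (b'.pairKind_of_occurs (fun p hp => hPc.1 hp) (fun p hp => hQc.1 hp) h')
  cases b <;> cases b' <;>
    first
    | (exfalso; simp only [kind] at hk; split_ifs at hk <;> omega)
    | (exfalso; simp [kind] at hk; done)
    | skip
  · rfl
  · rename_i s p hp hpar s' p' hp' hpar'
    obtain rfl : s = s' := by
      simp only [kind] at hk
      split_ifs at hk <;> omega
    suffices p = p' by subst this; rfl
    by_cases hs : s = 0
    · simp only [Occurs, hs, if_true] at h h'
      obtain ⟨i, -, rfl⟩ := h
      obtain ⟨j, -, hj⟩ := h'
      exact hPc.eq_of_rot hp hp' (isCycleSystem_anti.rot_iterate (hPc.1 hp) i) rfl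
        (congrArg Prod.fst hj).symm
    · simp only [Occurs, hs, if_false] at h h'
      exact antiLoop_inj (hPc.1 hp) (hPc.1 hp') (h.symm.trans h')
  · rename_i s p hp hpar s' p' hp' hpar'
    obtain rfl : s = s' := by
      simp only [kind] at hk
      split_ifs at hk <;> omega
    suffices p = p' by subst this; rfl
    by_cases hs : s = 0
    · simp only [Occurs, hs, if_true] at h h'
      obtain ⟨i, -, rfl⟩ := h
      obtain ⟨j, -, hj⟩ := h'
      exact hQc.eq_of_rot hp hp' (isCycleSystem_path.rot_iterate (hQc.1 hp) i) rfl
        (congrArg Prod.snd hj).symm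
    · simp only [Occurs, hs, if_false] at h h'
      exact pathLoop_inj (hQc.1 hp) (hQc.1 hp') (h.symm.trans h')
  · have e := h.symm.trans h'
    simp only [Prod.mk.injEq] at e
    obtain ⟨rfl, rfl⟩ := e
    rfl
  · have e := h.symm.trans h'
    obtain rfl := congrArg Prod.snd e
    rfl
  · obtain rfl := arrowPair_injective (h.symm.trans h')
    rfl

/-- A pair at which a basis element has coefficient one. -/
def BasisIndex.leading : Q.BasisIndex k T Pc Qc → V → PathWord V E × PathWord V E
  | unit, v => vertexPair V E v
  | anti s p _ _, _ => if s = 0 then (p, .trivial E p.src) else Q.antiLoop p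
  | path s p _ _, _ => if s = 0 then (.trivial E p.src, p) else Q.pathLoop p
  | maxAnti u q _ _, _ => (u, q)
  | maxPath u _ _, _ => (.trivial E u.src, u)
  | arrow α _, _ => Q.arrowPair α

theorem BasisIndex.chain_leading (hPc : ∀ p ∈ Pc, Q.IsCompleteAntiPath p)
    (hQc : ∀ p ∈ Qc, Q.IsCompletePath p) (b : Q.BasisIndex k T Pc Qc) (v : V) :
    b.chain (b.leading v) = 1 := by
  cases b with
  | unit => exact unitChain_vertexPair v
  | anti s p hp _ =>
    have hc := hPc p hp
    by_cases hs : s = 0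
    · simp only [chain, leading, hs, if_true, antiN0_eq hc]
      have := isCycleSystem_anti.cycleSum_of_lt
        (IsCycleSystem.sign k Q (-Q.pathDeg p) p.arrows.length p) p (i := 0) hc.isClosedWord.period_pos
      rwa [IsCycleSystem.sign_zero] at this
    · simp only [chain, leading, hs, if_false, antiN1_eq hc.isClosedWord.ne_nil]
      exact Finsupp.single_eq_same
  | path s p hp _ =>
    have hc := hQc p hp
    by_cases hs : s = 0
    · simp only [chain, leading, hs, if_true, pathN0_eq hc]
      have := isCycleSystem_path.cycleSum_of_lt
        (IsCycleSystem.sign k Q (Q.pathDeg p) 0 p) p (i := 0) hc.isClosedWord.period_pos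
      rwa [IsCycleSystem.sign_zero] at this
    · simp only [chain, leading, hs, if_false, pathN1_eq hc.isClosedWord.ne_nil]
      exact Finsupp.single_eq_same
  | maxAnti u q _ _ => exact Finsupp.single_eq_same
  | maxPath u _ _ => exact Finsupp.single_eq_same
  | arrow α _ => exact Finsupp.single_eq_same

theorem BasisIndex.occurs_leading (hPc : ∀ p ∈ Pc, Q.IsCompleteAntiPath p)
    (hQc : ∀ p ∈ Qc, Q.IsCompletePath p) (b : Q.BasisIndex k T Pc Qc) (v : V) :
    b.Occurs (b.leading v) :=
  b.occurs_of_chain_ne_zero hPc hQc (by rw [b.chain_leading hPc hQc v]; exact one_ne_zero)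

/-- If a function vanishes at all pairs at which no other basis element than `b` occurs, except
possibly at the leading pair of `b`, and is a coboundary, then it vanishes there, too. -/
theorem BasisIndex.bardzellDiff_leading (hT : Q.IsSpanningTree T)
    (hPc : Q.IsTransversal {p | Q.IsCompleteAntiPath p} Pc)
    (hQc : Q.IsTransversal {q | Q.IsCompletePath q} Qc) (b : Q.BasisIndex k T Pc Qc)
    {Z : PathWord V E × PathWord V E → k}
    (hZ : ∀ x, (∀ b' : Q.BasisIndex k T Pc Qc, ¬ b'.Occurs x) →
      Q.bardzellDiff b.bidegree.2 Z x = 0) (v : V) :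
    Q.bardzellDiff b.bidegree.2 Z (b.leading v) = 0 := by
  have hPc' : ∀ p ∈ Pc, Q.IsCompleteAntiPath p := fun p hp => hPc.1 hp
  have hQc' : ∀ p ∈ Qc, Q.IsCompletePath p := fun p hp => hQc.1 hp
  have hocc : ∀ (b' : Q.BasisIndex k T Pc Qc) {x}, b'.Occurs x → Q.pairKind x = b'.kind :=
    fun b' _ h => b'.pairKind_of_occurs hPc' hQc' h
  cases b with
  | unit => exact bardzellDiff_of_none _ (lam_eq_none (Or.inl rfl)) (rho_eq_none (Or.inl rfl))
  | anti s p hp par =>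
    have hc := hPc' p hp
    by_cases hs : s = 0
    · simp only [leading, hs, if_true]
      refine bardzellDiff_of_none _ (lam_eq_none (Or.inr ?_)) (rho_eq_none (Or.inr ?_))
      · simpa [PathWord.trivial] using hc.isClosedWord.ne_nil
      · simpa [PathWord.trivial] using hc.isClosedWord.ne_nil
    · simp only [leading, hs, if_false]
      refine isCycleSystem_anti.bardzellDiff_W_eq_zero hc
        ((sign_anti hc).trans (sgn_eq_one par)) fun i hi => hZ _ fun b' hb' => ?_
      have hci := isCycleSystem_anti.rot_iterate hc (i + 1)
      have hk : b'.kind = 6 := by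
        rw [← hocc b' hb', pairKind_antiLoop hci.isClosedWord.ne_nil]
      cases b' with
      | anti s' p' hp' par' =>
        have hs' : s' ≠ 0 := by
          rintro rfl
          simp [kind] at hk
        simp only [Occurs, hs', if_false] at hb'
        -- Two representatives of one rotation class coincide, so `p` would be fixed by fewer
        -- rotations than its period.
        have h1 := antiLoop_inj hci (hPc' p' hp') hb'
        have h2 := hPc.eq_of_rot hp hp' (hPc' p' hp') (i := i + 1) (j := 0) h1 rfl
        exact Function.not_isPeriodicPt_of_pos_of_lt_minimalPeriod (by omega) hi
          (h1.trans h2.symm)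
      | path s' p' hp' par' =>
        simp only [kind] at hk
        split_ifs at hk <;> omega
      | _ => simp [kind] at hk
  | path s p hp par =>
    have hc := hQc' p hp
    by_cases hs : s = 0
    · simp only [leading, hs, if_true]
      exact bardzellDiff_of_none _ (lam_eq_none (Or.inl rfl)) (rho_eq_none (Or.inl rfl))
    · simp only [leading, hs, if_false]
      refine isCycleSystem_path.bardzellDiff_W_eq_zero hc
        ((sign_path hc).trans (sgn_eq_one par)) fun i hi => hZ _ fun b' hb' => ?_
      have hci := isCycleSystem_path.rot_iterate hc (i + 1)
      have hk : b'.kind = 7 := by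
        rw [← hocc b' hb', pairKind_pathLoop hci.isClosedWord.ne_nil]
      cases b' with
      | path s' p' hp' par' =>
        have hs' : s' ≠ 0 := by
          rintro rfl
          simp [kind] at hk
        simp only [Occurs, hs', if_false] at hb'
        have h1 := pathLoop_inj hci (hQc' p' hp') hb'
        have h2 := hQc.eq_of_rot hp hp' (hQc' p' hp') (i := i + 1) (j := 0) h1 rfl
        exact Function.not_isPeriodicPt_of_pos_of_lt_minimalPeriod (by omega) hi
          (h1.trans h2.symm)
      | anti s' p' hp' par' =>
        simp only [kind] at hk
        split_ifs at hk <;> omega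
      | _ => simp [kind] at hk
  | maxAnti u q hu hq =>
    refine bardzellDiff_of_none _ (lam_eq_none (Or.inr ?_)) (rho_eq_none (Or.inr ?_))
    · intro (h : u.arrows.head? = q.arrows.head?)
      obtain ⟨α, m, hm⟩ := List.exists_cons_of_ne_nil hu.2.1
      have h1 : u.arrows.head? = some α := by rw [hm]; rfl
      exact hq.2.2.2.1 α (h.symm.trans h1) h1
    · intro (h : u.arrows.getLast? = q.arrows.getLast?)
      obtain ⟨m, α, hm⟩ := (List.eq_nil_or_concat' _).resolve_left hu.2.1
      have h1 : u.arrows.getLast? = some α := by rw [hm]; simp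
      exact hq.2.2.2.2 α (h.symm.trans h1) h1
  | maxPath u hu hcl =>
    exact bardzellDiff_of_none _ (lam_eq_none (Or.inl rfl)) (rho_eq_none (Or.inl rfl))
  | arrow α hα =>
    -- No basis element occurs at a tree arrow, so `Z` is constant on vertices and its coboundary
    -- vanishes at every arrow.
    have h1 := bardzellDiff_const hT (Z := Z) fun β hβ => hZ _ fun b' hb' => by
      have hk : b'.kind = 5 := by
        rw [← hocc b' hb']
        simp [pairKind, arrowPair, arrowPath]
      cases b' with
      | arrow γ hγ =>
        obtain rfl := arrowPair_injective hb'
        exact hγ hβ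
      | anti s' p' hp' par' =>
        simp only [kind] at hk
        split_ifs at hk <;> omega
      | path s' p' hp' par' =>
        simp only [kind] at hk
        split_ifs at hk <;> omega
      | _ => simp [kind] at hk
    change Q.bardzellDiff 0 Z (Q.arrowPair α) = 0
    rw [bardzellDiff_arrowPair, h1, sub_self]

/-- At the leading pair of an index only its own chain contributes, with coefficient 1. The
right-hand side vanishes at all pairs where no basis element occurs, hence at the leading pair too.
-/
theorem BasisIndex.eq_zero_of_sum_chain (hT : Q.IsSpanningTree T)
    (hPc : Q.IsTransversal {p | Q.IsCompleteAntiPath p} Pc)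
    (hQc : Q.IsTransversal {q | Q.IsCompletePath q} Qc) {n : ℕ} {d : ℤ} {ι : Type*}
    {e : ι → Q.BasisIndex k T Pc Qc} (he : Function.Injective e) {s : Finset ι}
    (hs : ∀ i ∈ s, (e i).bidegree = (n, d)) {g : ι → k} {Z : PathWord V E × PathWord V E → k}
    (h : ∑ i ∈ s, g i • ⇑(e i).chain = Q.bardzellDiff d Z) {i : ι} (hi : i ∈ s) : g i = 0 := by
  have hPc' : ∀ p ∈ Pc, Q.IsCompleteAntiPath p := fun p hp => hPc.1 hp
  have hQc' : ∀ p ∈ Qc, Q.IsCompletePath p := fun p hp => hQc.1 hp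
  have hx : ∀ x, Q.bardzellDiff d Z x = ∑ i ∈ s, g i * (e i).chain x := by
    intro x
    rw [← h, Finset.sum_apply]
    rfl
  obtain ⟨v⟩ := hT.1
  have h1 := hx ((e i).leading v)
  rw [Finset.sum_eq_single_of_mem i hi, (e i).chain_leading hPc' hQc', mul_one] at h1
  · rw [← h1]
    have hd : (e i).bidegree.2 = d := by rw [hs i hi]
    rw [← (e i).bardzellDiff_leading hT hPc hQc (fun x hno => ?_) v, hd]
    rw [hd, hx]
    refine Finset.sum_eq_zero fun b' _ => ?_
    by_contra hne
    exact hno _ ((e b').occurs_of_chain_ne_zero hPc' hQc' (right_ne_zero_of_mul hne))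
  · intro b' _ hne
    by_contra hne'
    refine hne (he ?_)
    exact BasisIndex.eq_of_occurs hPc hQc
      ((e b').occurs_of_chain_ne_zero hPc' hQc' (right_ne_zero_of_mul hne'))
      ((e i).occurs_leading hPc' hQc' v)

end Independence

end QuadraticQuiver

/-! ### The total Hochschild complex -/

namespace Hochschild

variable {k B : Type*} [Field k] [Ring B] [Algebra k B] (𝒜 : ℤ → Submodule k B) [GradedAlgebra 𝒜]

/-- The differential preserves the internal degree, so the total complex is a product of the
complexes of fixed internal degree and the conditions on the components are independent. -/
theorem mem_totalCocycles {i : ℤ} {c : (n : ℕ) → Cochain k B n} :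
    c ∈ totalCocycles 𝒜 i ↔ ∀ n : ℕ, c n ∈ cocycles 𝒜 n (i - n) := by
  constructor
  · intro h n
    exact ⟨h.1 n, congrFun h.2 (n + 1)⟩
  · intro h
    refine ⟨fun n => (h n).1, funext fun n => ?_⟩
    cases n with
    | zero => rfl
    | succ n => exact (h n).2

theorem HH.mk_eq_zero_iff {n : ℕ} {d : ℤ} (f : cocycles 𝒜 n d) :
    HH.mk 𝒜 f = 0 ↔ f.1 ∈ coboundaries 𝒜 n d :=
  Submodule.Quotient.mk_eq_zero _

/-- The class of a total cocycle lies in the neighbourhood `W_j` if and only if its components of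
arity less than `j` are coboundaries. -/
theorem mk_mem_filtration_iff {i : ℤ} {j : ℕ} (c : totalCocycles 𝒜 i) :
    TotalHH.mk 𝒜 c ∈ filtration 𝒜 i j ↔ ∀ n < j, c.1 n ∈ coboundaries 𝒜 n (i - n) := by
  classical
  have hdeg : ∀ m : ℕ, i - 1 - (m : ℤ) = i - ((m + 1 : ℕ) : ℤ) := fun m => by push_cast; ring
  constructor
  · rintro ⟨g, hg, hgc⟩ n hn
    have h0 : g.1 n = 0 := by
      have hg' : g.1 ∈ ⨅ n ∈ Finset.range j, LinearMap.ker (LinearMap.proj n :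
        ((n : ℕ) → Cochain k B n) →ₗ[k] Cochain k B n) := hg
      simp only [Submodule.mem_iInf] at hg'
      exact hg' n (Finset.mem_range.2 hn)
    obtain ⟨e, he, hec⟩ : g.1 - c.1 ∈ totalCoboundaries 𝒜 i :=
      (Submodule.Quotient.eq ((totalCoboundaries 𝒜 i).submoduleOf (totalCocycles 𝒜 i))).1 hgc
    have h1 := congrFun hec n
    rw [Pi.sub_apply, h0, zero_sub] at h1
    rw [← neg_neg (c.1 n), ← h1]
    refine Submodule.neg_mem _ ?_
    cases n with
    | zero => exact Submodule.zero_mem _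
    | succ m =>
      have h2 := he m
      rw [hdeg] at h2
      refine ⟨e m, h2, ?_⟩
      change _ = differential 𝒜 (i - 1 - m) m (e m)
      rw [hdeg]
  · intro h
    -- Primitives are chosen only in arities below `j`; subtracting their differentials truncates
    -- `c` without changing its class.
    have h' : ∀ m : ℕ, ∃ e : Cochain k B m, e ∈ homogeneous 𝒜 m (i - 1 - m) ∧
        differential 𝒜 (i - 1 - m) m e = if m + 1 < j then c.1 (m + 1) else 0 := by
      intro m
      by_cases hm : m + 1 < j
      · obtain ⟨e, he, hec⟩ := h (m + 1) hm
        rw [hdeg, if_pos hm]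
        exact ⟨e, he, hec⟩
      · exact ⟨0, Submodule.zero_mem _, by rw [if_neg hm, map_zero]⟩
    choose e he hec using h'
    have hgc : (fun n => if n < j then 0 else c.1 n) ∈ totalCocycles 𝒜 i := by
      refine (mem_totalCocycles 𝒜).2 fun n => ?_
      split_ifs
      · exact Submodule.zero_mem _
      · exact (mem_totalCocycles 𝒜).1 c.2 n
    refine ⟨⟨_, hgc⟩, ?_, (Submodule.Quotient.eq _).2 ?_⟩
    · change (fun n => if n < j then 0 else c.1 n) ∈ ⨅ n ∈ Finset.range j, LinearMap.ker
        (LinearMap.proj n : ((n : ℕ) → Cochain k B n) →ₗ[k] Cochain k B n)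
      simp only [Submodule.mem_iInf]
      intro n hn
      exact if_pos (Finset.mem_range.1 hn)
    · change (fun n => if n < j then 0 else c.1 n) - c.1 ∈ totalCoboundaries 𝒜 i
      refine ⟨fun m => - e m, fun m => Submodule.neg_mem _ (he m), funext fun n => ?_⟩
      cases n with
      | zero =>
        change 0 = (if 0 < j then 0 else c.1 0) - c.1 0
        split_ifs with h0
        · rw [zero_sub, (Submodule.mem_bot k).1 (h 0 h0), neg_zero]
        · rw [sub_self]
      | succ m =>
        change differential 𝒜 (i - 1 - m) m (- e m) = (if m + 1 < j then 0 else c.1 (m + 1)) -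
          c.1 (m + 1)
        rw [map_neg, hec]
        split_ifs
        · rw [zero_sub]
        · rw [sub_self, neg_zero]

end Hochschild

namespace QuadraticQuiver

variable {V E : Type*} {Q : QuadraticQuiver V E} {k : Type*} [Field k]

/-! ### Bases of Hochschild cohomology -/

theorem pathDeg_of_coeff_ne_zero [Fintype V] {e : ℤ} {a : Q.Alg k} (ha : a ∈ Q.grading k e)
    {q : PathWord V E} (hq : Q.coeff k q a ≠ 0) : Q.pathDeg q = e := by
  by_contra hne
  have : Q.grading k e ≤ LinearMap.ker (Q.coeff k q) := by
    refine Submodule.span_le.2 ?_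
    rintro _ ⟨p, hp, rfl⟩
    rw [SetLike.mem_coe, LinearMap.mem_ker, basis_eq, coeff_pathElem p.2, if_neg]
    rintro rfl
    exact hne hp
  exact hq (this ha)

theorem finite_coeff_ne_zero (a : Q.Alg k) : {q | Q.coeff k q a ≠ 0}.Finite := by
  refine (((Q.basis k).repr a).support.finite_toSet.image Subtype.val).subset fun q hq => ?_
  by_cases h : Q.IsPathOfA q
  · refine ⟨⟨q, h⟩, ?_, rfl⟩
    rw [Set.mem_ofPred_eq, coeff, dif_pos h] at hq
    simpa using hq
  · rw [Set.mem_ofPred_eq, coeff, dif_neg h] at hq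
    exact absurd rfl hq

section Bases

variable [Fintype V] {n : ℕ} {d : ℤ}

theorem isPairOf_of_restr_ne_zero {f : Cochain k (Q.Alg k) n}
    (hf : f ∈ homogeneous (Q.grading k) n d) {x : PathWord V E × PathWord V E}
    (hx : restr f x ≠ 0) : Q.IsPairOf n d x := by
  have hp : Q.IsPair x := by
    by_contra h
    exact hx (restr_of_not f h)
  have hn : x.1.arrows.length = n := by
    by_contra h
    exact hx (restr_of_length f h)
  rw [restr_of_isPair f hp] at hx
  have := pathDeg_of_coeff_ne_zero (onWords_mem_grading hf _) hx
  rw [listDeg_map_arrowPath] at this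
  refine ⟨hp, hn, ?_⟩
  rw [this, pathDeg]
  ring

/-- There are finitely many words of length `n`, and each value is a finite combination of paths,
although A itself may have infinite dimension. -/
theorem finite_support_restr [Finite E] (f : Cochain k (Q.Alg k) n) :
    (Function.support (restr f)).Finite := by
  have h1 : {p : PathWord V E | p.arrows.length = n}.Finite := by
    have h := (Set.finite_univ (α := V)).prod ((Set.finite_univ (α := V)).prod
      (List.finite_length_eq E n))
    refine (h.image fun x : V × V × List E => (⟨x.1, x.2.1, x.2.2⟩ : PathWord V E)).subset ?_
    exact fun p hp => ⟨(p.tgt, p.src, p.arrows), ⟨trivial, trivial, hp⟩, rfl⟩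
  refine (h1.biUnion fun p _ => (finite_coeff_ne_zero
    (onWords f (p.arrows.map Q.arrowPath))).image fun q => (p, q)).subset fun x hx => ?_
  have hn : x.1.arrows.length = n := by
    by_contra h
    exact hx (restr_of_length f h)
  have hp : Q.IsPair x := by
    by_contra h
    exact hx (restr_of_not f h)
  refine Set.mem_biUnion hn ⟨x.2, ?_, rfl⟩
  rwa [Function.mem_support, restr_of_isPair f hp] at hx

theorem coboundaries_le_cocycles :
    coboundaries (Q.grading k) n d ≤ cocycles (Q.grading k) n d := by
  cases n with
  | zero => exact bot_le
  | succ n =>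
    rintro _ ⟨f, hf, rfl⟩
    exact ⟨differential_mem_homogeneous hf, differential_differential _ d f⟩

theorem exists_bardzellDiff_of_mem_coboundaries {f : Cochain k (Q.Alg k) n}
    (hf : f ∈ coboundaries (Q.grading k) n d) :
    ∃ Z : PathWord V E × PathWord V E → k, restr f = Q.bardzellDiff d Z := by
  cases n with
  | zero =>
    obtain rfl : f = 0 := hf
    exact ⟨0, ((Q.restrLin k 0).map_zero).trans (Q.bardzellLin k d).map_zero.symm⟩
  | succ n =>
    obtain ⟨g, -, rfl⟩ := hf
    exact ⟨sgn k d • restr g, (restr_differential d g).trans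
      ((Q.bardzellLin k d).map_smul (sgn k d) (restr g)).symm⟩

variable {T : Set E} {Pc Qc : Set (PathWord V E)}

theorem restr_cochain (hPc : Q.IsTransversal {p | Q.IsCompleteAntiPath p} Pc)
    (hQc : Q.IsTransversal {q | Q.IsCompletePath q} Qc) {b : Q.BasisIndex k T Pc Qc}
    (hb : b.bidegree = (n, d)) : restr (b.cochain n) = b.chain := by
  have := b.isChainOf_chain (fun p hp => hPc.1 hp) fun p hp => hQc.1 hp
  rw [hb] at this
  exact restr_toHochschild this

theorem cochain_mem_cocycles (hQ : Q.IsGentle)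
    (hPc : Q.IsTransversal {p | Q.IsCompleteAntiPath p} Pc)
    (hQc : Q.IsTransversal {q | Q.IsCompletePath q} Qc) {b : Q.BasisIndex k T Pc Qc}
    (hb : b.bidegree = (n, d)) : b.cochain n ∈ cocycles (Q.grading k) n d := by
  have h1 := b.isChainOf_chain (fun p hp => hPc.1 hp) fun p hp => hQc.1 hp
  have h2 := b.bardzellDiff_chain hQ (fun p hp => hPc.1 hp) fun p hp => hQc.1 hp
  rw [hb] at h1 h2
  exact toHochschild_mem_cocycles h1 h2

theorem cochain_eq_zero (hPc : Q.IsTransversal {p | Q.IsCompleteAntiPath p} Pc)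
    (hQc : Q.IsTransversal {q | Q.IsCompletePath q} Qc) {b : Q.BasisIndex k T Pc Qc}
    (hb : b.bidegree.1 ≠ n) : b.cochain n = 0 := by
  have h1 := b.isChainOf_chain (fun p hp => hPc.1 hp) fun p hp => hQc.1 hp
  rw [BasisIndex.cochain, toHochschild_eq_sum]
  refine Finset.sum_eq_zero fun x hx => ?_
  rw [pairCochain, if_neg, smul_zero]
  exact fun h => hb ((h1 x hx).2.1.symm.trans h)

theorem eq_zero_of_sum_cochain (hT : Q.IsSpanningTree T)
    (hPc : Q.IsTransversal {p | Q.IsCompleteAntiPath p} Pc)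
    (hQc : Q.IsTransversal {q | Q.IsCompletePath q} Qc) {ι : Type*}
    {e : ι → Q.BasisIndex k T Pc Qc} (he : Function.Injective e) {s : Finset ι}
    (hs : ∀ i ∈ s, (e i).bidegree = (n, d)) {g : ι → k}
    (h : ∑ i ∈ s, g i • (e i).cochain n ∈ coboundaries (Q.grading k) n d) {i : ι} (hi : i ∈ s) :
    g i = 0 := by
  obtain ⟨Z, hZ⟩ := exists_bardzellDiff_of_mem_coboundaries h
  refine BasisIndex.eq_zero_of_sum_chain hT hPc hQc he hs (g := g) (Z := Z) ?_ hi
  rw [← hZ]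
  change _ = Q.restrLin k n _
  rw [map_sum]
  refine Finset.sum_congr rfl fun i hi => ?_
  rw [map_smul]
  exact congrArg (g i • ·) (restr_cochain hPc hQc (hs i hi)).symm

/-- The restriction of `f` is a Bardzell cocycle of finite support, hence the restriction of a
combination of basis cochains and coboundaries; the difference to `f` is a cocycle with restriction
zero. -/
theorem exists_sum_cochain [Finite E] (hQ : Q.IsGentle) (hT : Q.IsSpanningTree T)
    (hPc : Q.IsTransversal {p | Q.IsCompleteAntiPath p} Pc)
    (hQc : Q.IsTransversal {q | Q.IsCompletePath q} Qc) {f : Cochain k (Q.Alg k) n}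
    (hf : f ∈ cocycles (Q.grading k) n d) :
    ∃ l : {b : Q.BasisIndex k T Pc Qc // b.bidegree = (n, d)} →₀ k,
      f - ∑ b ∈ l.support, l b • b.1.cochain n ∈ coboundaries (Q.grading k) n d := by
  let v : {b : Q.BasisIndex k T Pc Qc // b.bidegree = (n, d)} → Cochain k (Q.Alg k) n :=
    fun b => b.1.cochain n
  let S := Submodule.span k (Set.range v) ⊔ coboundaries (Q.grading k) n d
  have hS : S ≤ cocycles (Q.grading k) n d := by
    refine sup_le (Submodule.span_le.2 ?_) coboundaries_le_cocycles
    rintro _ ⟨b, rfl⟩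
    exact cochain_mem_cocycles hQ hPc hQc b.2
  have hle : Q.chainSpan k T Pc Qc n d ≤ S.map (Q.restrLin k n) := by
    refine Submodule.span_le.2 ?_
    rintro _ (⟨b, hb, rfl⟩ | ⟨m, y, rfl, hy, rfl⟩)
    · exact ⟨b.cochain n, Submodule.mem_sup_left (Submodule.subset_span ⟨⟨b, hb⟩, rfl⟩),
        restr_cochain hPc hQc hb⟩
    · have hc := isChainOf_single hy (1 : k)
      refine ⟨sgn k d • differential (Q.grading k) d m
        (Q.toHochschild k m (Finsupp.single y 1)), Submodule.smul_mem _ _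
          (Submodule.mem_sup_right ⟨_, toHochschild_mem_homogeneous hc, rfl⟩), ?_⟩
      rw [map_smul]
      change sgn k d • restr _ = _
      rw [restr_differential, restr_toHochschild hc, smul_smul, sgn_mul_self, one_smul]
      rfl
  have hD : Q.bardzellDiff d (restr f) = 0 := by
    have h1 := restr_differential d f
    rw [LinearMap.mem_ker.1 hf.2] at h1
    have h2 : restr (0 : Cochain k (Q.Alg k) (n + 1)) = (0 : PathWord V E × PathWord V E → k) :=
      (Q.restrLin k (n + 1)).map_zero
    exact (smul_eq_zero.1 (h1.symm.trans h2)).resolve_left (sgn_ne_zero d)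
  obtain ⟨g, hg, hgf⟩ := hle (mem_chainSpan hQ hT hPc hQc hD
    (fun x hx => isPairOf_of_restr_ne_zero hf.1 hx) (finite_support_restr f))
  have hfg : f - g ∈ coboundaries (Q.grading k) n d := by
    refine mem_coboundaries_of_restr (Submodule.sub_mem _ hf (hS hg)) ?_
    change Q.restrLin k n (f - g) = 0
    rw [map_sub, hgf]
    exact sub_self _
  obtain ⟨y, hy, z, hz, rfl⟩ := Submodule.mem_sup.1 hg
  obtain ⟨l, hl⟩ := Finsupp.mem_span_range_iff_exists_finsupp.1 hy
  refine ⟨l, ?_⟩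
  have e : f - ∑ b ∈ l.support, l b • b.1.cochain n = (f - (y + z)) + z := by
    rw [← hl, Finsupp.sum]
    abel
  rw [e]
  exact Submodule.add_mem _ hfg hz

end Bases

end QuadraticQuiver

end

/-! ### Assembly of the basis and of the Schauder basis -/

open QuadraticQuiver Hochschild in
theorem mainTheorem1 {k V E : Type*} [Field k] [Fintype V] [Finite E]
    (Q : QuadraticQuiver V E) (hQ : Q.IsGentle) (hloop : ¬ Q.IsLoop)
    (hkron : ¬ Q.IsKronecker) (T : Set E) (hT : Q.IsSpanningTree T)
    (Pc Qc : Set (PathWord V E))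
    (hPc : Q.IsTransversal {p | Q.IsCompleteAntiPath p} Pc)
    (hQc : Q.IsTransversal {q | Q.IsCompletePath q} Qc) :
    (∀ (n : ℕ) (d : ℤ),
      ∃ h : ∀ b : Q.BasisIndex k T Pc Qc, b.bidegree = (n, d) →
          b.cochain n ∈ cocycles (Q.grading k) n d,
        let v := fun b : {b : Q.BasisIndex k T Pc Qc // b.bidegree = (n, d)} =>
          HH.mk (Q.grading k) ⟨b.1.cochain n, h b.1 b.2⟩
        LinearIndependent k v ∧ Submodule.span k (Set.range v) = ⊤) ∧
    (∀ i : ℤ,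
      ∃ h : ∀ b : Q.BasisIndex k T Pc Qc, b.totalDegree = i →
          b.cochain ∈ totalCocycles (Q.grading k) i,
        IsSchauderBasis (Q.grading k)
          fun b : {b : Q.BasisIndex k T Pc Qc // b.totalDegree = i} =>
            TotalHH.mk (Q.grading k) ⟨b.1.cochain, h b.1 b.2⟩) := by
  classical
  constructor
  · intro n d
    refine ⟨fun b hb => cochain_mem_cocycles hQ hPc hQc hb, ?_⟩
    intro v
    have hsum : ∀ (s : Finset {b : Q.BasisIndex k T Pc Qc // b.bidegree = (n, d)})
        (g : {b : Q.BasisIndex k T Pc Qc // b.bidegree = (n, d)} → k),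
        ∑ b ∈ s, g b • v b = HH.mk (Q.grading k) (∑ b ∈ s, g b •
          (⟨b.1.cochain n, cochain_mem_cocycles hQ hPc hQc b.2⟩ : cocycles (Q.grading k) n d)) := by
      intro s g
      have := map_sum ((coboundaries (Q.grading k) n d).submoduleOf
        (cocycles (Q.grading k) n d)).mkQ (fun b => g b •
          (⟨b.1.cochain n, cochain_mem_cocycles hQ hPc hQc b.2⟩ : cocycles (Q.grading k) n d)) s
      exact this.symm
    constructor
    · rw [linearIndependent_iff']
      intro s g hg b hb
      rw [hsum, HH.mk_eq_zero_iff] at hg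
      refine eq_zero_of_sum_cochain hT hPc hQc Subtype.val_injective (fun b _ => b.2)
        (g := g) ?_ hb
      simpa using hg
    · refine eq_top_iff.2 fun z _ => ?_
      obtain ⟨f, rfl⟩ := Submodule.Quotient.mk_surjective _ z
      obtain ⟨l, hl⟩ := exists_sum_cochain hQ hT hPc hQc f.2
      have h1 : HH.mk (Q.grading k) f = ∑ b ∈ l.support, l b • v b := by
        rw [hsum]
        refine (Submodule.Quotient.eq _).2 ?_
        change (f - _ : cocycles (Q.grading k) n d).1 ∈ coboundaries (Q.grading k) n d
        simpa using hl
      change HH.mk (Q.grading k) f ∈ _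
      rw [h1]
      exact Submodule.sum_mem _ fun b _ => Submodule.smul_mem _ _ (Submodule.subset_span ⟨b, rfl⟩)
  · intro i
    have hbi : ∀ {b : Q.BasisIndex k T Pc Qc} {n : ℕ}, b.totalDegree = i → b.bidegree.1 = n →
        b.bidegree = (n, i - n) := by
      intro b n h1 h2
      refine Prod.ext h2 ?_
      rw [← h1, BasisIndex.totalDegree, h2]
      ring
    have hcoc : ∀ b : Q.BasisIndex k T Pc Qc, b.totalDegree = i →
        b.cochain ∈ totalCocycles (Q.grading k) i := by
      intro b hb
      refine (mem_totalCocycles _).2 fun n => ?_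
      by_cases hn : b.bidegree.1 = n
      · exact cochain_mem_cocycles hQ hPc hQc (hbi hb hn)
      · rw [cochain_eq_zero hPc hQc hn]
        exact Submodule.zero_mem _
    refine ⟨hcoc, fun z => ?_⟩
    obtain ⟨c, rfl⟩ := Submodule.Quotient.mk_surjective _ z
    -- Membership in `W_j` is tested arity by arity, and in arity `n` only the basis elements of
    -- that arity contribute.
    have hfil : ∀ (a : {b : Q.BasisIndex k T Pc Qc // b.totalDegree = i} → k) (j : ℕ)
        (F : Finset {b : Q.BasisIndex k T Pc Qc // b.totalDegree = i}),
        TotalHH.mk (Q.grading k) c - ∑ b ∈ F, a b • TotalHH.mk (Q.grading k)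
          ⟨b.1.cochain, hcoc b.1 b.2⟩ ∈ filtration (Q.grading k) i j ↔
        ∀ n < j, c.1 n - ∑ b ∈ F with b.1.bidegree.1 = n, a b • b.1.cochain n ∈
          coboundaries (Q.grading k) n (i - n) := by
      intro a j F
      have h1 : TotalHH.mk (Q.grading k) c - ∑ b ∈ F, a b • TotalHH.mk (Q.grading k)
          ⟨b.1.cochain, hcoc b.1 b.2⟩ = TotalHH.mk (Q.grading k) (c - ∑ b ∈ F, a b •
            (⟨b.1.cochain, hcoc b.1 b.2⟩ : totalCocycles (Q.grading k) i)) := by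
        have := map_sum ((totalCoboundaries (Q.grading k) i).submoduleOf
          (totalCocycles (Q.grading k) i)).mkQ (fun b => a b •
            (⟨b.1.cochain, hcoc b.1 b.2⟩ : totalCocycles (Q.grading k) i)) F
        exact (congrArg (TotalHH.mk (Q.grading k) c - ·) this.symm).trans
          (map_sub ((totalCoboundaries (Q.grading k) i).submoduleOf
            (totalCocycles (Q.grading k) i)).mkQ _ _).symm
      rw [h1, mk_mem_filtration_iff]
      refine forall₂_congr fun n _ => ?_
      have h2 : (c - ∑ b ∈ F, a b •
            (⟨b.1.cochain, hcoc b.1 b.2⟩ : totalCocycles (Q.grading k) i)).1 n =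
          c.1 n - ∑ b ∈ F with b.1.bidegree.1 = n, a b • b.1.cochain n := by
        rw [Finset.sum_filter_of_ne fun b _ hne => by
          by_contra hn
          exact hne (by rw [cochain_eq_zero hPc hQc hn, smul_zero])]
        simp
      rw [h2]
    choose l hl using fun n : ℕ =>
      exists_sum_cochain (T := T) hQ hT hPc hQc ((mem_totalCocycles _).1 c.2 n)
    -- The coefficient of a basis element is taken from the finite expansion of the component of `c`
    -- in its own arity.
    let a : {b : Q.BasisIndex k T Pc Qc // b.totalDegree = i} → k := fun b =>
      l b.1.bidegree.1 ⟨b.1, hbi b.2 rfl⟩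
    have hex : ∀ j : ℕ, ∀ᶠ F in Filter.atTop, TotalHH.mk (Q.grading k) c -
        ∑ b ∈ F, a b • TotalHH.mk (Q.grading k) ⟨b.1.cochain, hcoc b.1 b.2⟩ ∈
          filtration (Q.grading k) i j := by
      intro j
      have htot : ∀ (n : ℕ) (b : {b : Q.BasisIndex k T Pc Qc // b.bidegree = (n, i - n)}),
          b.1.totalDegree = i := by
        intro n b
        rw [BasisIndex.totalDegree, b.2]
        ring
      -- Only arities below `j` matter, each with a finite expansion, so a finite set suffices.
      let F₀ := (Finset.range j).biUnion fun n => (l n).support.image fun b =>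
        (⟨b.1, htot n b⟩ : {b : Q.BasisIndex k T Pc Qc // b.totalDegree = i})
      filter_upwards [Filter.eventually_ge_atTop F₀] with F hF
      rw [hfil]
      intro n hn
      convert hl n using 2
      symm
      refine Finset.sum_of_injOn (fun b => ⟨b.1, htot n b⟩) ?_ ?_ ?_ ?_
      · intro b _ b' _ h
        exact Subtype.ext (congrArg (fun b => b.1) h)
      · intro b hb
        simp only [Finset.coe_filter, Set.mem_ofPred_eq]
        exact ⟨hF (Finset.mem_biUnion.2 ⟨n, Finset.mem_range.2 hn,
          Finset.mem_image.2 ⟨b, hb, rfl⟩⟩), by rw [b.2]⟩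
      · intro b hb hb'
        obtain ⟨-, rfl⟩ := Finset.mem_filter.1 hb
        have : a b = 0 := by
          by_contra hne
          exact hb' ⟨⟨b.1, hbi b.2 rfl⟩, Finsupp.mem_support_iff.2 hne, rfl⟩
        rw [this, zero_smul]
      · intro b _
        obtain ⟨b, hb⟩ := b
        obtain rfl : b.bidegree.1 = n := by rw [hb]
        rfl
    refine ⟨a, hex, fun a' ha' => funext fun b => ?_⟩
    -- The neighbourhood `W_j` controls arities strictly below `j`, so `j` is taken one larger than
    -- the arity of `b`. Both expansions then agree modulo coboundaries in that arity, and
    -- independence equates the coefficients.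
    obtain ⟨F, ⟨h1, h2⟩, h3⟩ := (((ha' (b.1.bidegree.1 + 1)).and (hex (b.1.bidegree.1 + 1))).and
      (Filter.eventually_ge_atTop {b})).exists
    have h4 := (hfil _ _ _).1 h1 b.1.bidegree.1 (Nat.lt_succ_self _)
    have h5 := (hfil _ _ _).1 h2 b.1.bidegree.1 (Nat.lt_succ_self _)
    have h6 := Submodule.sub_mem _ h5 h4
    rw [sub_sub_sub_cancel_left, ← Finset.sum_sub_distrib] at h6
    simp only [← sub_smul] at h6
    refine sub_eq_zero.1 (eq_zero_of_sum_cochain hT hPc hQc Subtype.val_injective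
      (fun b' hb' => hbi b'.2 (Finset.mem_filter.1 hb').2) h6
      (Finset.mem_filter.2 ⟨h3 (Finset.mem_singleton_self b), rfl⟩))
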